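/- **Theorem (Product formula on $SL(2,\mathbb R)$).** Let $\mathbb H$ be the upper half-plane with its hyperbolic distance $d$, and let $\Gamma\subset SL(2,\mathbb R)$ be a convex cocompact subgroup: $\Gamma$ is discrete and torsion-free, its discontinuity set $\Omega(\Gamma)=\partial\mathbb H\setminus\Lambda(\Gamma)$ is non-empty (here $\partial\mathbb H=\mathbb R\cup\{\infty\}$ and $\Lambda(\Gamma)=\overline{\Gamma x}\cap\partial\mathbb H$, $x\in\mathbb H$, is the limit set), and $\Gamma$ acts freely and cocompactly on $\mathbb H\cup\Omega(\Gamma)$. Let $\delta=\delta(\Gamma)$ be the infimum of all $s>0$ for which $\sum_{\gamma\in\Gamma}e^{-s\,d(x,\gamma y)}$ converges ($x,y\in\mathbb H$), and assume $\delta<\tfrac12$. Let $k\in\{0,1,-1\}$. For $\gamma=\begin{pmatrix}a&b\\c&d\end{pmatrix}$ put $j(\gamma,z)=cz+d$. For $z,z'\in\mathbb H$, $\zeta\in\mathbb R$ put $$P_k(z,\zeta;s)=\left(\frac{\overline z-\zeta}{z-\zeta}\right)^{k}\left(\frac{\operatorname{Im} z}{|\overline z-\zeta|^2}\right)^{s},\qquad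 E(z,\zeta;k,s)=\sum_{\gamma\in\Gamma} j(\gamma,z)^{-k}\,\overline{j(\gamma,z)}^{\,k}\,P_k(\gamma z,\zeta;s),$$ $$u=u(z,z')=\frac{|z-z'|^2}{4\operatorname{Im}z\operatorname{Im}z'},\qquad H_k(z,z')=\left(\frac{\overline z-z'}{\overline{z'}-z}\right)^{k},$$ $$K(z,z';k,s)=\frac{\sqrt\pi\,\Gamma(\frac12-s)}{\Gamma(1-s)}\,4^{-s}\,\frac{s}{s-|k|}\,H_k(z,z')\,u^{|k|-s}(1+u)^{-|k|}F\!\left(s-|k|,s-|k|;2s;-u^{-1}\right),$$ $$G(z,z';k,s)=\sum_{\gamma\in\Gamma} j(\gamma,z')^{k}\,\overline{j(\gamma,z')}^{\,-k}\,K(z,\gamma z';k,s),$$ where $F$ is the Gauss hypergeometric function (analytically continued along the negative real axis). Let $z,z'\in\mathbb H$ with $z\notin\Gamma z'$, and let $\delta<\operatorname{Re}s<1-\delta$. Then the series $E(z,\zeta;k,s)$ and $E(z',\zeta;-k,1-s)$ converge absolutely for every $\zeta\in\Omega(\Gamma)\cap\mathbb R$, and, if $s\ne\frac12$, so do the series $G(z,z';k,s)$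 and $G(z,z';k,1-s)$. The action of $\Gamma$ on $\Omega(\Gamma)$ has a measurable fundamental domain $D\subset\mathbb R$ (up to null sets), and for every such $D$ the function $\zeta\mapsto E(z,\zeta;k,s)\,E(z',\zeta;-k,1-s)$ is integrable on $D$ and $$\int_{\Gamma\backslash\Omega(\Gamma)}E(z,\zeta;k,s)\,E(z',\zeta;-k,1-s)\,d\zeta:=\int_{D}E(z,\zeta;k,s)\,E(z',\zeta;-k,1-s)\,d\zeta=G(z,z';k,s)+G(z,z';k,1-s).$$ At $s=\frac12$, where both Green functions have a pole, the right-hand side is to be read as its limit $\lim_{t\to 1/2,\ t\neq 1/2}\bigl[G(z,z';k,t)+G(z,z';k,1-t)\bigr]$, which exists and equals the integral. -/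

import Mathlib

open scoped UpperHalfPlane ComplexConjugate

noncomputable section

namespace HypProduct

/-- The group `SL(2, ℝ)`. -/
abbrev SL2R : Type := Matrix.SpecialLinearGroup (Fin 2) ℝ

/-- The action of `SL(2, ℝ)` on the Riemann sphere `ℂ ∪ {∞}` by Möbius transformations. -/
def sphereAct (γ : SL2R) (p : OnePoint ℂ) : OnePoint ℂ :=
  Matrix.SpecialLinearGroup.mapGL ℂ γ • p

/-- The action of `SL(2, ℝ)` on the boundary `∂ℍ = ℝ ∪ {∞}` by Möbius transformations. -/
def bdryAct (γ : SL2R) (p : OnePoint ℝ) : OnePoint ℝ :=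
  Matrix.SpecialLinearGroup.mapGL ℝ γ • p

/-- The inclusion of `∂ℍ = ℝ ∪ {∞}` into the Riemann sphere. -/
def bdryToSphere : OnePoint ℝ → OnePoint ℂ := OnePoint.map (fun x : ℝ => (x : ℂ))

/-- The limit set `Λ(Γ) ⊆ ∂ℍ`: the boundary points in the closure (in the Riemann sphere) of an
orbit `Γ x`, `x ∈ ℍ` (it does not depend on `x`; we take `x = i`). -/
def limitSet (Γ : Subgroup SL2R) : Set (OnePoint ℝ) :=
  {p | bdryToSphere p ∈
    closure {q : OnePoint ℂ | ∃ γ ∈ Γ, q = (((γ • UpperHalfPlane.I : ℍ) : ℂ) : OnePoint ℂ)}}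

/-- The discontinuity set `Ω(Γ) = ∂ℍ ∖ Λ(Γ)`. -/
def discontinuitySet (Γ : Subgroup SL2R) : Set (OnePoint ℝ) := (limitSet Γ)ᶜ

/-- The space `ℍ ∪ Ω(Γ)`, as a subspace of the Riemann sphere. -/
def extendedPlane (Γ : Subgroup SL2R) : Set (OnePoint ℂ) :=
  {q | ∃ z : ℍ, q = ((z : ℂ) : OnePoint ℂ)} ∪ bdryToSphere '' discontinuitySet Γ

/-- Convex cocompact subgroups of `SL(2, ℝ)`: discrete, torsion-free subgroups with nonempty
discontinuity set that act freely and cocompactly on `ℍ ∪ Ω(Γ)`. -/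
structure IsConvexCocompact (Γ : Subgroup SL2R) : Prop where
  discrete : DiscreteTopology Γ
  torsionFree : ∀ γ ∈ Γ, IsOfFinOrder γ → γ = 1
  nonempty : (discontinuitySet Γ).Nonempty
  free : ∀ γ ∈ Γ, γ ≠ 1 → ∀ p ∈ extendedPlane Γ, sphereAct γ p ≠ p
  cocompact : ∃ K : Set (OnePoint ℂ), IsCompact K ∧ K ⊆ extendedPlane Γ ∧
    ∀ p ∈ extendedPlane Γ, ∃ γ ∈ Γ, sphereAct γ p ∈ K

/-- The critical exponent `δ(Γ)`: the infimum of all `s > 0` for which the Poincaré series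
`∑_{γ ∈ Γ} exp (-s d(x, γ y))` converges (`d` is the hyperbolic distance; convergence does not
depend on `x, y`). It is an extended real, so that the infimum of the empty set is `∞`. -/
def criticalExponent (Γ : Subgroup SL2R) : EReal :=
  sInf ((fun s : ℝ => (s : EReal)) ''
    {s : ℝ | 0 < s ∧ ∀ x y : ℍ,
      Summable fun γ : Γ => Real.exp (-s * dist x ((γ : SL2R) • y))})

/-- The automorphy factor `j(γ, z) = c z + d`. -/
def autFactor (γ : SL2R) (z : ℍ) : ℂ := ((γ 1 0 : ℝ) : ℂ) * (z : ℂ) + ((γ 1 1 : ℝ) : ℂ)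

/-- The Poisson kernel `P(z, ζ) = Im z / |z̄ - ζ|²`. -/
def poissonKernel (z : ℍ) (ζ : ℝ) : ℝ := z.im / ‖conj (z : ℂ) - (ζ : ℂ)‖ ^ 2

/-- The Poisson kernel of weight `k`,
`P_k(z, ζ; s) = (z̄ - ζ)^k (z - ζ)^(-k) P(z, ζ)^s`. -/
def weightPoisson (k : ℤ) (s : ℂ) (z : ℍ) (ζ : ℝ) : ℂ :=
  (conj (z : ℂ) - (ζ : ℂ)) ^ k * ((z : ℂ) - (ζ : ℂ)) ^ (-k) * (poissonKernel z ζ : ℂ) ^ s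

/-- The term of the Eisenstein series of weight `k` belonging to `γ`:
`j(γ, z)^(-k) conj(j(γ, z))^k P_k(γ z, ζ; s)`. -/
def eisensteinTerm (k : ℤ) (s : ℂ) (z : ℍ) (ζ : ℝ) (γ : SL2R) : ℂ :=
  autFactor γ z ^ (-k) * conj (autFactor γ z) ^ k * weightPoisson k s (γ • z) ζ

/-- The Eisenstein series `E(z, ζ; k, s)` of weight `k`. -/
def eisenstein (Γ : Subgroup SL2R) (k : ℤ) (s : ℂ) (z : ℍ) (ζ : ℝ) : ℂ :=
  ∑' γ : Γ, eisensteinTerm k s z ζ γ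

/-- The point-pair invariant `u(z, w) = |z - w|² / (4 Im z Im w)`. -/
def pairInvariant (z w : ℍ) : ℝ := ‖(z : ℂ) - (w : ℂ)‖ ^ 2 / (4 * z.im * w.im)

/-- The weight factor `H_k(z, w) = (z̄ - w)^k (w̄ - z)^(-k)`; note `H_k(z, z) = 1`. -/
def weightFactor (k : ℤ) (z w : ℍ) : ℂ :=
  (conj (z : ℂ) - (w : ℂ)) ^ k * (conj (w : ℂ) - (z : ℂ)) ^ (-k)

/-- The Gauss hypergeometric function `F(a, b; c; x)` for real `x < 1`: the Gauss series where
`|x| < 1`, and for `x ≤ -1` its analytic continuation along the negative real axis, given by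
Pfaff's formula `F(a, b; c; x) = (1 - x)^(-a) F(a, c - b; c; x / (x - 1))`, in which
`x / (x - 1) ∈ [1/2, 1)`. (Mathlib's `ordinaryHypergeometric` is the bare sum of the series.) -/
def gaussF (a b c : ℂ) (x : ℝ) : ℂ :=
  if |x| < 1 then ordinaryHypergeometric a b c (x : ℂ)
  else ((1 - x : ℝ) : ℂ) ^ (-a) * ordinaryHypergeometric a (c - b) c ((x / (x - 1) : ℝ) : ℂ)

/-- The weight-`k` kernel `K(z, w; k, s)` on `ℍ × ℍ` off the diagonal:
`√π Γ(1/2 - s) / Γ(1 - s) * 4^(-s) * s / (s - |k|) * H_k(z, w) * u^(|k| - s) (1 + u)^(-|k|)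
  * F(s - |k|, s - |k|; 2 s; -1 / u)`, with `u = u(z, w)`. -/
def greenKernel (k : ℤ) (s : ℂ) (z w : ℍ) : ℂ :=
  (Real.sqrt Real.pi : ℂ) * Complex.Gamma (1 / 2 - s) / Complex.Gamma (1 - s)
    * (4 : ℂ) ^ (-s) * (s / (s - (|k| : ℤ))) * weightFactor k z w
    * (pairInvariant z w : ℂ) ^ (((|k| : ℤ) : ℂ) - s) * (1 + (pairInvariant z w : ℂ)) ^ (-|k|)
    * gaussF (s - (|k| : ℤ)) (s - (|k| : ℤ)) (2 * s) (-(pairInvariant z w)⁻¹)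

/-- The term of the automorphic Green function of weight `k` belonging to `γ`:
`j(γ, w)^k conj(j(γ, w))^(-k) K(z, γ w; k, s)`. -/
def greenTerm (k : ℤ) (s : ℂ) (z w : ℍ) (γ : SL2R) : ℂ :=
  autFactor γ w ^ k * conj (autFactor γ w) ^ (-k) * greenKernel k s z (γ • w)

/-- The automorphic Green function `G(z, w; k, s)` of weight `k`. -/
def green (Γ : Subgroup SL2R) (k : ℤ) (s : ℂ) (z w : ℍ) : ℂ :=
  ∑' γ : Γ, greenTerm k s z w γ

/-- `D ⊆ ℝ` is a measurable fundamental domain for `Γ` acting on `Ω(Γ)`, up to Lebesgue null sets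
(in particular, up to the point `∞`). Integrals over `Γ \ Ω(Γ)` of `Γ`-invariant densities
`f(ζ) dζ` are integrals over such a `D`. -/
structure IsBdryFundamentalDomain (Γ : Subgroup SL2R) (D : Set ℝ) : Prop where
  measurable : MeasurableSet D
  subset : ∀ ζ ∈ D, (ζ : OnePoint ℝ) ∈ discontinuitySet Γ
  covers : ∀ᵐ ζ : ℝ, (ζ : OnePoint ℝ) ∈ discontinuitySet Γ →
    ∃ γ ∈ Γ, ∃ η ∈ D, bdryAct γ (ζ : OnePoint ℝ) = (η : OnePoint ℝ)
  disjoint : ∀ γ ∈ Γ, γ ≠ 1 → MeasureTheory.volume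
    {ζ : ℝ | ζ ∈ D ∧ ∃ η ∈ D, bdryAct γ (ζ : OnePoint ℝ) = (η : OnePoint ℝ)} = 0

end HypProduct

end

/-! The identity is an unfolding. Multiply the two absolutely convergent series and index the pairs
of group elements as `(γ⁻¹, γ⁻¹β)`. Because the exponents `s` and `1 - s` are complementary and the
weights opposite, automorphy turns the `(β, γ)` term into the Jacobian of `γ` at `ζ`, times a phase
depending on `β`, times `P_k(z, γζ; s) P_{-k}(βz', γζ; 1 - s)` (`productTerm_eq`). The translates of
`D` tile `ℝ` up to null sets, so the sum over `γ` of the integrals over `D` is a single integral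
over `ℝ`. What remains is a formula for one pair of points: for `z ≠ w` the Poisson integral is
`K(z, w; k, s) + K(z, w; k, 1 - s)` (`integral_poissonPair_eq_greenKernel`).

In the angle at which the boundary is seen from `z`, the integrand is a product of two binomial
series, and Parseval gives `π H_k v^(1-s) F(1-s-k, 1-s+k; 1; 1-v)` with `v = 1/(1+u)`. Pfaff's
transformation rewrites the kernel as a constant times `H_k v^s F(s-|k|, s+|k|; 2s; v)`. After
removal of `H_k v^(1-s)`, the kernels at `s` and `1 - s` are multiples of the two Frobenius
solutions at `v = 0` of one hypergeometric equation, and the Poisson integral is a multiple of its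
solution regular at `v = 1`. The connection formula `hg_connection` is proved by evaluating the
Wronskians of these solutions at the endpoints.

The tiling requires a null limit set (`volume_compl_omegaReal`). The harmonic measure of `Ω(Γ)` is
invariant under `Γ` and locally bounded below on `ℍ ∪ Ω(Γ)`, hence by cocompactness bounded below on
`ℍ`; above a point where `Ω(Γ)` has density zero it would become arbitrarily small.

Convergence is governed by `v ≤ 4 exp(-d)`. All weight factors have modulus one, so everything is
dominated by weight `0` with a real exponent, where the integrand is positive and the Poisson
formula itself bounds its integral by Green kernels. The exponent `1/2` is enclosed between two
others. The same domination makes the unfolded series continuous in `s`, which gives the limit at `s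
= 1/2`. -/

noncomputable section

namespace HypProduct

open Filter Topology

/-! ### Power series on the unit disc -/

/-- The sum of the power series with coefficients `p`. -/
def powSum (p : ℕ → ℂ) (x : ℂ) : ℂ := ∑' n, p n * x ^ n

/-- Absolute convergence on the open unit disc. -/
def DiscSummable (p : ℕ → ℂ) : Prop := ∀ x : ℂ, ‖x‖ < 1 → Summable fun n => ‖p n * x ^ n‖

/-- The coefficients of the derivative. -/
def derivCoeff (p : ℕ → ℂ) (n : ℕ) : ℂ := (n + 1) * p (n + 1)

/-- The coefficients of the Euler derivative `x d/dx`. -/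
def eulerCoeff (p : ℕ → ℂ) (n : ℕ) : ℂ := n * p n

section PowSum

variable {p : ℕ → ℂ}

/-- Since `p n * R ^ n` is bounded for some `R` strictly between `r` and `1`, the derived terms are
at most a constant times `(n + 1) (r / R)^n`. Uniformity in `y` is what termwise differentiation
needs. -/
theorem DiscSummable.derivCoeff_bound (hp : DiscSummable p) {r : ℝ} (hr0 : 0 ≤ r) (hr : r < 1) :
    ∃ u : ℕ → ℝ, Summable u ∧ ∀ n, ∀ y : ℂ, ‖y‖ ≤ r → ‖derivCoeff p n * y ^ n‖ ≤ u n := by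
  obtain ⟨R, hrR, hR1⟩ := exists_between hr
  have hR0 : 0 < R := hr0.trans_lt hrR
  have hs := hp (R : ℂ) (by simpa [abs_of_pos hR0] using hR1)
  obtain ⟨M, hM⟩ := hs.tendsto_atTop_zero.bddAbove_range
  have hM' : ∀ n, ‖p n‖ * R ^ n ≤ M := fun n => by
    have := hM ⟨n, rfl⟩
    simpa [abs_of_pos hR0] using this
  refine ⟨fun n => M / R * ((n + 1) * (r / R) ^ n), ?_, ?_⟩
  · have h1 : ‖r / R‖ < 1 := by
      rw [Real.norm_of_nonneg (by positivity)]; exact (div_lt_one hR0).2 hrR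
    have := (summable_pow_mul_geometric_of_norm_lt_one 1 h1).add
      (summable_geometric_of_norm_lt_one h1)
    refine (this.mul_left (M / R)).congr fun n => ?_
    ring
  · intro n y hy
    have h2 : ‖p (n + 1)‖ ≤ M / R ^ (n + 1) := (le_div_iff₀ (by positivity)).2 (hM' (n + 1))
    have h3 : ‖((n : ℂ) + 1)‖ = (n : ℝ) + 1 := by
      have : ((n : ℂ) + 1) = ((n + 1 : ℕ) : ℂ) := by push_cast; rfl
      rw [this, Complex.norm_natCast]; push_cast; rfl
    rw [derivCoeff, norm_mul, norm_mul, norm_pow, h3]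
    calc ((n : ℝ) + 1) * ‖p (n + 1)‖ * ‖y‖ ^ n ≤ (n + 1) * (M / R ^ (n + 1)) * r ^ n := by
          have := (norm_nonneg _).trans h2
          gcongr
      _ = M / R * ((n + 1) * (r / R) ^ n) := by
          rw [div_pow, pow_succ]; field_simp

theorem DiscSummable.derivCoeff (hp : DiscSummable p) : DiscSummable (derivCoeff p) := by
  intro x hx
  obtain ⟨u, hu, hb⟩ := hp.derivCoeff_bound (norm_nonneg x) hx
  exact Summable.of_nonneg_of_le (fun _ => norm_nonneg _) (fun n => hb n x le_rfl) hu

theorem DiscSummable.summable (hp : DiscSummable p) {x : ℂ} (hx : ‖x‖ < 1) :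
    Summable fun n => p n * x ^ n := (hp x hx).of_norm

theorem DiscSummable.hasDerivAt (hp : DiscSummable p) {x : ℂ} (hx : ‖x‖ < 1) :
    HasDerivAt (powSum p) (powSum (HypProduct.derivCoeff p) x) x := by
  obtain ⟨r, hxr, hr1⟩ := exists_between hx
  obtain ⟨u, hu, hb⟩ := hp.derivCoeff_bound ((norm_nonneg x).trans hxr.le) hr1
  have key : ∀ y : ℂ, ‖y‖ < 1 → ∑' n, p n * ((n : ℂ) * y ^ (n - 1)) =
      powSum (HypProduct.derivCoeff p) y := by
    intro y hy
    have hs : Summable fun n : ℕ => p n * ((n : ℂ) * y ^ (n - 1)) := by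
      rw [← summable_nat_add_iff 1]
      refine (hp.derivCoeff.summable hy).congr fun n => ?_
      simp [HypProduct.derivCoeff]; ring
    rw [hs.tsum_eq_zero_add]
    simp only [Nat.cast_zero, zero_mul, mul_zero, zero_add, powSum]
    refine tsum_congr fun n => ?_
    simp [HypProduct.derivCoeff]; ring
  have hu' : Summable fun n : ℕ => if n = 0 then (0 : ℝ) else u (n - 1) := by
    rw [← summable_nat_add_iff 1]; simpa using hu
  have := hasDerivAt_tsum_of_isPreconnected (t := Metric.ball (0 : ℂ) r)
    (g := fun n y => p n * y ^ n) (g' := fun n y => p n * ((n : ℂ) * y ^ (n - 1))) hu'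
    Metric.isOpen_ball (convex_ball _ _).isPreconnected
    (fun n y _ => (hasDerivAt_pow n y).const_mul _) ?_ (y₀ := x) (by simpa using hxr)
    (hp.summable hx) (y := x) (by simpa using hxr)
  · rw [key x hx] at this; exact this
  · intro n y hy
    rcases n with _ | n
    · simp
    · have h := hb n y (by simpa using (mem_ball_zero_iff.1 hy).le)
      simp only [Nat.add_eq_zero_iff, one_ne_zero, and_false, if_false, Nat.add_sub_cancel]
      refine le_of_eq_of_le ?_ h
      congr 1
      simp [HypProduct.derivCoeff]; ring

theorem DiscSummable.hasSum_euler (hp : DiscSummable p) {x : ℂ} (hx : ‖x‖ < 1) :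
    HasSum (fun n => eulerCoeff p n * x ^ n) (x * powSum (HypProduct.derivCoeff p) x) := by
  have h := (hp.derivCoeff.summable hx).hasSum.mul_left x
  rw [← hasSum_nat_add_iff' 1]
  simp only [Finset.range_one, Finset.sum_singleton, eulerCoeff, Nat.cast_zero, zero_mul, sub_zero]
  refine h.congr_fun ?_
  intro n
  simp [HypProduct.derivCoeff]; ring

theorem DiscSummable.eulerCoeff (hp : DiscSummable p) : DiscSummable (eulerCoeff p) :=
  fun _ hx => summable_norm_iff.2 (hp.hasSum_euler hx).summable

theorem powSum_zero (p : ℕ → ℂ) : powSum p 0 = p 0 := by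
  rw [powSum, tsum_eq_single 0]
  · simp
  · intro n hn; simp [hn]

/-- Abel's theorem for sequences: `(1 - v) ∑ aₙ vⁿ → lim aₙ` as `v → 1-`. -/
theorem tendsto_one_sub_mul_powSum {a : ℕ → ℂ} {l : ℂ} (ha : Tendsto a atTop (𝓝 l))
    (hs : DiscSummable a) :
    Tendsto (fun v : ℝ => (1 - (v : ℂ)) * powSum a v) (𝓝[<] 1) (𝓝 l) := by
  -- Abel summation: the increments `f` telescope to `a`, so `(1 - v) ∑ aₙ vⁿ = ∑ fₙ vⁿ`, and Abel's
  -- limit theorem applies to the convergent series of `f`.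
  set f : ℕ → ℂ := fun n => a n - (if n = 0 then 0 else a (n - 1)) with hf
  have hsum : ∀ n, ∑ i ∈ Finset.range (n + 1), f i = a n := by
    intro n
    induction n with
    | zero => simp [hf]
    | succ n ih => rw [Finset.sum_range_succ, ih]; simp [hf]
  have h1 : Tendsto (fun n ↦ ∑ i ∈ Finset.range n, f i) atTop (𝓝 l) := by
    rw [← tendsto_add_atTop_iff_nat 1]
    simpa only [hsum] using ha
  have h2 := Complex.tendsto_tsum_powerSeries_nhdsWithin_lt h1
  rw [tendsto_map'_iff] at h2
  refine h2.congr' ?_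
  have : ∀ᶠ v : ℝ in 𝓝[<] 1, v ∈ Set.Ioo (0 : ℝ) 1 := Ioo_mem_nhdsLT zero_lt_one
  filter_upwards [this] with v hv
  have hv1 : ‖(v : ℂ)‖ < 1 := by
    simpa [abs_of_pos hv.1] using hv.2
  have hA := (hs.summable hv1).hasSum
  have hB : HasSum (fun n => (if n = 0 then 0 else a (n - 1)) * (v : ℂ) ^ n)
      ((v : ℂ) * powSum a v) := by
    rw [← hasSum_nat_add_iff' 1]
    simp only [Finset.range_one, Finset.sum_singleton, if_true, zero_mul, sub_zero]
    refine (hA.mul_left (v : ℂ)).congr_fun ?_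
    intro n
    simp; ring
  have hC := (hA.sub hB).tsum_eq
  simp only [Function.comp_apply]
  rw [one_sub_mul]
  refine Eq.trans ?_ hC
  refine tsum_congr fun n => ?_
  simp only [hf]; ring

/-! ### The Gauss hypergeometric series -/

/-- The coefficients of `F(a, b; c; x)`. -/
def hgCoeff (a b c : ℂ) (n : ℕ) : ℂ := ordinaryHypergeometricCoefficient a b c n

/-- `c` is not a nonpositive integer. -/
def NonPole (c : ℂ) : Prop := ∀ n : ℕ, c ≠ -n

theorem ordinaryHypergeometric_eq_powSum (a b c x : ℂ) :
    ordinaryHypergeometric a b c x = powSum (hgCoeff a b c) x := by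
  rw [ordinaryHypergeometric_eq_tsum]; rfl

theorem NonPole.add_ne_zero {c : ℂ} (hc : NonPole c) (n : ℕ) : c + n ≠ 0 :=
  fun h => hc n (eq_neg_of_add_eq_zero_left h)

theorem NonPole.ascPochhammer_ne_zero {c : ℂ} (hc : NonPole c) (n : ℕ) :
    (ascPochhammer ℂ n).eval c ≠ 0 := by
  rw [Ne, ascPochhammer_eval_eq_zero_iff]
  rintro ⟨k, -, hk⟩
  exact hc k (by rw [hk]; simp)

theorem hgCoeff_zero (a b c : ℂ) : hgCoeff a b c 0 = 1 := by
  simp [hgCoeff, ordinaryHypergeometricCoefficient]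

theorem hgCoeff_succ (a b : ℂ) {c : ℂ} (hc : NonPole c) (n : ℕ) :
    ((n : ℂ) + 1) * (c + n) * hgCoeff a b c (n + 1) = (a + n) * (b + n) * hgCoeff a b c n := by
  have h1 := hc.ascPochhammer_ne_zero n
  have h2 := hc.add_ne_zero n
  have h3 : ((n : ℂ) + 1) ≠ 0 := by exact_mod_cast n.succ_ne_zero
  have h4 : ((n.factorial : ℕ) : ℂ) ≠ 0 := by exact_mod_cast n.factorial_ne_zero
  simp only [hgCoeff, ordinaryHypergeometricCoefficient, ascPochhammer_succ_eval,
    Nat.factorial_succ]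
  push_cast
  field_simp

/-- Either some coefficient vanishes, and then the recurrence kills all later ones, or the ratio
test applies with limiting ratio `‖x‖`. -/
theorem hgCoeff_discSummable (a b : ℂ) {c : ℂ} (hc : NonPole c) :
    DiscSummable (hgCoeff a b c) := by
  intro x hx
  by_cases h0 : ∃ n, hgCoeff a b c n = 0
  · obtain ⟨N, hN⟩ := h0
    have : ∀ m, hgCoeff a b c (N + m) = 0 := by
      intro m
      induction m with
      | zero => simpa using hN
      | succ m ih =>
        have := hgCoeff_succ a b hc (N + m)
        rw [ih, mul_zero] at this
        refine (mul_eq_zero.1 this).resolve_left (mul_ne_zero ?_ (hc.add_ne_zero _))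
        exact_mod_cast (N + m).succ_ne_zero
    refine summable_of_ne_finset_zero (s := Finset.range N) fun n hn => ?_
    obtain ⟨m, rfl⟩ := Nat.exists_eq_add_of_le (not_lt.1 (by simpa using hn))
    simp [this]
  · push Not at h0
    rcases eq_or_ne x 0 with rfl | hx0
    · refine summable_of_ne_finset_zero (s := {0}) fun n hn => ?_
      simp [show n ≠ 0 by simpa using hn]
    have hne : ∀ n : ℕ, a + n ≠ 0 ∧ b + n ≠ 0 := by
      intro n
      have h := hgCoeff_succ a b hc n
      have h5 : ((n : ℂ) + 1) ≠ 0 := by exact_mod_cast n.succ_ne_zero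
      have : (a + n) * (b + n) * hgCoeff a b c n ≠ 0 := by
        rw [← h]; exact mul_ne_zero (mul_ne_zero h5 (hc.add_ne_zero _)) (h0 _)
      exact ⟨fun h => this (by rw [h]; ring), fun h => this (by rw [h]; ring)⟩
    have hlim : Tendsto (fun n : ℕ => ‖x‖ * ‖(a + n) / (1 + n) * ((b + n) / (c + n))‖) atTop
        (𝓝 ‖x‖) := by
      have h1 := tendsto_add_mul_div_add_mul_atTop_nhds a 1 (1 : ℂ) (one_ne_zero)
      have h2 := tendsto_add_mul_div_add_mul_atTop_nhds b c (1 : ℂ) (one_ne_zero)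
      have := ((h1.mul h2).norm).const_mul ‖x‖
      simpa using this
    refine (summable_of_ratio_test_tendsto_lt_one hx ?_ (hlim.congr fun n => ?_))
    · exact Eventually.of_forall fun n => norm_ne_zero_iff.2 (mul_ne_zero (h0 n) (pow_ne_zero _ hx0))
    · have h5 : ((n : ℂ) + 1) ≠ 0 := by exact_mod_cast n.succ_ne_zero
      have h6 : ((1 : ℂ) + n) ≠ 0 := by rwa [add_comm]
      have h := hgCoeff_succ a b hc n
      have h7 := hc.add_ne_zero n
      have : hgCoeff a b c (n + 1) = (a + n) / (1 + n) * ((b + n) / (c + n)) * hgCoeff a b c n := by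
        field_simp
        linear_combination h
      simp only [norm_norm]
      rw [← norm_mul, ← norm_div, this]
      congr 1
      have := h0 n
      field_simp
      ring

/-- The hypergeometric differential equation. -/
theorem hgCoeff_ode (a b : ℂ) {c : ℂ} (hc : NonPole c) {x : ℂ} (hx : ‖x‖ < 1) :
    x * (1 - x) * powSum (derivCoeff (derivCoeff (hgCoeff a b c))) x
      + (c - (a + b + 1) * x) * powSum (derivCoeff (hgCoeff a b c)) x
      - a * b * powSum (hgCoeff a b c) x = 0 := by
  set p := hgCoeff a b c with hpdef
  have hp : DiscSummable p := hgCoeff_discSummable a b hc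
  have e1 := (hp.summable hx).hasSum
  have e2 := (hp.derivCoeff.summable hx).hasSum
  have e3 := (hp.hasSum_euler hx)
  have e4 := (hp.derivCoeff.hasSum_euler hx)
  -- With `θ = x d/dx` the equation reads `d/dx (θ + c - 1) F = (θ + a)(θ + b) F`, which
  -- coefficientwise is the recurrence. Here `e5` is the series of `d/dx θ F` and `e6` that of `θ²
  -- F`.
  have e5 : HasSum (fun n => derivCoeff (eulerCoeff p) n * x ^ n)
      (powSum (derivCoeff p) x + x * powSum (derivCoeff (derivCoeff p)) x) := by
    refine (e2.add e4).congr_fun ?_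
    intro n
    simp only [derivCoeff, eulerCoeff]; push_cast; ring
  have e6 := hp.eulerCoeff.hasSum_euler hx
  rw [powSum, e5.tsum_eq] at e6
  have lhs := e5.add (e2.mul_left (c - 1))
  have rhs := (e6.add (e3.mul_left (a + b))).add (e1.mul_left (a * b))
  have := lhs.unique (rhs.congr_fun ?_)
  · change _ = _ + _ + a * b * powSum p x at this
    change _ + (c - 1) * powSum (derivCoeff p) x = _ at this
    linear_combination this
  · intro n
    have h := hgCoeff_succ a b hc n
    rw [← hpdef] at h
    simp only [derivCoeff, eulerCoeff]
    push_cast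
    linear_combination x ^ n * h

end PowSum

/-! ### Gamma asymptotics of the coefficients and the connection formula. -/

theorem NonPole.gamma_ne_zero {c : ℂ} (hc : NonPole c) : Complex.Gamma c ≠ 0 :=
  Complex.Gamma_ne_zero hc

/-- The denominator in Euler's limit for `Γ` is a Pochhammer product, so quotients of such products
converge to quotients of Gamma values. -/
theorem gammaSeq_ascPochhammer {c : ℂ} (hc : NonPole c) (n : ℕ) :
    Complex.GammaSeq c n * (ascPochhammer ℂ (n + 1)).eval c = (n : ℂ) ^ c * n.factorial := by
  have h : ∏ j ∈ Finset.range (n + 1), (c + j) = (ascPochhammer ℂ (n + 1)).eval c := by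
    induction (n + 1) with
    | zero => simp
    | succ m ih => rw [Finset.prod_range_succ, ih, ascPochhammer_succ_eval]
  rw [Complex.GammaSeq, h, div_mul_cancel₀ _ (hc.ascPochhammer_ne_zero _)]

/-- The coefficients of `F(A, B; A + B; x)` behave like `Γ(A+B) / (Γ(A) Γ(B) n)`. -/
theorem tendsto_derivCoeff_hgCoeff {A B : ℂ} (hA : NonPole A) (hB : NonPole B)
    (hAB : NonPole (A + B)) :
    Tendsto (derivCoeff (hgCoeff A B (A + B))) atTop
      (𝓝 (Complex.Gamma (A + B) / (Complex.Gamma A * Complex.Gamma B))) := by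
  have h := (Complex.GammaSeq_tendsto_Gamma (A + B)).div
    ((Complex.GammaSeq_tendsto_Gamma A).mul (Complex.GammaSeq_tendsto_Gamma B))
    (mul_ne_zero hA.gamma_ne_zero hB.gamma_ne_zero)
  refine h.congr' ?_
  filter_upwards [eventually_ne_atTop 0] with n hn
  have a1 := gammaSeq_ascPochhammer hA n
  have a2 := gammaSeq_ascPochhammer hB n
  have a3 := gammaSeq_ascPochhammer hAB n
  have n0 : (n : ℂ) ≠ 0 := by exact_mod_cast hn
  have f0 : ((n.factorial : ℕ) : ℂ) ≠ 0 := by exact_mod_cast n.factorial_ne_zero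
  have n1 : ((n : ℂ) + 1) ≠ 0 := by exact_mod_cast n.succ_ne_zero
  have p1 := hA.ascPochhammer_ne_zero (n + 1)
  have p2 := hB.ascPochhammer_ne_zero (n + 1)
  have p3 := hAB.ascPochhammer_ne_zero (n + 1)
  have c1 : (n : ℂ) ^ A ≠ 0 := by simp [Complex.cpow_eq_zero_iff, n0]
  have c2 : (n : ℂ) ^ B ≠ 0 := by simp [Complex.cpow_eq_zero_iff, n0]
  rw [Complex.cpow_add _ _ n0] at a3
  have e1 := eq_div_of_mul_eq p1 a1
  have e2 := eq_div_of_mul_eq p2 a2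
  have e3 := eq_div_of_mul_eq p3 a3
  simp only [Pi.div_apply, e1, e2, e3, derivCoeff, hgCoeff,
    ordinaryHypergeometricCoefficient, Nat.factorial_succ]
  push_cast
  field_simp

theorem tendsto_hgCoeff_zero {A B : ℂ} (hA : NonPole A) (hB : NonPole B)
    (hAB : NonPole (A + B)) : Tendsto (hgCoeff A B (A + B)) atTop (𝓝 0) := by
  rw [← tendsto_add_atTop_iff_nat 1]
  have h := (tendsto_derivCoeff_hgCoeff hA hB hAB).mul
    (tendsto_one_div_add_atTop_nhds_zero_nat (𝕜 := ℂ))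
  rw [mul_zero] at h
  refine h.congr fun n => ?_
  have n1 : ((n : ℂ) + 1) ≠ 0 := by exact_mod_cast n.succ_ne_zero
  simp only [derivCoeff]
  field_simp

/-- `f` solves the hypergeometric equation with parameters `a, b, c` on `(0, 1)`, and `f'` is its
derivative. -/
structure SolvesHG (a b c : ℂ) (f f' : ℝ → ℂ) : Prop where
  deriv : ∀ v ∈ Set.Ioo (0 : ℝ) 1, HasDerivAt f (f' v) v
  ode : ∀ v ∈ Set.Ioo (0 : ℝ) 1, ∃ w, HasDerivAt f' w v ∧
    (v : ℂ) * (1 - v) * w + (c - (a + b + 1) * v) * f' v - a * b * f v = 0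

theorem norm_lt_one_of_mem {v : ℝ} (hv : v ∈ Set.Ioo (0 : ℝ) 1) : ‖(v : ℂ)‖ < 1 := by
  simpa [abs_of_pos hv.1] using hv.2

theorem solvesHG_zero (a b : ℂ) {c : ℂ} (hc : NonPole c) :
    SolvesHG a b c (fun v => powSum (hgCoeff a b c) v)
      (fun v => powSum (derivCoeff (hgCoeff a b c)) v) where
  deriv _ hv := ((hgCoeff_discSummable a b hc).hasDerivAt (norm_lt_one_of_mem hv)).comp_ofReal
  ode _ hv := ⟨_, ((hgCoeff_discSummable a b hc).derivCoeff.hasDerivAt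
    (norm_lt_one_of_mem hv)).comp_ofReal, hgCoeff_ode a b hc (norm_lt_one_of_mem hv)⟩

/-- The substitution `v ↦ 1 - v` preserves the hypergeometric equation and replaces `c` by `a + b +
1 - c`. -/
theorem solvesHG_one (a b : ℂ) {c : ℂ} (hc : NonPole (a + b + 1 - c)) :
    SolvesHG a b c (fun v => powSum (hgCoeff a b (a + b + 1 - c)) (1 - v))
      (fun v => - powSum (derivCoeff (hgCoeff a b (a + b + 1 - c))) (1 - v)) := by
  have hs := hgCoeff_discSummable a b hc
  have hn : ∀ v : ℝ, v ∈ Set.Ioo (0 : ℝ) 1 → ‖(1 : ℂ) - v‖ < 1 := fun v hv => by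
    have := norm_lt_one_of_mem (v := 1 - v) ⟨by linarith [hv.2], by linarith [hv.1]⟩
    simpa using this
  have hd : ∀ v : ℝ, HasDerivAt (fun v : ℂ => 1 - v) (-1) (v : ℂ) := fun v =>
    (hasDerivAt_id _).const_sub 1
  refine ⟨fun v hv => ?_, fun v hv => ?_⟩
  · have := ((hs.hasDerivAt (hn v hv)).comp (v : ℂ) (hd v)).comp_ofReal
    simpa using this
  · have := ((hs.derivCoeff.hasDerivAt (hn v hv)).comp (v : ℂ) (hd v)).neg.comp_ofReal
    refine ⟨_, this, ?_⟩
    have h := hgCoeff_ode a b hc (hn v hv)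
    linear_combination h

/-- The indicial roots at `v = 0` are `0` and `1 - c`; this is the Frobenius solution belonging to
`1 - c`. -/
theorem solvesHG_second (a b : ℂ) {c : ℂ} (hc : NonPole (2 - c)) :
    SolvesHG a b c
      (fun v => (v : ℂ) ^ (1 - c) * powSum (hgCoeff (a - c + 1) (b - c + 1) (2 - c)) v)
      (fun v => (1 - c) * (v : ℂ) ^ (-c) * powSum (hgCoeff (a - c + 1) (b - c + 1) (2 - c)) v
        + (v : ℂ) ^ (1 - c) * powSum (derivCoeff (hgCoeff (a - c + 1) (b - c + 1) (2 - c))) v) := by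
  have hs := hgCoeff_discSummable (a - c + 1) (b - c + 1) hc
  have hp : ∀ (e : ℂ) (v : ℝ), v ∈ Set.Ioo (0 : ℝ) 1 →
      HasDerivAt (fun w : ℂ => w ^ e) (e * (v : ℂ) ^ (e - 1)) (v : ℂ) := fun e v hv => by
    have := (hasDerivAt_id (v : ℂ)).cpow_const (c := e) (Or.inl (by simpa using hv.1))
    simpa using this
  refine ⟨fun v hv => ?_, fun v hv => ?_⟩
  · have := ((hp (1 - c) v hv).mul (hs.hasDerivAt (norm_lt_one_of_mem hv))).comp_ofReal
    rwa [show 1 - c - 1 = -c by ring] at this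
  · have h1 := (((hp (-c) v hv).const_mul (1 - c)).mul
      (hs.hasDerivAt (norm_lt_one_of_mem hv)))
    have h2 := ((hp (1 - c) v hv).mul (hs.derivCoeff.hasDerivAt (norm_lt_one_of_mem hv)))
    refine ⟨_, (h1.add h2).comp_ofReal, ?_⟩
    have h := hgCoeff_ode (a - c + 1) (b - c + 1) hc (norm_lt_one_of_mem hv)
    have v0 : (v : ℂ) ≠ 0 := by exact_mod_cast hv.1.ne'
    have q1 : (v : ℂ) ^ (-c) = v * (v : ℂ) ^ (-c - 1) := by
      rw [Complex.cpow_sub _ _ v0, Complex.cpow_one]; field_simp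
    have q2 : (v : ℂ) ^ (1 - c) = v * (v * (v : ℂ) ^ (-c - 1)) := by
      rw [← q1, sub_eq_add_neg, Complex.cpow_add _ _ v0, Complex.cpow_one]
    have q3 : (v : ℂ) ^ (1 - c - 1) = v * (v : ℂ) ^ (-c - 1) := by
      rw [← q1]; congr 1; ring
    rw [q3, q2, q1]
    linear_combination (v : ℂ) ^ 2 * (v : ℂ) ^ (-c - 1) * h

/-- The Wronskian of two solutions, when `c = a + b`. -/
theorem SolvesHG.wronskian {a b : ℂ} {f f' g g' : ℝ → ℂ} (hf : SolvesHG a b (a + b) f f')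
    (hg : SolvesHG a b (a + b) g g') : ∃ C : ℂ, ∀ v ∈ Set.Ioo (0 : ℝ) 1,
      (v : ℂ) ^ (a + b) * (1 - v) * (f v * g' v - f' v * g v) = C := by
  -- For `c = a + b` the ratio of the first two coefficients of the equation is `c/v - 1/(1 - v)`,
  -- so `v^c (1 - v)` is the integrating factor in Abel's identity.
  set W : ℝ → ℂ := fun v => (v : ℂ) ^ (a + b) * (1 - v) * (f v * g' v - f' v * g v)
  have key : ∀ v ∈ Set.Ioo (0 : ℝ) 1, HasDerivAt W 0 v := by
    intro v hv
    obtain ⟨f2, hf2, ef⟩ := hf.ode v hv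
    obtain ⟨g2, hg2, eg⟩ := hg.ode v hv
    have hf1 := hf.deriv v hv
    have hg1 := hg.deriv v hv
    have hp : HasDerivAt (fun w : ℝ => (w : ℂ) ^ (a + b)) ((a + b) * (v : ℂ) ^ (a + b - 1)) v := by
      have := ((hasDerivAt_id (v : ℂ)).cpow_const (c := a + b)
        (Or.inl (by simpa using hv.1))).comp_ofReal
      simpa using this
    have hq : HasDerivAt (fun w : ℝ => (1 : ℂ) - w) (-1) v :=
      ((hasDerivAt_id (v : ℂ)).const_sub 1).comp_ofReal
    have := (hp.mul hq).mul ((hf1.mul hg2).sub (hf2.mul hg1))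
    refine this.congr_deriv ?_
    have v0 : (v : ℂ) ≠ 0 := by exact_mod_cast hv.1.ne'
    have q1 : (v : ℂ) ^ (a + b) = v * (v : ℂ) ^ (a + b - 1) := by
      rw [Complex.cpow_sub _ _ v0, Complex.cpow_one]; field_simp
    simp only [q1, Pi.mul_apply, Pi.sub_apply]
    linear_combination (v : ℂ) ^ (a + b - 1) * (f v * eg - g v * ef)
  refine ⟨W (1 / 2), fun v hv => ?_⟩
  refine isOpen_Ioo.is_const_of_deriv_eq_zero isPreconnected_Ioo (𝕜 := ℝ) (f := W)
    (fun x hx => (key x hx).differentiableAt.differentiableWithinAt)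
    (fun x hx => (key x hx).deriv) hv (by constructor <;> norm_num)

theorem eq_of_tendsto_of_forall_Ioo {C L : ℂ} {W : ℝ → ℂ} {l : Filter ℝ} [l.NeBot]
    (h : ∀ v ∈ Set.Ioo (0 : ℝ) 1, W v = C) (hl : Set.Ioo (0 : ℝ) 1 ∈ l) (hW : Tendsto W l (𝓝 L)) :
    C = L := by
  refine tendsto_nhds_unique (f := W) (l := l) ?_ hW
  refine tendsto_const_nhds.congr' ?_
  filter_upwards [hl] with v hv using (h v hv).symm

theorem DiscSummable.continuousAt {p : ℕ → ℂ} (hp : DiscSummable p) {x : ℂ} (hx : ‖x‖ < 1) :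
    ContinuousAt (powSum p) x := (hp.hasDerivAt hx).continuousAt

theorem nonPole_one : NonPole 1 := fun n h => by
  have : ((n + 1 : ℕ) : ℂ) = 0 := by push_cast; rw [h]; ring
  exact absurd this (by exact_mod_cast n.succ_ne_zero)

/-- The connection formula between `x = 1` and `x = 0` for `c = a + b`. -/
theorem hg_connection {a b : ℂ} (ha : NonPole a) (hb : NonPole b) (ha' : NonPole (1 - a))
    (hb' : NonPole (1 - b)) (hc : NonPole (a + b)) (hc' : NonPole (2 - (a + b)))
    {v : ℝ} (hv : v ∈ Set.Ioo (0 : ℝ) 1) :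
    (1 - (a + b)) * powSum (hgCoeff a b 1) (1 - v) =
      Complex.Gamma (2 - (a + b)) / (Complex.Gamma (1 - a) * Complex.Gamma (1 - b))
        * powSum (hgCoeff a b (a + b)) v
      - Complex.Gamma (a + b) / (Complex.Gamma a * Complex.Gamma b)
        * ((v : ℂ) ^ (1 - (a + b)) * powSum (hgCoeff (1 - b) (1 - a) (2 - (a + b))) v) := by
  have s0 := solvesHG_one a b (c := a + b)
    (by rw [show a + b + 1 - (a + b) = 1 by ring]; exact nonPole_one)
  rw [show a + b + 1 - (a + b) = 1 by ring] at s0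
  have s1 := solvesHG_zero a b hc
  have s2 := solvesHG_second a b hc'
  rw [show a - (a + b) + 1 = 1 - b by ring, show b - (a + b) + 1 = 1 - a by ring] at s2
  have d0 := hgCoeff_discSummable a b nonPole_one
  have d1 := hgCoeff_discSummable a b hc
  have d2 := hgCoeff_discSummable (1 - b) (1 - a) hc'
  -- Any three solutions satisfy `f₀ W₁₂ - f₁ W₀₂ + f₂ W₀₁ = 0`. The normalised Wronskians are
  -- constant, so each may be computed at whichever endpoint is convenient.
  obtain ⟨C12, h12⟩ := s1.wronskian s2
  obtain ⟨C02, h02⟩ := s0.wronskian s2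
  obtain ⟨C01, h01⟩ := s0.wronskian s1
  have hIoo0 : Set.Ioo (0 : ℝ) 1 ∈ 𝓝[>] (0 : ℝ) := Ioo_mem_nhdsGT zero_lt_one
  have hIoo1 : Set.Ioo (0 : ℝ) 1 ∈ 𝓝[<] (1 : ℝ) := Ioo_mem_nhdsLT zero_lt_one
  have cast0 : Tendsto (fun v : ℝ => (v : ℂ)) (𝓝[>] 0) (𝓝 0) := by
    have : Tendsto (fun v : ℝ => (v : ℂ)) (𝓝 0) (𝓝 ((0 : ℝ) : ℂ)) :=
      Complex.continuous_ofReal.tendsto 0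
    simpa using this.mono_left nhdsWithin_le_nhds
  have cast1 : Tendsto (fun v : ℝ => (v : ℂ)) (𝓝[<] 1) (𝓝 1) := by
    have : Tendsto (fun v : ℝ => (v : ℂ)) (𝓝 1) (𝓝 ((1 : ℝ) : ℂ)) :=
      Complex.continuous_ofReal.tendsto 1
    simpa using this.mono_left nhdsWithin_le_nhds
  have csub : Tendsto (fun v : ℝ => (1 : ℂ) - v) (𝓝[<] 1) (𝓝 0) := by
    simpa using cast1.const_sub 1
  have at0 : ∀ {p : ℕ → ℂ}, DiscSummable p →
      Tendsto (fun v : ℝ => powSum p v) (𝓝[>] 0) (𝓝 (p 0)) := fun {p} hp => by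
    have := (hp.continuousAt (x := 0) (by simp)).tendsto
    rw [powSum_zero] at this
    exact this.comp cast0
  have at1 : ∀ {p : ℕ → ℂ}, DiscSummable p →
      Tendsto (fun v : ℝ => powSum p (1 - v)) (𝓝[<] 1) (𝓝 (p 0)) := fun {p} hp => by
    have := (hp.continuousAt (x := 0) (by simp)).tendsto
    rw [powSum_zero] at this
    exact this.comp csub
  have pow1 : ∀ e : ℂ, Tendsto (fun v : ℝ => (v : ℂ) ^ e) (𝓝[<] 1) (𝓝 1) := fun e => by
    have : ContinuousAt (fun w : ℂ => w ^ e) 1 :=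
      continuousAt_cpow_const (by simp)
    have := this.tendsto.comp cast1
    rwa [Complex.one_cpow] at this
  -- As `v → 0` both series tend to `1` and `v^(a+b)` cancels the singular powers, leaving the
  -- difference of the indicial roots.
  have e12 : C12 = 1 - (a + b) := by
    have hlim : Tendsto (fun v : ℝ => (1 - (v : ℂ)) * (powSum (hgCoeff a b (a + b)) v *
        ((1 - (a + b)) * powSum (hgCoeff (1 - b) (1 - a) (2 - (a + b))) v
          + v * powSum (derivCoeff (hgCoeff (1 - b) (1 - a) (2 - (a + b)))) v)
        - powSum (derivCoeff (hgCoeff a b (a + b))) v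
          * (v * powSum (hgCoeff (1 - b) (1 - a) (2 - (a + b))) v))) (𝓝[>] 0)
        (𝓝 (1 - (a + b))) := by
      have := (cast0.const_sub 1).mul (((at0 d1).mul (((at0 d2).const_mul (1 - (a + b))).add
        (cast0.mul (at0 d2.derivCoeff)))).sub ((at0 d1.derivCoeff).mul (cast0.mul (at0 d2))))
      simpa [hgCoeff_zero] using this
    refine eq_of_tendsto_of_forall_Ioo (l := 𝓝[>] 0) (fun v hv => ?_) hIoo0 hlim
    rw [← h12 v hv]
    have v0 : (v : ℂ) ≠ 0 := by exact_mod_cast hv.1.ne'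
    have z0 : (v : ℂ) ^ (a + b) ≠ 0 := by simp [Complex.cpow_eq_zero_iff, v0]
    rw [Complex.cpow_neg, Complex.cpow_sub _ _ v0, Complex.cpow_one]
    field_simp
  -- As `v → 1` the coefficients of the second solution's series tend to `0` and those of its
  -- derivative to a Gamma quotient. By Abel's theorem `(1 - v)` times the series tends to `0`, and
  -- `(1 - v)` times the derivative to that quotient.
  have e02 : C02 = Complex.Gamma (2 - (a + b)) / (Complex.Gamma (1 - a) * Complex.Gamma (1 - b)) := by
    have hsum : 1 - b + (1 - a) = 2 - (a + b) := by ring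
    have l1 := tendsto_derivCoeff_hgCoeff hb' ha' (by rw [hsum]; exact hc')
    have l2 := tendsto_hgCoeff_zero hb' ha' (by rw [hsum]; exact hc')
    rw [hsum] at l1 l2
    have m1 := tendsto_one_sub_mul_powSum l1 d2.derivCoeff
    have m2 := tendsto_one_sub_mul_powSum l2 d2
    have hlim := (pow1 (a + b)).mul (((at1 d0).mul (((pow1 (-(a + b))).const_mul (1 - (a + b))).mul
      m2 |>.add ((pow1 (1 - (a + b))).mul m1))).add ((at1 d0.derivCoeff).mul
      ((pow1 (1 - (a + b))).mul m2)))
    simp only [hgCoeff_zero, mul_zero, zero_add, one_mul, add_zero] at hlim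
    rw [mul_comm (Complex.Gamma (1 - b))] at hlim
    refine eq_of_tendsto_of_forall_Ioo (l := 𝓝[<] 1) (fun v hv => ?_) hIoo1 hlim
    rw [← h02 v hv]
    ring
  have e01 : C01 = Complex.Gamma (a + b) / (Complex.Gamma a * Complex.Gamma b) := by
    have m1 := tendsto_one_sub_mul_powSum (tendsto_derivCoeff_hgCoeff ha hb hc) d1.derivCoeff
    have m2 := tendsto_one_sub_mul_powSum (tendsto_hgCoeff_zero ha hb hc) d1
    have hlim := (pow1 (a + b)).mul (((at1 d0).mul m1).add ((at1 d0.derivCoeff).mul m2))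
    simp only [hgCoeff_zero, mul_zero, one_mul, add_zero] at hlim
    refine eq_of_tendsto_of_forall_Ioo (l := 𝓝[<] 1) (fun v hv => ?_) hIoo1 hlim
    rw [← h01 v hv]
    ring
  have g12 := h12 v hv
  have g02 := h02 v hv
  have g01 := h01 v hv
  rw [e12] at g12
  rw [e02] at g02
  rw [e01] at g01
  linear_combination (-powSum (hgCoeff a b 1) (1 - v)) * g12 + powSum (hgCoeff a b (a + b)) v * g02
    - (v : ℂ) ^ (1 - (a + b)) * powSum (hgCoeff (1 - b) (1 - a) (2 - (a + b))) v * g01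

/-! ### Pfaff's transformation. -/

/-- Uniqueness of the analytic solution of the hypergeometric equation at `0`. -/
theorem hg_unique {a b c : ℂ} (hc : NonPole c) {h : ℂ → ℂ} (ha : AnalyticAt ℂ h 0) (h0 : h 0 = 0)
    (hode : ∀ᶠ x in 𝓝 (0 : ℂ), x * (1 - x) * deriv (deriv h) x
      + (c - (a + b + 1) * x) * deriv h x - a * b * h x = 0) :
    ∀ᶠ x in 𝓝 (0 : ℂ), h x = 0 := by
  by_contra hne
  -- A nonzero solution vanishing at `0` is `x^(m+1) g` with `g 0 ≠ 0`. Dividing the equation by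
  -- `x^m` and letting `x → 0` yields `(c + m)(m + 1) g 0 = 0`, which is impossible.
  obtain ⟨n, g, hg, hg0, hgn⟩ := (ha.exists_eventuallyEq_pow_smul_nonzero_iff).2 hne
  simp only [sub_zero, smul_eq_mul] at hgn
  rcases n with _ | m
  · have := hgn.self_of_nhds
    rw [h0] at this
    simp at this
    exact hg0 this.symm
  have hgd : ∀ᶠ x in 𝓝 (0 : ℂ), DifferentiableAt ℂ g x :=
    hg.eventually_analyticAt.mono fun x hx => hx.differentiableAt
  have hgd' : ∀ᶠ x in 𝓝 (0 : ℂ), DifferentiableAt ℂ (deriv g) x :=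
    hg.deriv.eventually_analyticAt.mono fun x hx => hx.differentiableAt
  set g1 : ℂ → ℂ := fun x => (m + 1) * g x + x * deriv g x with hg1
  have hg1a : AnalyticAt ℂ g1 0 := by
    exact (analyticAt_const.mul hg).add (analyticAt_id.mul hg.deriv)
  have e1 : ∀ᶠ x in 𝓝 (0 : ℂ), deriv h x = x ^ m * g1 x := by
    filter_upwards [hgn.eventually_nhds, hgd] with x hx hxd
    have h1 : deriv h x = deriv (fun z => z ^ (m + 1) * g z) x :=
      EventuallyEq.deriv_eq hx
    rw [h1, ((hasDerivAt_pow (m + 1) x).fun_mul hxd.hasDerivAt).deriv, hg1]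
    simp only [Nat.add_sub_cancel]; push_cast; ring
  have hg1d : ∀ᶠ x in 𝓝 (0 : ℂ), DifferentiableAt ℂ g1 x :=
    hg1a.eventually_analyticAt.mono fun x hx => hx.differentiableAt
  have e2 : ∀ᶠ x in 𝓝 (0 : ℂ), x * deriv (deriv h) x = x ^ m * (m * g1 x + x * deriv g1 x) := by
    filter_upwards [e1.eventually_nhds, hg1d] with x hx hxd
    have h1 : deriv (deriv h) x = deriv (fun z => z ^ m * g1 z) x := EventuallyEq.deriv_eq hx
    rw [h1, ((hasDerivAt_pow m x).fun_mul hxd.hasDerivAt).deriv]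
    rcases m with _ | m
    · simp
    · simp only [Nat.add_sub_cancel]; push_cast; ring
  set k : ℂ → ℂ := fun x => (1 - x) * (m * g1 x + x * deriv g1 x)
    + (c - (a + b + 1) * x) * g1 x - a * b * (x * g x) with hk
  have hk0 : ∀ᶠ x in 𝓝[≠] (0 : ℂ), k x = 0 := by
    have := (hode.and (e1.and (e2.and hgn))).filter_mono (nhdsWithin_le_nhds (s := {0}ᶜ))
    filter_upwards [this, self_mem_nhdsWithin] with x ⟨o, h1, h2, h3⟩ hx
    have hx0 : x ^ m ≠ 0 := pow_ne_zero _ hx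
    refine (mul_eq_zero.1 (?_ : x ^ m * k x = 0)).resolve_left hx0
    rw [h1, h3] at o
    rw [hk]
    linear_combination o - (1 - x) * h2
  have hkc : ContinuousAt k 0 := by
    have c1 := hg1a.continuousAt
    have c2 := hg1a.deriv.continuousAt
    have c3 := hg.continuousAt
    exact ((((continuousAt_const.sub continuousAt_id).mul ((continuousAt_const.mul c1).add
      (continuousAt_id.mul c2))).add ((continuousAt_const.sub
      (continuousAt_const.mul continuousAt_id)).mul c1)).sub
      (continuousAt_const.mul (continuousAt_id.mul c3)))
  have hk00 : k 0 = 0 := by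
    refine tendsto_nhds_unique (f := k) (l := 𝓝[≠] (0 : ℂ))
      (hkc.tendsto.mono_left nhdsWithin_le_nhds) ?_
    exact tendsto_const_nhds.congr' (hk0.mono fun x hx => hx.symm)
  simp only [hk, hg1] at hk00
  have : (c + m) * ((m + 1) * g 0) = 0 := by linear_combination hk00
  have hm : ((m : ℂ) + 1) ≠ 0 := by exact_mod_cast m.succ_ne_zero
  exact mul_ne_zero (hc.add_ne_zero m) (mul_ne_zero hm hg0) this

/-- Pfaff's transformation. -/
theorem pfaff (a b : ℂ) {c : ℂ} (hc : NonPole c) {x : ℂ} (hx : ‖x‖ < 1) (hx' : x.re < 1 / 2) :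
    powSum (hgCoeff a b c) x =
      (1 - x) ^ (-a) * powSum (hgCoeff a (c - b) c) (x / (x - 1)) := by
  -- The condition `Re z < 1/2` is equivalent to `|z/(z-1)| < 1` and keeps `1 - z` off the branch
  -- cut. The set is convex, so an identity near `0` propagates to all of it.
  set U : Set ℂ := Metric.ball 0 1 ∩ {x | x.re < 1 / 2} with hU
  have hUo : IsOpen U := Metric.isOpen_ball.inter (isOpen_lt Complex.continuous_re continuous_const)
  have hUc : IsPreconnected U :=
    ((convex_ball _ _).inter (convex_halfSpace_re_lt (1 / 2))).isPreconnected
  have hU0 : (0 : ℂ) ∈ U := by simp [hU]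
  have hs1 := hgCoeff_discSummable a b hc
  have hs2 := hgCoeff_discSummable a (c - b) hc
  set H0 := powSum (hgCoeff a (c - b) c) with hH0
  set H1 := powSum (derivCoeff (hgCoeff a (c - b) c)) with hH1
  set H2 := powSum (derivCoeff (derivCoeff (hgCoeff a (c - b) c))) with hH2
  set F0 := powSum (hgCoeff a b c) with hF0
  have hne : ∀ z ∈ U, 1 - z ≠ 0 := fun z hz h => by
    have h1 := hz.2
    rw [← sub_eq_zero.1 h] at h1
    norm_num at h1
  have hslit : ∀ z ∈ U, 1 - z ∈ Complex.slitPlane := fun z hz => by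
    left
    have h1 : z.re < 1 / 2 := hz.2
    simp; linarith
  have hy : ∀ z ∈ U, ‖z / (z - 1)‖ < 1 := fun z hz => by
    have h1 : z.re < 1 / 2 := hz.2
    have h2 : z - 1 ≠ 0 := fun h => hne z hz (by rw [← neg_sub, h, neg_zero])
    rw [norm_div, div_lt_one (norm_pos_iff.2 h2)]
    rw [← sq_lt_sq₀ (norm_nonneg _) (norm_nonneg _), Complex.sq_norm, Complex.sq_norm,
      Complex.normSq_apply, Complex.normSq_apply]
    simp; nlinarith
  have hyd : ∀ z ∈ U, HasDerivAt (fun z : ℂ => z / (z - 1)) (-(1 - z) ^ (-2 : ℤ)) z := fun z hz => by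
    have h2 : z - 1 ≠ 0 := fun h => hne z hz (by rw [← neg_sub, h, neg_zero])
    have := (hasDerivAt_id z).fun_div ((hasDerivAt_id z).sub_const 1) h2
    refine this.congr_deriv ?_
    have := hne z hz
    simp only [id]
    rw [zpow_neg]
    field_simp
    norm_cast
    ring
  have hpd : ∀ (e : ℂ), ∀ z ∈ U, HasDerivAt (fun z : ℂ => (1 - z) ^ e) (-e * (1 - z) ^ (e - 1)) z :=
    fun e z hz => by
    have := ((hasDerivAt_id z).const_sub 1).cpow_const (c := e) (hslit z hz)
    refine this.congr_deriv ?_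
    simp
  set g : ℂ → ℂ := fun z => (1 - z) ^ (-a) * H0 (z / (z - 1)) with hg
  set g' : ℂ → ℂ := fun z => a * (1 - z) ^ (-a - 1) * H0 (z / (z - 1))
    - (1 - z) ^ (-a - 2) * H1 (z / (z - 1)) with hg'
  set g'' : ℂ → ℂ := fun z => a * (a + 1) * (1 - z) ^ (-a - 2) * H0 (z / (z - 1))
    - (2 * a + 2) * (1 - z) ^ (-a - 3) * H1 (z / (z - 1))
    + (1 - z) ^ (-a - 4) * H2 (z / (z - 1)) with hg''
  have hH0d : ∀ z ∈ U, HasDerivAt (fun z => H0 (z / (z - 1)))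
      (H1 (z / (z - 1)) * -(1 - z) ^ (-2 : ℤ)) z := fun z hz =>
    HasDerivAt.comp (h₂ := H0) z (hs2.hasDerivAt (hy z hz)) (hyd z hz)
  have hH1d : ∀ z ∈ U, HasDerivAt (fun z => H1 (z / (z - 1)))
      (H2 (z / (z - 1)) * -(1 - z) ^ (-2 : ℤ)) z := fun z hz =>
    HasDerivAt.comp (h₂ := H1) z (hs2.derivCoeff.hasDerivAt (hy z hz)) (hyd z hz)
  have hpow : ∀ (e : ℂ) (n : ℕ), ∀ z ∈ U, (1 - z) ^ (e - n) = (1 - z) ^ e * ((1 - z) ^ n)⁻¹ :=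
    fun e n z hz => by
      rw [Complex.cpow_sub _ _ (hne z hz), Complex.cpow_natCast, div_eq_mul_inv]
  have hgd : ∀ z ∈ U, HasDerivAt g (g' z) z := fun z hz => by
    refine ((hpd (-a) z hz).fun_mul (hH0d z hz)).congr_deriv ?_
    have h2 := hpow (-a) 2 z hz
    push_cast at h2
    simp only [hg', h2, zpow_neg]
    norm_cast
    ring
  have hgd' : ∀ z ∈ U, HasDerivAt g' (g'' z) z := fun z hz => by
    refine ((((hpd (-a - 1) z hz).const_mul a).fun_mul (hH0d z hz)).fun_sub
      ((hpd (-a - 2) z hz).fun_mul (hH1d z hz))).congr_deriv ?_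
    have h1 := hpow (-a) 1 z hz
    have h2 := hpow (-a) 2 z hz
    have h3 := hpow (-a) 3 z hz
    have h4 := hpow (-a) 4 z hz
    push_cast at h1 h2 h3 h4
    have h5 : -a - 1 - 1 = -a - 2 := by ring
    have h6 : -a - 2 - 1 = -a - 3 := by ring
    have := hne z hz
    simp only [hg'', h1, h2, h3, h4, h5, h6, zpow_neg]
    norm_cast
    field_simp
    ring
  have hode : ∀ z ∈ U, z * (1 - z) * g'' z + (c - (a + b + 1) * z) * g' z - a * b * g z = 0 := by
    intro z hz
    have h := hgCoeff_ode a (c - b) hc (hy z hz)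
    rw [← hH0, ← hH1, ← hH2] at h
    simp only [hg, hg', hg'']
    have h1 := hpow (-a) 1 z hz
    have h2 := hpow (-a) 2 z hz
    have h3 := hpow (-a) 3 z hz
    have h4 := hpow (-a) 4 z hz
    push_cast at h1 h2 h3 h4
    rw [h1, h2, h3, h4]
    have h0 := hne z hz
    have h0' : z - 1 ≠ 0 := fun h => h0 (by rw [← neg_sub, h, neg_zero])
    generalize H0 (z / (z - 1)) = A0 at *
    generalize H1 (z / (z - 1)) = A1 at *
    generalize H2 (z / (z - 1)) = A2 at *
    generalize (1 - z) ^ (-a) = T at *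
    obtain ⟨t, ht⟩ : ∃ t, t = 1 - z := ⟨_, rfl⟩
    have hz1 : z = 1 - t := by rw [ht]; ring
    subst hz1
    rw [← ht] at h0 ⊢
    have e1 : (1 - t - 1 : ℂ) = -t := by ring
    rw [e1] at h
    field_simp at h ⊢
    linear_combination (-T) * h
  have hF : ∀ z ∈ U, HasDerivAt F0 (powSum (derivCoeff (hgCoeff a b c)) z) z := fun z hz =>
    hs1.hasDerivAt (by simpa using hz.1)
  have hF' : ∀ z ∈ U, HasDerivAt (powSum (derivCoeff (hgCoeff a b c)))
      (powSum (derivCoeff (derivCoeff (hgCoeff a b c))) z) z := fun z hz =>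
    hs1.derivCoeff.hasDerivAt (by simpa using hz.1)
  have hdiff : AnalyticOnNhd ℂ (fun z => F0 z - g z) U :=
    DifferentiableOn.analyticOnNhd (fun z hz =>
      ((hF z hz).sub (hgd z hz)).differentiableAt.differentiableWithinAt) hUo
  have hev : ∀ᶠ z in 𝓝 (0 : ℂ), z ∈ U := hUo.mem_nhds hU0
  have hd1 : ∀ z ∈ U, deriv (fun z => F0 z - g z) z =
      powSum (derivCoeff (hgCoeff a b c)) z - g' z := fun z hz =>
    ((hF z hz).fun_sub (hgd z hz)).deriv
  have hz0 : ∀ᶠ z in 𝓝 (0 : ℂ), F0 z - g z = 0 := by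
    refine hg_unique (a := a) (b := b) hc (hdiff 0 hU0) ?_ ?_
    · simp [hF0, hg, hH0, powSum_zero, hgCoeff_zero]
    · filter_upwards [hev.eventually_nhds] with z hz
      have hzU := hz.self_of_nhds
      have hd2 : deriv (deriv (fun z => F0 z - g z)) z =
          powSum (derivCoeff (derivCoeff (hgCoeff a b c))) z - g'' z := by
        have h1 : deriv (fun z => F0 z - g z) =ᶠ[𝓝 z]
            fun z => powSum (derivCoeff (hgCoeff a b c)) z - g' z := hz.mono hd1
        rw [h1.deriv_eq]
        exact ((hF' z hzU).fun_sub (hgd' z hzU)).deriv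
      rw [hd2, hd1 z hzU]
      have o1 := hgCoeff_ode a b hc (x := z) (by simpa using hzU.1)
      rw [← hF0] at o1
      linear_combination o1 - hode z hzU
  have := hdiff.eqOn_zero_of_preconnected_of_eventuallyEq_zero hUc hU0 hz0
    (show x ∈ U from ⟨by simpa using hx, hx'⟩)
  exact sub_eq_zero.1 this

/-- The function `gaussF` at `-1/u`, expressed through the series at `1/(1+u)`. -/
theorem gaussF_neg_inv (a b : ℂ) {c : ℂ} (hc : NonPole c) {u : ℝ} (hu : 0 < u) :
    gaussF a b c (-u⁻¹) = ((1 + u⁻¹ : ℝ) : ℂ) ^ (-a) *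
      powSum (hgCoeff a (c - b) c) (((1 + u)⁻¹ : ℝ) : ℂ) := by
  have e1 : (1 - -u⁻¹ : ℝ) = 1 + u⁻¹ := by ring
  have e2 : (-u⁻¹ / (-u⁻¹ - 1) : ℝ) = (1 + u)⁻¹ := by
    have h1 : (-u⁻¹ - 1 : ℝ) = -(u⁻¹ * (1 + u)) := by field_simp; ring
    have h2 : (1 + u : ℝ) ≠ 0 := by positivity
    rw [h1]
    field_simp
  rw [gaussF]
  -- For `|x| < 1` the formula is Pfaff's theorem; otherwise it is the definition of `gaussF`.
  split_ifs with h
  · rw [ordinaryHypergeometric_eq_powSum, pfaff a b hc (by simpa using h)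
      (by rw [Complex.ofReal_re]; have := inv_pos.2 hu; linarith), ← e1, ← e2]
    push_cast
    rfl
  · rw [e1, e2, ordinaryHypergeometric_eq_powSum]

/-! ### The Green kernel and its sum with the kernel at `1 - s`. -/

/-- The scalar constant of the kernel. -/
def kernelConst (m s : ℂ) : ℂ :=
  (Real.sqrt Real.pi : ℂ) * Complex.Gamma (1 / 2 - s) / Complex.Gamma (1 - s)
    * (4 : ℂ) ^ (-s) * (s / (s - m))

theorem nonPole_of_re_pos {c : ℂ} (h : 0 < c.re) : NonPole c := fun n hn => by
  rw [hn] at h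
  simp at h
  linarith [Nat.cast_nonneg (α := ℝ) n]

theorem nonPole_of_re_mem {c : ℂ} (h : -1 < c.re) (h' : c.re < 0) : NonPole c := fun n hn => by
  rw [hn] at h h'
  simp at h h'
  omega

theorem one_sub_two_mul_ne_zero {s : ℂ} (hs : s ≠ 1 / 2) : 1 - 2 * s ≠ 0 := fun h =>
  hs (by linear_combination (-1 / 2) * h)

/-- Legendre duplication at `1/2 - s` replaces `Γ(1 - 2s)/Γ(1 - s)` by `Γ(1/2 - s)`, up to `√π` and
a power of two. For `m = 1` the functional equation brings `Γ(-s) Γ(2 - s)` back to `Γ(1 - s)²` and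
produces the factor `s/(s - 1)`. -/
theorem kernelConst_eq {m s : ℂ} (hm : m = 0 ∨ m = 1) (h0 : 0 < s.re) (h1 : s.re < 1)
    (hs : s ≠ 1 / 2) :
    Real.pi * Complex.Gamma (2 - 2 * s) / ((1 - 2 * s) *
      (Complex.Gamma (1 - s - m) * Complex.Gamma (1 - s + m))) = kernelConst m s := by
  have hs2 := one_sub_two_mul_ne_zero hs
  have hs0 : s ≠ 0 := fun h => by simp [h] at h0
  have hs1 : 1 - s ≠ 0 := fun h => by
    have : s = 1 := by linear_combination -h
    simp [this] at h1
  have g1 : Complex.Gamma (2 - 2 * s) = (1 - 2 * s) * Complex.Gamma (1 - 2 * s) := by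
    rw [← Complex.Gamma_add_one _ hs2]; congr 1; ring
  have dup := Complex.Gamma_mul_Gamma_add_half (1 / 2 - s)
  rw [show (1 / 2 - s + 1 / 2 : ℂ) = 1 - s by ring, show (2 * (1 / 2 - s) : ℂ) = 1 - 2 * s by ring,
    show (1 - (1 - 2 * s) : ℂ) = 2 * s by ring] at dup
  have g2 : Complex.Gamma (1 - s) ≠ 0 := (nonPole_of_re_pos (by simpa using h1)).gamma_ne_zero
  have h4 : (4 : ℂ) ^ (-s) * (2 : ℂ) ^ (2 * s) = 1 := by
    have h := Complex.mul_cpow_ofReal_nonneg (zero_le_two (α := ℝ)) (zero_le_two (α := ℝ)) s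
    push_cast at h
    rw [Complex.cpow_neg, two_mul, Complex.cpow_add _ _ two_ne_zero, ← h]
    rw [show (2 : ℂ) * 2 = 4 by norm_num]
    exact inv_mul_cancel₀ (by simp [Complex.cpow_eq_zero_iff])
  have hpi : (Real.sqrt Real.pi : ℂ) * Real.sqrt Real.pi = Real.pi := by
    rw [← Complex.ofReal_mul, Real.mul_self_sqrt Real.pi_pos.le]
  have key : Real.pi * Complex.Gamma (1 - 2 * s) / (Complex.Gamma (1 - s) * Complex.Gamma (1 - s))
      = (Real.sqrt Real.pi : ℂ) * Complex.Gamma (1 / 2 - s) / Complex.Gamma (1 - s)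
        * (4 : ℂ) ^ (-s) := by
    rw [← hpi]
    generalize Complex.Gamma (1 / 2 - s) = G at *
    field_simp
    linear_combination (-(4 : ℂ) ^ (-s)) * dup
      - Complex.Gamma (1 - 2 * s) * (Real.sqrt Real.pi : ℂ) * h4
  rw [kernelConst, ← key, g1]
  rcases hm with rfl | rfl
  · simp only [sub_zero, add_zero, div_self hs0, mul_one]
    field_simp
  · have e1 : Complex.Gamma (1 - s) = -s * Complex.Gamma (-s) := by
      rw [← Complex.Gamma_add_one _ (neg_ne_zero.2 hs0)]; congr 1; ring
    have e2 : Complex.Gamma (1 - s + 1) = (1 - s) * Complex.Gamma (1 - s) :=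
      Complex.Gamma_add_one _ hs1
    have e3 : Complex.Gamma (-s) ≠ 0 := fun h => g2 (by rw [e1, h, mul_zero])
    have e4 : s - 1 ≠ 0 := fun h => hs1 (by linear_combination -h)
    rw [show (1 - s - 1 : ℂ) = -s by ring, e2, e1]
    field_simp
    ring

/-- The connection formula in the form needed for the kernel. -/
theorem kernel_connection {m s : ℂ} (hm : m = 0 ∨ m = 1) (h0 : 0 < s.re) (h1 : s.re < 1)
    (hs : s ≠ 1 / 2) {v : ℝ} (hv : v ∈ Set.Ioo (0 : ℝ) 1) :
    Real.pi * (v : ℂ) ^ (1 - s) * powSum (hgCoeff (1 - s - m) (1 - s + m) 1) (1 - v) =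
      kernelConst m s * (v : ℂ) ^ s * powSum (hgCoeff (s - m) (s + m) (2 * s)) v
      + kernelConst m (1 - s) * (v : ℂ) ^ (1 - s)
        * powSum (hgCoeff (1 - s - m) (1 - s + m) (2 * (1 - s))) v := by
  have hs2 := one_sub_two_mul_ne_zero hs
  have hs' : 1 - s ≠ 1 / 2 := fun h => hs (by linear_combination -h)
  have v0 : (v : ℂ) ≠ 0 := by exact_mod_cast hv.1.ne'
  have np : ∀ t : ℂ, 0 < t.re → t.re < 1 → NonPole (t - m) ∧ NonPole (t + m) := by
    intro t ht0 ht1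
    rcases hm with rfl | rfl
    · simp [nonPole_of_re_pos ht0]
    · exact ⟨nonPole_of_re_mem (by simp; linarith) (by simp; linarith),
        nonPole_of_re_pos (by simp; linarith)⟩
  have n1 := np s h0 h1
  have n2 := np (1 - s) (by simpa using h1) (by simpa using h0)
  have e1 : 1 - (1 - s - m) = s + m := by ring
  have e2 : 1 - (1 - s + m) = s - m := by ring
  have e3 : 1 - s - m + (1 - s + m) = 2 * (1 - s) := by ring
  have e4 : 2 - 2 * (1 - s) = 2 * s := by ring
  have e5 : 1 - 2 * (1 - s) = 2 * s - 1 := by ring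
  -- The parameters `1 - s ∓ m` sum to `2(1 - s)`, so the second indicial root is `2s - 1`;
  -- multiplication by `v^(1-s)` then gives the symmetric powers `v^s` and `v^(1-s)`. The strip `0 <
  -- Re s < 1` keeps `s - 1` and `-s` off the poles when `m = 1`.
  have h := hg_connection n2.1 n2.2 (by rw [e1]; exact n1.2) (by rw [e2]; exact n1.1)
    (by rw [e3]; exact nonPole_of_re_pos (by simpa using h1))
    (by rw [e3, e4]; exact nonPole_of_re_pos (by simpa using h0)) hv
  rw [e3, e1, e2, e4, e5] at h
  rw [← kernelConst_eq hm h0 h1 hs,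
    ← kernelConst_eq hm (by simpa using h1) (by simpa using h0) hs']
  rw [show 2 - 2 * (1 - s) = 2 * s by ring, show 1 - 2 * (1 - s) = 2 * s - 1 by ring,
    show 1 - (1 - s) - m = s - m by ring, show 1 - (1 - s) + m = s + m by ring,
    show 2 - 2 * s = 2 * (1 - s) by ring]
  have hpow : (v : ℂ) ^ s = (v : ℂ) ^ (1 - s) * (v : ℂ) ^ (2 * s - 1) := by
    rw [← Complex.cpow_add _ _ v0]; congr 1; ring
  have hs3 : 2 * s - 1 ≠ 0 := fun h => hs2 (by linear_combination -h)
  have hneg : (1 - 2 * s) = -(2 * s - 1) := by ring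
  have z1 := n1.1.gamma_ne_zero
  have z2 := n1.2.gamma_ne_zero
  have z3 := n2.1.gamma_ne_zero
  have z4 := n2.2.gamma_ne_zero
  rw [hpow, hneg]
  field_simp at h ⊢
  linear_combination (v : ℂ) ^ (1 - s) * h

theorem weight_abs {k : ℤ} (hk : k = 0 ∨ k = 1 ∨ k = -1) :
    ((|k| : ℤ) : ℂ) = 0 ∨ ((|k| : ℤ) : ℂ) = 1 := by
  rcases hk with rfl | rfl | rfl <;> simp

/-- The kernel in the variable `1 / (1 + u)`. -/
theorem greenKernel_eq {k : ℤ} {s : ℂ} (h0 : 0 < s.re) {z w : ℍ} (hu : 0 < pairInvariant z w) :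
    greenKernel k s z w = weightFactor k z w * (kernelConst (|k| : ℤ) s
      * (((1 + pairInvariant z w)⁻¹ : ℝ) : ℂ) ^ s
      * powSum (hgCoeff (s - (|k| : ℤ)) (s + (|k| : ℤ)) (2 * s))
        (((1 + pairInvariant z w)⁻¹ : ℝ) : ℂ)) := by
  set u := pairInvariant z w with hudef
  have hu1 : 0 < 1 + u := by linarith
  rw [greenKernel, ← hudef, gaussF_neg_inv _ _ (nonPole_of_re_pos (by simpa using h0)) hu, kernelConst]
  rw [show 2 * s - (s - ((|k| : ℤ) : ℂ)) = s + (|k| : ℤ) by ring]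
  set m : ℤ := |k|
  have u0 : (u : ℂ) ≠ 0 := by exact_mod_cast hu.ne'
  have u1 : ((1 + u : ℝ) : ℂ) ≠ 0 := by exact_mod_cast hu1.ne'
  -- Because `1 + 1/u = (1 + u)/u`, the powers of `u` cancel and only `(1 + u)^(-s)` survives.
  have key : (u : ℂ) ^ ((m : ℂ) - s) * (1 + (u : ℂ)) ^ (-m) * ((1 + u⁻¹ : ℝ) : ℂ) ^ (-(s - m))
      = (((1 + u)⁻¹ : ℝ) : ℂ) ^ s := by
    have a1 : (1 + u⁻¹ : ℝ) = (1 + u) * u⁻¹ := by field_simp; ring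
    have a2 : (1 + (u : ℂ)) ^ (-m) = ((1 + u : ℝ) : ℂ) ^ (-(m : ℂ)) := by
      rw [← Int.cast_neg, Complex.cpow_intCast]; push_cast; rfl
    have inv_cpow : ∀ (x : ℝ) (e : ℂ), 0 < x → ((x⁻¹ : ℝ) : ℂ) ^ e = (x : ℂ) ^ (-e) := by
      intro x e hx
      rw [Complex.ofReal_inv, Complex.inv_cpow, Complex.cpow_neg]
      rw [Complex.arg_ofReal_of_nonneg hx.le]; exact Real.pi_pos.ne
    rw [a1, a2, Complex.ofReal_mul, Complex.mul_cpow_ofReal_nonneg hu1.le (inv_nonneg.2 hu.le),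
      inv_cpow u _ hu, inv_cpow (1 + u) _ hu1, neg_neg]
    calc (u : ℂ) ^ ((m : ℂ) - s) * ((1 + u : ℝ) : ℂ) ^ (-(m : ℂ))
          * (((1 + u : ℝ) : ℂ) ^ (-(s - m)) * (u : ℂ) ^ (s - m))
        = ((u : ℂ) ^ ((m : ℂ) - s) * (u : ℂ) ^ (s - m))
          * (((1 + u : ℝ) : ℂ) ^ (-(m : ℂ)) * ((1 + u : ℝ) : ℂ) ^ (-(s - m))) := by ring
      _ = _ := by
        rw [← Complex.cpow_add _ _ u0, ← Complex.cpow_add _ _ u1]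
        rw [show (m : ℂ) - s + (s - m) = 0 by ring, Complex.cpow_zero, one_mul]
        congr 1; ring
  rw [← key]
  ring

/-- Only the sum of the two kernels is a multiple of the series in `1 - v = u/(1 + u)`, the form in
which the Poisson integral appears. -/
theorem greenKernel_add {k : ℤ} (hk : k = 0 ∨ k = 1 ∨ k = -1) {s : ℂ} (h0 : 0 < s.re)
    (h1 : s.re < 1) (hs : s ≠ 1 / 2) {z w : ℍ} (hu : 0 < pairInvariant z w) :
    greenKernel k s z w + greenKernel k (1 - s) z w = weightFactor k z w *
      (Real.pi * (((1 + pairInvariant z w)⁻¹ : ℝ) : ℂ) ^ (1 - s)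
        * powSum (hgCoeff (1 - s - (|k| : ℤ)) (1 - s + (|k| : ℤ)) 1)
          (1 - (((1 + pairInvariant z w)⁻¹ : ℝ) : ℂ))) := by
  rw [greenKernel_eq h0 hu, greenKernel_eq (by simpa using h1) hu,
    kernel_connection (weight_abs hk) h0 h1 hs]
  · ring
  · exact ⟨by positivity, inv_lt_one_of_one_lt₀ (by linarith)⟩

open MeasureTheory

/-! ### The integral of a product of two Poisson kernels -/

/-- The product of Poisson kernels of opposite weights and complementary exponents. -/
def poissonPair (k : ℤ) (s : ℂ) (z w : ℍ) (ζ : ℝ) : ℂ :=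
  weightPoisson k s z ζ * weightPoisson (-k) (1 - s) w ζ

/-- The Cayley coordinate of `w` in the disc centred at `z`. -/
def discCoord (z w : ℍ) : ℂ := ((w : ℂ) - z) / ((w : ℂ) - conj (z : ℂ))

theorem sub_conj_ne_zero (z w : ℍ) : (w : ℂ) - conj (z : ℂ) ≠ 0 := fun h => by
  have := congrArg Complex.im h
  simp at this
  linarith [z.im_pos, w.im_pos]

theorem conj_sub_ne_zero (z w : ℍ) : conj (w : ℂ) - (z : ℂ) ≠ 0 := fun h => by
  have := congrArg Complex.im h
  simp at this
  linarith [z.im_pos, w.im_pos]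

theorem coe_sub_ofReal_ne_zero (z : ℍ) (x : ℝ) : (z : ℂ) - x ≠ 0 := fun h => by
  have := congrArg Complex.im h
  simp at this
  exact z.im_ne_zero this

theorem conj_sub_ofReal_ne_zero (z : ℍ) (x : ℝ) : conj (z : ℂ) - x ≠ 0 := fun h => by
  have := congrArg Complex.im h
  simp at this
  exact z.im_ne_zero this

theorem one_add_pairInvariant (z w : ℍ) :
    1 + pairInvariant z w = ‖(w : ℂ) - conj (z : ℂ)‖ ^ 2 / (4 * z.im * w.im) := by
  have h1 := z.im_pos
  have h2 := w.im_pos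
  rw [pairInvariant, Complex.sq_norm, Complex.sq_norm, Complex.normSq_apply, Complex.normSq_apply]
  simp only [Complex.sub_re, Complex.sub_im, Complex.conj_re, Complex.conj_im,
    UpperHalfPlane.coe_re, UpperHalfPlane.coe_im]
  field_simp
  ring

theorem pairInvariant_nonneg (z w : ℍ) : 0 ≤ pairInvariant z w := by
  have h1 := z.im_pos
  have h2 := w.im_pos
  unfold pairInvariant
  positivity

theorem pairInvariant_pos {z w : ℍ} (h : z ≠ w) : 0 < pairInvariant z w := by
  have h1 := z.im_pos
  have h2 := w.im_pos
  have h3 : (z : ℂ) - w ≠ 0 := sub_ne_zero.2 fun e => h (UpperHalfPlane.ext e)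
  unfold pairInvariant
  positivity

theorem normSq_discCoord (z w : ℍ) :
    discCoord z w * conj (discCoord z w) = 1 - (((1 + pairInvariant z w)⁻¹ : ℝ) : ℂ) := by
  rw [Complex.mul_conj, discCoord, map_div₀]
  norm_cast
  have h1 := z.im_pos
  have h2 := w.im_pos
  have h3 : Complex.normSq ((w : ℂ) - conj (z : ℂ)) ≠ 0 :=
    (Complex.normSq_pos.2 (sub_conj_ne_zero z w)).ne'
  rw [one_add_pairInvariant, Complex.sq_norm, inv_div]
  rw [div_eq_iff h3, sub_mul, div_mul_cancel₀ _ h3]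
  rw [Complex.normSq_apply, Complex.normSq_apply]
  simp only [Complex.sub_re, Complex.sub_im, Complex.conj_re, Complex.conj_im,
    UpperHalfPlane.coe_re, UpperHalfPlane.coe_im]
  ring

theorem norm_discCoord_lt_one (z w : ℍ) : ‖discCoord z w‖ < 1 := by
  have h := normSq_discCoord z w
  rw [Complex.mul_conj] at h
  norm_cast at h
  rw [Complex.normSq_eq_norm_sq] at h
  have h3 : 0 < 1 + pairInvariant z w := by linarith [pairInvariant_nonneg z w]
  have h4 : 0 < (1 + pairInvariant z w)⁻¹ := inv_pos.2 h3
  nlinarith [norm_nonneg (discCoord z w)]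

/-- The integrand in the angular coordinate. -/
def angularPair (a b q : ℂ) (φ : ℝ) : ℂ :=
  (1 + q * Complex.exp (-(2 * φ * Complex.I))) ^ (-a)
    * (1 + conj q * Complex.exp (2 * φ * Complex.I)) ^ (-b)

theorem conj_exp_angle (φ : ℝ) :
    conj (Complex.exp (-(2 * φ * Complex.I))) = Complex.exp (2 * φ * Complex.I) := by
  rw [← Complex.exp_conj]
  simp [map_ofNat (starRingEnd ℂ) 2]

theorem norm_exp_angle (φ : ℝ) : ‖Complex.exp (2 * φ * Complex.I)‖ = 1 := by
  have := Complex.norm_exp_ofReal_mul_I (2 * φ)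
  push_cast at this
  exact this

theorem norm_exp_neg_angle (φ : ℝ) : ‖Complex.exp (-(2 * φ * Complex.I))‖ = 1 := by
  have := Complex.norm_exp_ofReal_mul_I (-(2 * φ))
  push_cast at this
  rwa [neg_mul] at this

theorem one_add_mem_slitPlane {x : ℂ} (hx : ‖x‖ < 1) : 1 + x ∈ Complex.slitPlane :=
  Complex.mem_slitPlane_of_norm_lt_one hx

theorem re_one_add_pos {x : ℂ} (hx : ‖x‖ < 1) : 0 < (1 + x).re := by
  have := Complex.abs_re_le_norm x
  simp
  linarith [neg_abs_le x.re]

theorem poissonPair_angular (k : ℤ) (s : ℂ) (z w : ℍ) {φ : ℝ} (hφ : 0 < Real.cos φ) :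
    ((z.im / Real.cos φ ^ 2 : ℝ) : ℂ) * poissonPair k s z w (z.re + z.im * Real.tan φ) =
      weightFactor k z w * (((1 + pairInvariant z w)⁻¹ : ℝ) : ℂ) ^ (1 - s)
        * angularPair (1 - s - k) (1 - s + k) (discCoord z w) φ := by
  set q := discCoord z w with hq
  set E := Complex.exp (φ * Complex.I) with hE
  have hE0 : E ≠ 0 := Complex.exp_ne_zero _
  set c : ℝ := Real.cos φ with hc
  have hc0 : (c : ℂ) ≠ 0 := by exact_mod_cast hφ.ne'
  have hyp := z.im_pos
  have hy0 : (z.im : ℂ) ≠ 0 := by exact_mod_cast hyp.ne'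
  have hcE : (c : ℂ) = (E + E⁻¹) / 2 := by
    rw [hc, Complex.ofReal_cos, Complex.cos, hE, ← Complex.exp_neg]; ring_nf
  have hsE : ((Real.sin φ : ℝ) : ℂ) = (E⁻¹ - E) * Complex.I / 2 := by
    rw [Complex.ofReal_sin, Complex.sin, hE, ← Complex.exp_neg]; ring_nf
  have hE2 : Complex.exp (2 * φ * Complex.I) = E ^ 2 := by
    rw [hE, ← Complex.exp_nat_mul]; push_cast; ring_nf
  have hEm2 : Complex.exp (-(2 * φ * Complex.I)) = (E ^ 2)⁻¹ := by
    rw [Complex.exp_neg, hE2]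
  set ζ : ℝ := z.re + z.im * Real.tan φ with hζ
  have hζc : (ζ : ℂ) * c = z.re * c + z.im * (Real.sin φ : ℝ) := by
    rw [hζ, Real.tan_eq_sin_div_cos, ← hc]; push_cast; field_simp
  have hzre : (z : ℂ) = z.re + z.im * Complex.I := (Complex.re_add_im z).symm
  have hzcre : conj (z : ℂ) = z.re - z.im * Complex.I := by
    conv_lhs => rw [hzre]
    simp; ring
  set A := 1 + q * Complex.exp (-(2 * φ * Complex.I)) with hA
  set B := 1 + conj q * Complex.exp (2 * φ * Complex.I) with hB
  have hBA : B = conj A := by rw [hA, map_add, map_mul, conj_exp_angle, map_one]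
  have hI : Complex.I ^ 2 = -1 := Complex.I_sq
  -- With `y = Im z` and `q` the disc coordinate, `z - ζ = i y e^(iφ)/cos φ` and `w - ζ = (w - z̄)
  -- e^(iφ) (1 + q e^(-2iφ))/(2 cos φ)`. The phases `e^(±iφ)` from `z` and from `w` cancel because
  -- the weights are opposite.
  have z1 : ((z : ℂ) - ζ) * c = Complex.I * z.im * E := by
    rw [sub_mul, hζc, hsE, hzre, hcE]; ring
  have z2 : (conj (z : ℂ) - ζ) * c = -(Complex.I * z.im * E⁻¹) := by
    rw [sub_mul, hζc, hsE, hzcre, hcE]; ring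
  have hd1 := sub_conj_ne_zero z w
  have hd2 := conj_sub_ne_zero z w
  have qa : q * ((w : ℂ) - conj (z : ℂ)) = (w : ℂ) - z := div_mul_cancel₀ _ hd1
  have qb : conj q * (conj (w : ℂ) - (z : ℂ)) = conj (w : ℂ) - conj (z : ℂ) := by
    have := congrArg conj qa
    simpa using this
  have w1 : ((w : ℂ) - ζ) * (2 * c) = ((w : ℂ) - conj (z : ℂ)) * E * A := by
    rw [hA, hEm2]
    have : ((w : ℂ) - conj (z : ℂ)) * E * (1 + q * (E ^ 2)⁻¹) =
      ((w : ℂ) - conj (z : ℂ)) * E + (q * ((w : ℂ) - conj (z : ℂ))) * E⁻¹ := by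
      field_simp
    rw [this, qa]
    have : ((w : ℂ) - ζ) * (2 * c) = ((w : ℂ) - z.re) * (2 * c) - 2 * z.im * (Real.sin φ : ℝ) := by
      linear_combination (-2) * hζc
    rw [this, hsE, hzcre, hcE, hzre]
    ring
  have w2 : (conj (w : ℂ) - ζ) * (2 * c) = (conj (w : ℂ) - (z : ℂ)) * E⁻¹ * B := by
    have h1 : conj E = E⁻¹ := by
      rw [hE, ← Complex.exp_conj, ← Complex.exp_neg]; simp
    have := congrArg conj w1
    rw [hBA, ← h1]
    simpa [map_ofNat (starRingEnd ℂ) 2] using this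
  have hAre : ‖q * Complex.exp (-(2 * φ * Complex.I))‖ < 1 := by
    rw [norm_mul, norm_exp_neg_angle, mul_one]; exact norm_discCoord_lt_one z w
  have hA0 : A ≠ 0 := Complex.slitPlane_ne_zero (one_add_mem_slitPlane hAre)
  have hB0 : B ≠ 0 := by rw [hBA]; simpa using hA0
  have c1 := coe_sub_ofReal_ne_zero z ζ
  have c2 := conj_sub_ofReal_ne_zero z ζ
  have c3 := coe_sub_ofReal_ne_zero w ζ
  have c4 := conj_sub_ofReal_ne_zero w ζ
  -- the phases
  have phase : (conj (z : ℂ) - ζ) ^ k * ((z : ℂ) - ζ) ^ (-k) *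
      ((conj (w : ℂ) - ζ) ^ (-k) * ((w : ℂ) - ζ) ^ (- -k)) =
      weightFactor k z w * (A ^ k * B ^ (-k)) := by
    rw [weightFactor]
    simp only [zpow_neg, neg_neg, ← inv_zpow, ← mul_zpow]
    congr 1
    have e1 : (z : ℂ) - ζ = Complex.I * z.im * E / c := by rw [← z1]; field_simp
    have e2 : conj (z : ℂ) - ζ = -(Complex.I * z.im * E⁻¹) / c := by rw [← z2]; field_simp
    have e3 : (w : ℂ) - ζ = ((w : ℂ) - conj (z : ℂ)) * E * A / (2 * c) := by rw [← w1]; field_simp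
    have e4 : conj (w : ℂ) - ζ = (conj (w : ℂ) - (z : ℂ)) * E⁻¹ * B / (2 * c) := by
      rw [← w2]; field_simp
    rw [e1, e2, e3, e4]
    have := Complex.I_ne_zero
    field_simp
    ring
  -- the moduli
  have pz : poissonKernel z ζ = c ^ 2 / z.im := by
    have h1 : ‖conj (z : ℂ) - ζ‖ * c = z.im := by
      have := congrArg norm z2
      rw [norm_neg, norm_mul, norm_mul, norm_mul, norm_inv, hE, Complex.norm_exp_ofReal_mul_I,
        Complex.norm_I, Complex.norm_real, Complex.norm_real, Real.norm_of_nonneg hφ.le,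
        Real.norm_of_nonneg hyp.le] at this
      simpa using this
    rw [poissonKernel, eq_div_of_mul_eq hφ.ne' h1]
    field_simp
  have pw : poissonKernel w ζ = (c ^ 2 / z.im) * (1 + pairInvariant z w)⁻¹ * (Complex.normSq A)⁻¹ := by
    have h1 : ‖conj (w : ℂ) - ζ‖ * (2 * c) = ‖(w : ℂ) - conj (z : ℂ)‖ * ‖A‖ := by
      have := congrArg norm w2
      rw [norm_mul, norm_mul, norm_mul, norm_mul, norm_inv, hE, Complex.norm_exp_ofReal_mul_I,
        Complex.norm_real, Real.norm_of_nonneg hφ.le] at this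
      have h2 : ‖conj (w : ℂ) - (z : ℂ)‖ = ‖(w : ℂ) - conj (z : ℂ)‖ := by
        rw [← Complex.norm_conj]; simp
      rw [h2, hBA, Complex.norm_conj] at this
      simpa using this
    have h5 : ‖(w : ℂ) - conj (z : ℂ)‖ ≠ 0 := norm_ne_zero_iff.2 hd1
    have h6 : ‖A‖ ≠ 0 := norm_ne_zero_iff.2 hA0
    have h7 := w.im_pos
    rw [poissonKernel, one_add_pairInvariant, Complex.normSq_eq_norm_sq,
      eq_div_of_mul_eq (by positivity) h1]
    field_simp
    ring
  have hv : 0 < (1 + pairInvariant z w)⁻¹ := inv_pos.2 (by linarith [pairInvariant_nonneg z w])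
  have hN : 0 < Complex.normSq A := Complex.normSq_pos.2 hA0
  have hcy : 0 < c ^ 2 / z.im := by positivity
  have argA : A.arg ≠ Real.pi := by
    have : A.re > 0 := re_one_add_pos hAre
    intro h
    rw [Complex.arg_eq_pi_iff] at h
    linarith [h.1]
  -- `A` and `B` are conjugate and lie in the right half-plane, so their arguments are opposite; the
  -- principal power of `A B = |A|²` may therefore be split.
  have sumarg : A.arg + B.arg ∈ Set.Ioc (-Real.pi) Real.pi := by
    have : A.arg + B.arg = 0 := by rw [hBA, Complex.arg_conj, if_neg argA]; ring
    rw [this]; exact ⟨by linarith [Real.pi_pos], Real.pi_pos.le⟩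
  have moduli : ((z.im / c ^ 2 : ℝ) : ℂ) * ((poissonKernel z ζ : ℂ) ^ s *
      (poissonKernel w ζ : ℂ) ^ (1 - s)) =
      (((1 + pairInvariant z w)⁻¹ : ℝ) : ℂ) ^ (1 - s) * (A ^ (-(1 - s)) * B ^ (-(1 - s))) := by
    rw [pz, pw, Complex.ofReal_mul, Complex.ofReal_mul,
      ← Complex.ofReal_mul (c ^ 2 / z.im), Complex.mul_cpow_ofReal_nonneg (by positivity)
        (by positivity), Complex.ofReal_mul, Complex.mul_cpow_ofReal_nonneg hcy.le hv.le]
    have h1 : ((c ^ 2 / z.im : ℝ) : ℂ) ^ s * ((c ^ 2 / z.im : ℝ) : ℂ) ^ (1 - s) =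
        ((c ^ 2 / z.im : ℝ) : ℂ) := by
      rw [← Complex.cpow_add _ _ (by exact_mod_cast hcy.ne')]; simp
    have h2 : (((Complex.normSq A)⁻¹ : ℝ) : ℂ) ^ (1 - s) = A ^ (-(1 - s)) * B ^ (-(1 - s)) := by
      rw [Complex.ofReal_inv, Complex.inv_cpow _ _ (by
        rw [Complex.arg_ofReal_of_nonneg hN.le]; exact Real.pi_pos.ne), ← Complex.mul_conj, ← hBA,
        Complex.cpow_neg, Complex.cpow_neg, ← mul_inv,
        Complex.cpow_def_of_ne_zero (mul_ne_zero hA0 hB0), Complex.log_mul hA0 hB0 sumarg,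
        add_mul, Complex.exp_add, ← Complex.cpow_def_of_ne_zero hA0,
        ← Complex.cpow_def_of_ne_zero hB0]
    have h3 : ((z.im / c ^ 2 : ℝ) : ℂ) * ((c ^ 2 / z.im : ℝ) : ℂ) = 1 := by
      norm_cast; field_simp
    rw [h2]
    calc _ = ((z.im / c ^ 2 : ℝ) : ℂ) * (((c ^ 2 / z.im : ℝ) : ℂ) ^ s
          * ((c ^ 2 / z.im : ℝ) : ℂ) ^ (1 - s)) *
          ((((1 + pairInvariant z w)⁻¹ : ℝ) : ℂ) ^ (1 - s) * (A ^ (-(1 - s)) * B ^ (-(1 - s)))) := by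
          ring
      _ = _ := by rw [h1, h3, one_mul]
  rw [poissonPair, weightPoisson, weightPoisson, angularPair, ← hA, ← hB]
  calc _ = ((conj (z : ℂ) - ζ) ^ k * ((z : ℂ) - ζ) ^ (-k) *
      ((conj (w : ℂ) - ζ) ^ (-k) * ((w : ℂ) - ζ) ^ (- -k))) * (((z.im / c ^ 2 : ℝ) : ℂ) *
      ((poissonKernel z ζ : ℂ) ^ s * (poissonKernel w ζ : ℂ) ^ (1 - s))) := by ring
    _ = _ := by
      rw [phase, moduli, show -(1 - s - (k : ℂ)) = -(1 - s) + k by ring,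
        show -(1 - s + (k : ℂ)) = -(1 - s) + (-k : ℤ) by push_cast; ring,
        Complex.cpow_add _ _ hA0, Complex.cpow_add _ _ hB0, Complex.cpow_intCast,
        Complex.cpow_intCast]
      ring

theorem hasSum_binomial (a : ℂ) {x : ℂ} (hx : ‖x‖ < 1) :
    HasSum (fun n => hgCoeff a 1 1 n * (-x) ^ n) ((1 + x) ^ (-a)) := by
  have h := (Complex.one_add_cpow_hasFPowerSeriesOnBall_zero (a := -a)).hasSum (y := x)
    (by rwa [Metric.mem_eball, edist_zero_right, ← ofReal_norm, ENNReal.ofReal_lt_one])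
  rw [zero_add, binomialSeries_eq_ordinaryHypergeometricSeries (b := 1), neg_neg] at h
  · refine h.congr_fun fun n => ?_
    simp only [FormalMultilinearSeries.compContinuousLinearMap_apply]
    have : (⇑(-ContinuousLinearMap.id ℂ ℂ) ∘ fun _ : Fin n => x) = fun _ => -x := by
      ext; simp
    rw [this, ordinaryHypergeometricSeries_apply_eq]
    simp [hgCoeff, ordinaryHypergeometricCoefficient]
  · intro k hk
    exact nonPole_one k (by rw [hk, neg_neg])

/-- Since `(1)_n = n!`, binomial coefficients are `hgCoeff a 1 1`, and their products are the
diagonal terms in Parseval's formula. -/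
theorem hgCoeff_mul (a b : ℂ) (n : ℕ) : hgCoeff a 1 1 n * hgCoeff b 1 1 n = hgCoeff a b 1 n := by
  have h : (ascPochhammer ℂ n).eval 1 ≠ 0 := nonPole_one.ascPochhammer_ne_zero n
  have h' : (ascPochhammer ℂ n).eval 1 = (n.factorial : ℂ) := by
    rw [ascPochhammer_eval_one]
  simp only [hgCoeff, ordinaryHypergeometricCoefficient]
  rw [h'] at h ⊢
  field_simp

theorem integral_exp_angle (m n : ℕ) :
    ∫ φ in (-(Real.pi / 2))..(Real.pi / 2),
      Complex.exp (-(2 * φ * Complex.I)) ^ m * Complex.exp (2 * φ * Complex.I) ^ n =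
      if m = n then (Real.pi : ℂ) else 0 := by
  have h : ∀ φ : ℝ, Complex.exp (-(2 * φ * Complex.I)) ^ m * Complex.exp (2 * φ * Complex.I) ^ n =
      Complex.exp ((2 * ((n : ℂ) - m) * Complex.I) * φ) := fun φ => by
    rw [← Complex.exp_nat_mul, ← Complex.exp_nat_mul, ← Complex.exp_add]; congr 1; ring
  simp only [h]
  split_ifs with hmn
  · simp [hmn]
  · have hne : (2 * ((n : ℂ) - m) * Complex.I) ≠ 0 := by
      refine mul_ne_zero (mul_ne_zero two_ne_zero (sub_ne_zero.2 ?_)) Complex.I_ne_zero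
      exact_mod_cast Ne.symm hmn
    rw [integral_exp_mul_complex hne]
    have : Complex.exp ((2 * ((n : ℂ) - m) * Complex.I) * ((Real.pi / 2 : ℝ) : ℂ)) =
        Complex.exp ((2 * ((n : ℂ) - m) * Complex.I) * ((-(Real.pi / 2) : ℝ) : ℂ)) := by
      rw [Complex.exp_eq_exp_iff_exists_int]
      refine ⟨(n : ℤ) - m, ?_⟩
      push_cast; ring
    rw [this, sub_self, zero_div]

theorem continuous_angularPair (a b : ℂ) {q : ℂ} (hq : ‖q‖ < 1) :
    Continuous (angularPair a b q) := by
  unfold angularPair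
  refine Continuous.mul (Continuous.cpow (by fun_prop) continuous_const fun φ => ?_)
    (Continuous.cpow (by fun_prop) continuous_const fun φ => ?_)
  · exact one_add_mem_slitPlane (by rw [norm_mul, norm_exp_neg_angle, mul_one]; exact hq)
  · exact one_add_mem_slitPlane (by rw [norm_mul, norm_exp_angle, mul_one, Complex.norm_conj]; exact hq)

/-- Parseval's formula for the product of two binomial series. -/
theorem integral_angularPair (a b : ℂ) {q : ℂ} (hq : ‖q‖ < 1) :
    ∫ φ in (-(Real.pi / 2))..(Real.pi / 2), angularPair a b q φ =
      Real.pi * powSum (hgCoeff a b 1) (q * conj q) := by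
  set α := hgCoeff a 1 1 with hα
  set β := hgCoeff b 1 1 with hβ
  have hsα := hgCoeff_discSummable a 1 nonPole_one q hq
  have hsβ := hgCoeff_discSummable b 1 nonPole_one (conj q) (by rwa [Complex.norm_conj])
  rw [← hα] at hsα
  rw [← hβ] at hsβ
  -- The double binomial expansion. Integration over a period keeps only the diagonal, where the two
  -- signs `(-1)^n` cancel.
  set F : ℕ × ℕ → ℝ → ℂ := fun x φ => (α x.1 * (-q) ^ x.1 * (β x.2 * (-conj q) ^ x.2)) *
    (Complex.exp (-(2 * φ * Complex.I)) ^ x.1 * Complex.exp (2 * φ * Complex.I) ^ x.2) with hF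
  have hbound : Summable fun x : ℕ × ℕ => ‖α x.1 * q ^ x.1‖ * ‖β x.2 * (conj q) ^ x.2‖ :=
    hsα.mul_of_nonneg hsβ (fun _ => norm_nonneg _) (fun _ => norm_nonneg _)
  have hnorm : ∀ x φ, ‖F x φ‖ = ‖α x.1 * q ^ x.1‖ * ‖β x.2 * (conj q) ^ x.2‖ := fun x φ => by
    simp only [hF, norm_mul, norm_pow, norm_neg, norm_exp_angle, norm_exp_neg_angle, one_pow, mul_one]
  have h1 : HasSum (fun x => ∫ φ in (-(Real.pi / 2))..(Real.pi / 2), F x φ)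
      (∫ φ in (-(Real.pi / 2))..(Real.pi / 2), angularPair a b q φ) := by
    refine intervalIntegral.hasSum_integral_of_dominated_convergence
      (fun x _ => ‖α x.1 * q ^ x.1‖ * ‖β x.2 * (conj q) ^ x.2‖) (fun x => ?_) (fun x => ?_) ?_ ?_ ?_
    · exact (by simp only [hF]; fun_prop : Continuous (F x)).aestronglyMeasurable
    · exact Eventually.of_forall fun φ _ => (hnorm x φ).le
    · exact Eventually.of_forall fun φ _ => hbound
    · exact intervalIntegrable_const
    · refine Eventually.of_forall fun φ _ => ?_
      have s1 := hasSum_binomial a (x := q * Complex.exp (-(2 * φ * Complex.I)))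
        (by rw [norm_mul, norm_exp_neg_angle, mul_one]; exact hq)
      have s2 := hasSum_binomial b (x := conj q * Complex.exp (2 * φ * Complex.I))
        (by rw [norm_mul, norm_exp_angle, mul_one, Complex.norm_conj]; exact hq)
      have hs : Summable fun x => F x φ := by
        refine Summable.of_norm ?_
        simpa only [hnorm] using hbound
      have hFe : (fun x => F x φ) = fun x : ℕ × ℕ =>
          (α x.1 * (-(q * Complex.exp (-(2 * φ * Complex.I)))) ^ x.1) *
          (β x.2 * (-(conj q * Complex.exp (2 * φ * Complex.I))) ^ x.2) := by
        ext x
        simp only [hF, ← neg_mul, mul_pow]; ring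
      rw [hFe] at hs ⊢
      rw [angularPair]
      exact HasSum.mul (f := fun n => α n * (-(q * Complex.exp (-(2 * φ * Complex.I)))) ^ n)
        (g := fun n => β n * (-(conj q * Complex.exp (2 * φ * Complex.I))) ^ n) s1 s2 hs
  have h2 : ∀ x : ℕ × ℕ, ∫ φ in (-(Real.pi / 2))..(Real.pi / 2), F x φ =
      (α x.1 * (-q) ^ x.1 * (β x.2 * (-conj q) ^ x.2)) * if x.1 = x.2 then (Real.pi : ℂ) else 0 := by
    intro x
    simp only [hF]
    rw [intervalIntegral.integral_const_mul, integral_exp_angle]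
  simp only [h2] at h1
  have hinj : Function.Injective fun n : ℕ => (n, n) := fun m n h => (Prod.mk.inj h).1
  rw [← hinj.hasSum_iff] at h1
  · have h3 : HasSum (fun n => Real.pi * (hgCoeff a b 1 n * (q * conj q) ^ n))
        (∫ φ in (-(Real.pi / 2))..(Real.pi / 2), angularPair a b q φ) := by
      refine h1.congr_fun fun n => ?_
      simp only [Function.comp_apply, if_true]
      rw [← hgCoeff_mul, mul_pow, neg_pow, neg_pow (conj q)]
      have : ((-1 : ℂ) ^ n) * (-1) ^ n = 1 := by rw [← mul_pow]; simp
      linear_combination (-(Real.pi * α n * β n * q ^ n * (conj q) ^ n)) * this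
    rw [← h3.tsum_eq, tsum_mul_left]; rfl
  · rintro ⟨m, n⟩ hmn
    have : m ≠ n := fun h => hmn ⟨m, by simp [h]⟩
    simp [this]

/-- The angular parametrization of the boundary as seen from `z`. -/
def angleToBdry (z : ℍ) (φ : ℝ) : ℝ := z.re + z.im * Real.tan φ

theorem angleToBdry_image (z : ℍ) :
    angleToBdry z '' Set.Ioo (-(Real.pi / 2)) (Real.pi / 2) = Set.univ := by
  refine Set.eq_univ_of_forall fun x => ?_
  obtain ⟨φ, hφ, h⟩ : (x - z.re) / z.im ∈ Real.tan '' Set.Ioo (-(Real.pi / 2)) (Real.pi / 2) := by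
    rw [Real.image_tan_Ioo]; trivial
  refine ⟨φ, hφ, ?_⟩
  have := z.im_ne_zero
  rw [angleToBdry, h]; field_simp; ring

theorem angleToBdry_injOn (z : ℍ) :
    Set.InjOn (angleToBdry z) (Set.Ioo (-(Real.pi / 2)) (Real.pi / 2)) := fun x hx y hy h => by
  refine Real.injOn_tan hx hy ?_
  have h2 := z.im_ne_zero
  simp only [angleToBdry, add_right_inj] at h
  exact mul_left_cancel₀ h2 h

theorem hasDerivAt_angleToBdry (z : ℍ) {φ : ℝ} (hφ : φ ∈ Set.Ioo (-(Real.pi / 2)) (Real.pi / 2)) :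
    HasDerivAt (angleToBdry z) (z.im / Real.cos φ ^ 2) φ := by
  have := ((Real.hasDerivAt_tan (Real.cos_pos_of_mem_Ioo hφ).ne').const_mul z.im).const_add z.re
  refine this.congr_deriv ?_
  ring

theorem angular_smul_eq (k : ℤ) (s : ℂ) (z w : ℍ) {φ : ℝ}
    (hφ : φ ∈ Set.Ioo (-(Real.pi / 2)) (Real.pi / 2)) :
    |z.im / Real.cos φ ^ 2| • poissonPair k s z w (angleToBdry z φ) =
      weightFactor k z w * (((1 + pairInvariant z w)⁻¹ : ℝ) : ℂ) ^ (1 - s)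
        * angularPair (1 - s - k) (1 - s + k) (discCoord z w) φ := by
  have hc := Real.cos_pos_of_mem_Ioo hφ
  have := z.im_pos
  rw [abs_of_pos (by positivity), Complex.real_smul, ← poissonPair_angular k s z w hc]
  rfl

theorem integrable_poissonPair (k : ℤ) (s : ℂ) (z w : ℍ) :
    Integrable (poissonPair k s z w) := by
  rw [← integrableOn_univ, ← angleToBdry_image z,
    integrableOn_image_iff_integrableOn_abs_deriv_smul measurableSet_Ioo
      (fun φ hφ => (hasDerivAt_angleToBdry z hφ).hasDerivWithinAt) (angleToBdry_injOn z)]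
  have : IntegrableOn (fun φ => weightFactor k z w *
      (((1 + pairInvariant z w)⁻¹ : ℝ) : ℂ) ^ (1 - s)
        * angularPair (1 - s - k) (1 - s + k) (discCoord z w) φ)
      (Set.Ioo (-(Real.pi / 2)) (Real.pi / 2)) := by
    refine (Continuous.integrableOn_Icc ?_).mono_set Set.Ioo_subset_Icc_self
    exact continuous_const.mul (continuous_angularPair _ _ (norm_discCoord_lt_one z w))
  refine this.congr_fun (fun φ hφ => ?_) measurableSet_Ioo
  exact (angular_smul_eq k s z w hφ).symm

theorem integral_poissonPair (k : ℤ) (s : ℂ) (z w : ℍ) :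
    ∫ ζ, poissonPair k s z w ζ = weightFactor k z w *
      (Real.pi * (((1 + pairInvariant z w)⁻¹ : ℝ) : ℂ) ^ (1 - s)
        * powSum (hgCoeff (1 - s - k) (1 - s + k) 1)
          (1 - (((1 + pairInvariant z w)⁻¹ : ℝ) : ℂ))) := by
  have h := integral_image_eq_integral_abs_deriv_smul measurableSet_Ioo
      (fun φ hφ => (hasDerivAt_angleToBdry z hφ).hasDerivWithinAt) (angleToBdry_injOn z)
      (poissonPair k s z w)
  rw [angleToBdry_image, setIntegral_univ] at h
  rw [h, setIntegral_congr_fun measurableSet_Ioo (fun φ hφ => angular_smul_eq k s z w hφ),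
    ← integral_Ioc_eq_integral_Ioo, ← intervalIntegral.integral_of_le (by linarith [Real.pi_pos]),
    intervalIntegral.integral_const_mul, integral_angularPair _ _ (norm_discCoord_lt_one z w),
    normSq_discCoord]
  ring

theorem hgCoeff_symm (a b c : ℂ) : hgCoeff a b c = hgCoeff b a c := by
  ext n; simp only [hgCoeff, ordinaryHypergeometricCoefficient]; ring

/-- The Poisson integral is the sum of the two kernels. -/
theorem integral_poissonPair_eq_greenKernel {k : ℤ} (hk : k = 0 ∨ k = 1 ∨ k = -1) {s : ℂ}
    (h0 : 0 < s.re) (h1 : s.re < 1) (hs : s ≠ 1 / 2) {z w : ℍ} (hzw : z ≠ w) :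
    ∫ ζ, poissonPair k s z w ζ = greenKernel k s z w + greenKernel k (1 - s) z w := by
  rw [integral_poissonPair, greenKernel_add hk h0 h1 hs (pairInvariant_pos hzw)]
  congr 3
  rcases hk with rfl | rfl | rfl
  · simp
  · simp
  -- For `k = -1` replacing `k` by `|k|` exchanges the two upper parameters.
  · rw [hgCoeff_symm]; simp [sub_eq_add_neg]

/-! ### Möbius transformations of the real line -/

/-- The denominator `c x + d` at a real point. -/
def bden (γ : SL2R) (x : ℝ) : ℝ := γ 1 0 * x + γ 1 1

/-- The value `(a x + b) / (c x + d)` at a real point (meaningful where `c x + d ≠ 0`). -/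
def bact (γ : SL2R) (x : ℝ) : ℝ := (γ 0 0 * x + γ 0 1) / bden γ x

theorem det_eq (γ : SL2R) : γ 0 0 * γ 1 1 - γ 0 1 * γ 1 0 = 1 := by
  have := γ.det_coe
  rwa [Matrix.det_fin_two] at this

theorem bdryAct_coe (γ : SL2R) (x : ℝ) :
    bdryAct γ x = if bden γ x = 0 then (OnePoint.infty : OnePoint ℝ) else ((bact γ x : ℝ) : OnePoint ℝ) := by
  rw [bdryAct, OnePoint.smul_some_eq_ite]
  simp only [bact, bden]
  split_ifs <;> simp_all

theorem bdryAct_coe_eq_coe {γ : SL2R} {x y : ℝ} :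
    bdryAct γ x = (y : OnePoint ℝ) ↔ bden γ x ≠ 0 ∧ bact γ x = y := by
  rw [bdryAct_coe]
  split_ifs with h
  · simp [h]
  · simp [h]

theorem bden_mul (γ γ' : SL2R) {x : ℝ} (h : bden γ' x ≠ 0) :
    bden (γ * γ') x = bden γ (bact γ' x) * bden γ' x := by
  unfold bact
  simp only [bden, Matrix.SpecialLinearGroup.coe_mul, Matrix.mul_apply, Fin.sum_univ_two] at *
  field_simp
  ring

theorem bact_mul (γ γ' : SL2R) {x : ℝ} (h : bden γ' x ≠ 0) (h' : bden γ (bact γ' x) ≠ 0) :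
    bact (γ * γ') x = bact γ (bact γ' x) := by
  have e := bden_mul γ γ' h
  rw [bact, e]
  conv_rhs => rw [bact]
  rw [div_eq_div_iff (mul_ne_zero h' h) h']
  have : bact γ' x * bden γ' x = γ' 0 0 * x + γ' 0 1 := div_mul_cancel₀ _ h
  simp only [Matrix.SpecialLinearGroup.coe_mul, Matrix.mul_apply, Fin.sum_univ_two]
  have hb : bden γ' x = γ' 1 0 * x + γ' 1 1 := rfl
  rw [hb] at this ⊢
  linear_combination (-bden γ (bact γ' x) * γ 0 0) * this

theorem bden_one (x : ℝ) : bden 1 x = 1 := by simp [bden]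

theorem bact_one (x : ℝ) : bact 1 x = x := by simp [bact, bden]

theorem bden_inv_mul (γ : SL2R) {x : ℝ} (h : bden γ x ≠ 0) : bden γ⁻¹ (bact γ x) * bden γ x = 1 := by
  rw [← bden_mul _ _ h, inv_mul_cancel, bden_one]

theorem bden_inv_ne_zero (γ : SL2R) {x : ℝ} (h : bden γ x ≠ 0) : bden γ⁻¹ (bact γ x) ≠ 0 :=
  fun h' => by have := bden_inv_mul γ h; rw [h', zero_mul] at this; exact zero_ne_one this

theorem bact_inv_bact (γ : SL2R) {x : ℝ} (h : bden γ x ≠ 0) : bact γ⁻¹ (bact γ x) = x := by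
  rw [← bact_mul _ _ h (bden_inv_ne_zero γ h), inv_mul_cancel, bact_one]

theorem hasDerivAt_bact (γ : SL2R) {x : ℝ} (h : bden γ x ≠ 0) :
    HasDerivAt (bact γ) (1 / bden γ x ^ 2) x := by
  have h1 : HasDerivAt (fun x => γ 0 0 * x + γ 0 1) (γ 0 0) x :=
    (((hasDerivAt_id x).const_mul (γ 0 0)).add_const (γ 0 1)).congr_deriv (mul_one _)
  have h2 : HasDerivAt (bden γ) (γ 1 0) x :=
    (((hasDerivAt_id x).const_mul (γ 1 0)).add_const (γ 1 1)).congr_deriv (mul_one _)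
  refine (h1.fun_div h2 h).congr_deriv ?_
  congr 1
  have := det_eq γ
  rw [bden]
  linear_combination this

theorem continuous_bden (γ : SL2R) : Continuous (bden γ) := by unfold bden; fun_prop

theorem measurable_bact (γ : SL2R) : Measurable (bact γ) := by
  unfold bact bden; fun_prop

/-- The points where `γ` is finite. -/
def finiteSet (γ : SL2R) : Set ℝ := {x | bden γ x ≠ 0}

theorem measurableSet_finiteSet (γ : SL2R) : MeasurableSet (finiteSet γ) :=
  (isOpen_ne_fun (continuous_bden γ) continuous_const).measurableSet

theorem ae_bden_ne_zero (γ : SL2R) : ∀ᵐ x : ℝ, bden γ x ≠ 0 := by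
  rw [ae_iff]
  refine Set.Finite.measure_zero ?_ _
  refine Set.Subsingleton.finite fun x hx y hy => ?_
  simp only [bden, not_not, Set.mem_ofPred_eq] at hx hy
  have hd := det_eq γ
  have hc : γ 1 0 ≠ 0 := fun hc => by
    rw [hc] at hx hd
    simp at hx
    rw [hx] at hd; simp at hd
  exact mul_left_cancel₀ hc (by linarith)

theorem injOn_bact (γ : SL2R) : Set.InjOn (bact γ) (finiteSet γ) := fun x hx y hy h => by
  rw [← bact_inv_bact γ hx, h, bact_inv_bact γ hy]

/-! ### Automorphy -/

theorem autFactor_ne_zero (γ : SL2R) (z : ℍ) : autFactor γ z ≠ 0 := fun h => by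
  have h1 := congrArg Complex.im h
  have h2 := congrArg Complex.re h
  have hd := det_eq γ
  simp [autFactor, z.im_ne_zero] at h1 h2
  rw [h1] at h2 hd
  simp at h2
  rw [h2] at hd; simp at hd

theorem coe_smul_eq (γ : SL2R) (z : ℍ) :
    ((γ • z : ℍ) : ℂ) = (((γ 0 0 : ℝ) : ℂ) * z + ((γ 0 1 : ℝ) : ℂ)) / autFactor γ z := by
  rw [UpperHalfPlane.coe_specialLinearGroup_apply]
  rfl

theorem autFactor_mul (γ γ' : SL2R) (z : ℍ) :
    autFactor (γ * γ') z = autFactor γ (γ' • z) * autFactor γ' z := by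
  have h := autFactor_ne_zero γ' z
  rw [autFactor, autFactor, coe_smul_eq, add_mul, mul_assoc, div_mul_cancel₀ _ h]
  simp only [autFactor, Matrix.SpecialLinearGroup.coe_mul, Matrix.mul_apply, Fin.sum_univ_two]
  push_cast
  ring

theorem autFactor_one (z : ℍ) : autFactor 1 z = 1 := by simp [autFactor]

theorem im_smul_eq (γ : SL2R) (z : ℍ) : (γ • z).im = z.im / Complex.normSq (autFactor γ z) := by
  have h := autFactor_ne_zero γ z
  have hn : Complex.normSq (autFactor γ z) ≠ 0 := (Complex.normSq_pos.2 h).ne'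
  rw [← UpperHalfPlane.coe_im, coe_smul_eq, Complex.div_im]
  have hd := det_eq γ
  rw [← sub_div]
  congr 1
  simp [autFactor]
  linear_combination z.im * hd

theorem smul_sub_bact (γ : SL2R) (z : ℍ) {x : ℝ} (h : bden γ x ≠ 0) :
    (((γ • z : ℍ) : ℂ) - bact γ x) * (autFactor γ z * bden γ x) = (z : ℂ) - x := by
  have h1 := autFactor_ne_zero γ z
  have h2 : (bden γ x : ℂ) ≠ 0 := by exact_mod_cast h
  have hd : ((γ 0 0 : ℝ) : ℂ) * ((γ 1 1 : ℝ) : ℂ) - ((γ 0 1 : ℝ) : ℂ) * ((γ 1 0 : ℝ) : ℂ) = 1 := by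
    exact_mod_cast det_eq γ
  rw [coe_smul_eq, bact]
  push_cast
  rw [div_sub_div _ _ h1 h2, div_mul_cancel₀ _ (mul_ne_zero h1 h2), autFactor, bden]
  push_cast
  linear_combination ((z : ℂ) - x) * hd

theorem conj_smul_sub_bact (γ : SL2R) (z : ℍ) {x : ℝ} (h : bden γ x ≠ 0) :
    (conj ((γ • z : ℍ) : ℂ) - bact γ x) * (conj (autFactor γ z) * bden γ x) = conj (z : ℂ) - x := by
  have := congrArg conj (smul_sub_bact γ z h)
  simpa using this

theorem poissonKernel_pos (z : ℍ) (x : ℝ) : 0 < poissonKernel z x :=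
  div_pos z.im_pos (pow_pos (norm_pos_iff.2 (conj_sub_ofReal_ne_zero z x)) 2)

theorem poissonKernel_smul (γ : SL2R) (z : ℍ) {x : ℝ} (h : bden γ x ≠ 0) :
    poissonKernel (γ • z) (bact γ x) = poissonKernel z x * bden γ x ^ 2 := by
  have h1 := autFactor_ne_zero γ z
  have h2 : ‖conj ((γ • z : ℍ) : ℂ) - bact γ x‖ ≠ 0 :=
    norm_ne_zero_iff.2 (conj_sub_ofReal_ne_zero _ _)
  have h3 : ‖autFactor γ z‖ ≠ 0 := norm_ne_zero_iff.2 h1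
  rw [poissonKernel, poissonKernel, ← conj_smul_sub_bact γ z h, im_smul_eq, norm_mul, norm_mul,
    Complex.norm_conj, Complex.norm_real, Complex.normSq_eq_norm_sq, mul_pow, mul_pow,
    Real.norm_eq_abs, sq_abs]
  field_simp

/-- The automorphy factors cancel the change in `z - ζ` and its conjugate, and `bden` is real, hence
contributes no phase. Only the positive factor `bden²` is left, so its power splits off without a
branch problem. -/
theorem weightPoisson_smul (k : ℤ) (s : ℂ) (γ : SL2R) (z : ℍ) {x : ℝ} (h : bden γ x ≠ 0) :
    autFactor γ z ^ (-k) * conj (autFactor γ z) ^ k * weightPoisson k s (γ • z) (bact γ x) =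
      ((bden γ x ^ 2 : ℝ) : ℂ) ^ s * weightPoisson k s z x := by
  have h1 := autFactor_ne_zero γ z
  have h1' : conj (autFactor γ z) ≠ 0 := by simpa using h1
  have h2 : (bden γ x : ℂ) ≠ 0 := by exact_mod_cast h
  have c1 := coe_sub_ofReal_ne_zero (γ • z) (bact γ x)
  have c2 := conj_sub_ofReal_ne_zero (γ • z) (bact γ x)
  rw [weightPoisson, weightPoisson, poissonKernel_smul γ z h, Complex.ofReal_mul,
    Complex.mul_cpow_ofReal_nonneg (poissonKernel_pos z x).le (sq_nonneg _),
    ← smul_sub_bact γ z h, ← conj_smul_sub_bact γ z h]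
  simp only [zpow_neg, ← inv_zpow]
  have e : (autFactor γ z)⁻¹ ^ k * conj (autFactor γ z) ^ k *
      ((conj ((γ • z : ℍ) : ℂ) - bact γ x) ^ k * (((γ • z : ℍ) : ℂ) - bact γ x)⁻¹ ^ k) =
      ((conj ((γ • z : ℍ) : ℂ) - bact γ x) * (conj (autFactor γ z) * bden γ x)) ^ k *
        ((((γ • z : ℍ) : ℂ) - bact γ x) * (autFactor γ z * bden γ x))⁻¹ ^ k := by
    simp only [← mul_zpow]
    congr 1
    field_simp
  linear_combination ((poissonKernel z x : ℂ) ^ s * ((bden γ x ^ 2 : ℝ) : ℂ) ^ s) * e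

/-- By the cocycle identity for `j`, left translation by `γ` acts through the boundary variable
alone. At exponents `s` and `1 - s` the two factors multiply to `bden²`, the inverse of the
Jacobian. -/
theorem eisensteinTerm_mul (k : ℤ) (s : ℂ) (γ β : SL2R) (z : ℍ) {x : ℝ} (h : bden γ x ≠ 0) :
    eisensteinTerm k s z (bact γ x) (γ * β) =
      ((bden γ x ^ 2 : ℝ) : ℂ) ^ s * eisensteinTerm k s z x β := by
  rw [eisensteinTerm, eisensteinTerm, autFactor_mul, mul_smul]
  have := weightPoisson_smul k s γ (β • z) h
  rw [map_mul, mul_zpow, mul_zpow]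
  linear_combination (autFactor β z ^ (-k) * conj (autFactor β z) ^ k) * this

theorem eisensteinTerm_one (k : ℤ) (s : ℂ) (z : ℍ) (x : ℝ) :
    eisensteinTerm k s z x 1 = weightPoisson k s z x := by
  simp [eisensteinTerm, autFactor_one]

theorem norm_phase (a : ℂ) (ha : a ≠ 0) (k : ℤ) : ‖a ^ (-k) * conj a ^ k‖ = 1 := by
  rw [norm_mul, norm_zpow, norm_zpow, Complex.norm_conj, ← zpow_add₀ (norm_ne_zero_iff.2 ha)]
  simp

theorem norm_weightPoisson (k : ℤ) (s : ℂ) (z : ℍ) (x : ℝ) :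
    ‖weightPoisson k s z x‖ = poissonKernel z x ^ s.re := by
  have h := norm_phase ((z : ℂ) - x) (coe_sub_ofReal_ne_zero z x) k
  rw [weightPoisson, norm_mul, Complex.norm_cpow_eq_rpow_re_of_pos (poissonKernel_pos z x), mul_comm
    (_ ^ k)]
  have e : conj (z : ℂ) - x = conj ((z : ℂ) - x) := by simp
  rw [e, h, one_mul]

theorem norm_eisensteinTerm (k : ℤ) (s : ℂ) (z : ℍ) (x : ℝ) (γ : SL2R) :
    ‖eisensteinTerm k s z x γ‖ = poissonKernel (γ • z) x ^ s.re := by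
  rw [eisensteinTerm, norm_mul, norm_phase _ (autFactor_ne_zero γ z), one_mul, norm_weightPoisson]

/-! ### The critical exponent -/

variable {Γ : Subgroup SL2R}

theorem criticalExponent_nonneg (Γ : Subgroup SL2R) : 0 ≤ criticalExponent Γ := by
  refine le_sInf ?_
  rintro _ ⟨s, hs, rfl⟩
  exact EReal.coe_nonneg.2 hs.1.le

theorem summable_exp_neg_dist {σ : ℝ} (hσ : criticalExponent Γ < (σ : EReal)) (x y : ℍ) :
    Summable fun γ : Γ => Real.exp (-σ * dist x ((γ : SL2R) • y)) := by
  obtain ⟨_, ⟨s, hs, rfl⟩, hlt⟩ := sInf_lt_iff.1 hσ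
  have hlt' : s < σ := EReal.coe_lt_coe_iff.1 hlt
  refine Summable.of_nonneg_of_le (fun _ => (Real.exp_pos _).le) (fun γ => ?_) (hs.2 x y)
  rw [Real.exp_le_exp]
  nlinarith [dist_nonneg (x := x) (y := (γ : SL2R) • y)]

/-- A summable family has countable support, and every exponential is positive. -/
theorem countable_of_criticalExponent_lt {σ : ℝ} (hσ : criticalExponent Γ < (σ : EReal)) :
    Countable Γ := by
  have h := (summable_exp_neg_dist hσ UpperHalfPlane.I UpperHalfPlane.I).countable_support
  have e : Function.support (fun γ : Γ => Real.exp (-σ * dist UpperHalfPlane.I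
      ((γ : SL2R) • UpperHalfPlane.I))) = Set.univ :=
    Set.eq_univ_of_forall fun γ => (Real.exp_pos _).ne'
  rw [e] at h
  exact Set.countable_univ_iff.1 h

/-- From `cosh d = 1 + 2u` follows `e^d ≤ 2 cosh d = 2 + 4u ≤ 4(1 + u)`. -/
theorem inv_one_add_pairInvariant_le (z w : ℍ) :
    (1 + pairInvariant z w)⁻¹ ≤ 4 * Real.exp (-dist z w) := by
  have h1 := z.im_pos
  have h2 := w.im_pos
  have h : Real.cosh (dist z w) = 1 + 2 * pairInvariant z w := by
    rw [UpperHalfPlane.cosh_dist, pairInvariant, Complex.dist_eq]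
    field_simp
    ring
  have h3 : Real.exp (dist z w) ≤ 2 * Real.cosh (dist z w) := by
    rw [Real.cosh_eq]; linarith [Real.exp_pos (-dist z w)]
  have h4 := pairInvariant_nonneg z w
  rw [Real.exp_neg, ← div_eq_mul_inv, inv_eq_one_div, div_le_div_iff₀ (by linarith) (Real.exp_pos _)]
  linarith

/-! ### Convergence of the automorphic Green functions -/

theorem norm_weightFactor (k : ℤ) (z w : ℍ) : ‖weightFactor k z w‖ = 1 := by
  have h := norm_phase (conj (w : ℂ) - z) (conj_sub_ne_zero z w) k
  have e : conj (conj (w : ℂ) - z) = -(conj (z : ℂ) - w) := by simp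
  rw [e, norm_mul, norm_zpow, norm_zpow, norm_neg] at h
  rw [weightFactor, norm_mul, norm_zpow, norm_zpow, mul_comm, h]

theorem norm_greenTerm (k : ℤ) (s : ℂ) (z w : ℍ) (γ : SL2R) :
    ‖greenTerm k s z w γ‖ = ‖greenKernel k s z (γ • w)‖ := by
  have h := norm_phase (autFactor γ w) (autFactor_ne_zero γ w) (-k)
  rw [neg_neg] at h
  rw [greenTerm, norm_mul, h, one_mul]

theorem tendsto_dist_smul {σ : ℝ} (h0 : 0 < σ) (hσ : criticalExponent Γ < (σ : EReal)) (z w : ℍ) :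
    Tendsto (fun γ : Γ => (1 + pairInvariant z ((γ : SL2R) • w))⁻¹) cofinite (𝓝 0) := by
  have h := (summable_exp_neg_dist hσ z w).tendsto_cofinite_zero
  have h1 : Tendsto (fun γ : Γ => 4 * Real.exp (-dist z ((γ : SL2R) • w))) cofinite (𝓝 0) := by
    have h2 := ((h.rpow_const (p := 1 / σ) (Or.inr (by positivity))).const_mul 4)
    rw [Real.zero_rpow (by positivity), mul_zero] at h2
    refine h2.congr fun γ => ?_
    rw [← Real.exp_mul]
    congr 2
    field_simp
  refine squeeze_zero (fun γ => ?_) (fun γ => inv_one_add_pairInvariant_le z _) h1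
  have := pairInvariant_nonneg z ((γ : SL2R) • w)
  positivity

/-- For all but finitely many `γ` the variable `v` is close to `0`, where the hypergeometric factor
is bounded, so the terms are `O(v^σ) = O(exp(-σ d))` with `σ = Re s`. At `s = 1/2` the Gamma pole
has the default value `0`, so the bound persists. -/
theorem summable_greenTerm {k : ℤ} {s : ℂ} (h0 : 0 < s.re)
    (hs : criticalExponent Γ < (s.re : EReal)) {z w : ℍ} (hz : ∀ γ ∈ Γ, z ≠ γ • w) :
    Summable fun γ : Γ => greenTerm k s z w γ := by
  set f := powSum (hgCoeff (s - (|k| : ℤ)) (s + (|k| : ℤ)) (2 * s)) with hf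
  have hcont : ContinuousAt f 0 :=
    (hgCoeff_discSummable _ _ (nonPole_of_re_pos (by simpa using h0))).continuousAt (by simp)
  have hv := tendsto_dist_smul h0 hs z w
  have hv' : Tendsto (fun γ : Γ => (((1 + pairInvariant z ((γ : SL2R) • w))⁻¹ : ℝ) : ℂ)) cofinite
      (𝓝 0) := by
    have := (Complex.continuous_ofReal.tendsto 0).comp hv
    rwa [Complex.ofReal_zero] at this
  have hb := (hcont.tendsto.comp hv').norm.eventually (gt_mem_nhds (lt_add_one ‖f 0‖))
  have hsum := (summable_exp_neg_dist hs z w).mul_left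
    (‖kernelConst (|k| : ℤ) s‖ * 4 ^ s.re * (‖f 0‖ + 1))
  refine Summable.of_norm_bounded_eventually hsum ?_
  filter_upwards [hb] with γ hγ
  have hu := pairInvariant_pos (hz γ γ.2)
  have hv0 : 0 < (1 + pairInvariant z ((γ : SL2R) • w))⁻¹ := by positivity
  rw [norm_greenTerm, greenKernel_eq h0 hu, norm_mul, norm_weightFactor, one_mul, norm_mul, norm_mul,
    Complex.norm_cpow_eq_rpow_re_of_pos hv0, ← hf]
  have h2 : (1 + pairInvariant z ((γ : SL2R) • w))⁻¹ ^ s.re ≤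
      4 ^ s.re * Real.exp (-s.re * dist z ((γ : SL2R) • w)) := by
    refine (Real.rpow_le_rpow hv0.le (inv_one_add_pairInvariant_le z _) h0.le).trans ?_
    rw [Real.mul_rpow (by norm_num) (Real.exp_pos _).le, ← Real.exp_mul]
    refine le_of_eq ?_
    congr 2; ring
  have h3 : ‖f (((1 + pairInvariant z ((γ : SL2R) • w))⁻¹ : ℝ) : ℂ)‖ ≤ ‖f 0‖ + 1 := le_of_lt hγ
  calc _ ≤ ‖kernelConst (|k| : ℤ) s‖ * (4 ^ s.re * Real.exp (-s.re * dist z ((γ : SL2R) • w)))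
        * (‖f 0‖ + 1) := by gcongr
    _ = _ := by ring

/-! ### The discontinuity set on the real line -/

theorem coe_mem_discontinuitySet_iff {ζ : ℝ} :
    (ζ : OnePoint ℝ) ∈ discontinuitySet Γ ↔
      ∃ ε > 0, ∀ γ ∈ Γ, ε ≤ ‖((γ • UpperHalfPlane.I : ℍ) : ℂ) - ζ‖ := by
  have hset : {q : OnePoint ℂ | ∃ γ ∈ Γ, q = (((γ • UpperHalfPlane.I : ℍ) : ℂ) : OnePoint ℂ)} =
      ((↑) : ℂ → OnePoint ℂ) '' {w | ∃ γ ∈ Γ, w = ((γ • UpperHalfPlane.I : ℍ) : ℂ)} := by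
    ext q
    constructor
    · rintro ⟨γ, hγ, rfl⟩; exact ⟨_, ⟨γ, hγ, rfl⟩, rfl⟩
    · rintro ⟨w, ⟨γ, hγ, rfl⟩, rfl⟩; exact ⟨γ, hγ, rfl⟩
  have hcl : (ζ : OnePoint ℝ) ∈ limitSet Γ ↔
      (ζ : ℂ) ∈ closure {w : ℂ | ∃ γ ∈ Γ, w = ((γ • UpperHalfPlane.I : ℍ) : ℂ)} := by
    rw [OnePoint.isOpenEmbedding_coe.isInducing.closure_eq_preimage_closure_image, ← hset]
    rfl
  rw [discontinuitySet, Set.mem_compl_iff, hcl, Metric.mem_closure_iff]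
  push Not
  constructor
  · rintro ⟨ε, hε, h⟩
    refine ⟨ε, hε, fun γ hγ => ?_⟩
    have := h _ ⟨γ, hγ, rfl⟩
    rwa [dist_comm, Complex.dist_eq] at this
  · rintro ⟨ε, hε, h⟩
    refine ⟨ε, hε, ?_⟩
    rintro _ ⟨γ, hγ, rfl⟩
    rw [dist_comm, Complex.dist_eq]
    exact h γ hγ

/-- The real points of the discontinuity set. -/
def omegaReal (Γ : Subgroup SL2R) : Set ℝ := {ζ | (ζ : OnePoint ℝ) ∈ discontinuitySet Γ}

theorem isOpen_omegaReal (Γ : Subgroup SL2R) : IsOpen (omegaReal Γ) := by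
  rw [Metric.isOpen_iff]
  intro ζ hζ
  obtain ⟨ε, hε, h⟩ := coe_mem_discontinuitySet_iff.1 hζ
  refine ⟨ε / 2, by positivity, fun x hx => coe_mem_discontinuitySet_iff.2 ⟨ε / 2, by positivity,
    fun γ hγ => ?_⟩⟩
  have h1 := h γ hγ
  have h2 : ‖(x : ℂ) - ζ‖ < ε / 2 := by
    rw [← Complex.ofReal_sub, Complex.norm_real]
    exact hx
  have h3 := norm_add_le (((γ • UpperHalfPlane.I : ℍ) : ℂ) - x) ((x : ℂ) - ζ)
  rw [sub_add_sub_cancel] at h3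
  linarith

/-- Change of base point from `i` to `z`: `|γi - γz| ≤ Im(γz) (e^d - 1)` with `d = d(i, z)`, and
`Im(γz) ≤ |γz - ζ|`, hence `|γi - ζ| ≤ e^d |γz - ζ|`. -/
theorem orbit_away {ζ : ℝ} (hζ : ζ ∈ omegaReal Γ) (z : ℍ) :
    ∃ ε > 0, ∀ γ ∈ Γ, ε ≤ ‖((γ • z : ℍ) : ℂ) - ζ‖ := by
  obtain ⟨ε, hε, h⟩ := coe_mem_discontinuitySet_iff.1 hζ
  refine ⟨ε * Real.exp (-dist UpperHalfPlane.I z), by positivity, fun γ hγ => ?_⟩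
  have h1 := h γ hγ
  have h2 := UpperHalfPlane.dist_coe_le (γ • UpperHalfPlane.I) (γ • z)
  rw [dist_smul, Complex.dist_eq] at h2
  have h3 := norm_add_le (((γ • UpperHalfPlane.I : ℍ) : ℂ) - ((γ • z : ℍ) : ℂ))
    (((γ • z : ℍ) : ℂ) - ζ)
  rw [sub_add_sub_cancel] at h3
  have h4 : (γ • z).im ≤ ‖((γ • z : ℍ) : ℂ) - ζ‖ := by
    have := Complex.abs_im_le_norm (((γ • z : ℍ) : ℂ) - ζ)
    simp only [Complex.sub_im, Complex.ofReal_im, sub_zero, UpperHalfPlane.coe_im] at this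
    exact (le_abs_self _).trans this
  have h5 : 1 ≤ Real.exp (dist UpperHalfPlane.I z) := Real.one_le_exp dist_nonneg
  rw [Real.exp_neg, ← div_eq_mul_inv, div_le_iff₀ (Real.exp_pos _)]
  nlinarith

/-- As `e^d ≤ 2 cosh d = (1 + |w|²)/Im w` for `d = d(i, w)`, the product `P e^d` is at most `(1 +
|w|²)/|w - ζ|²`, and `|w|² ≤ 2|w - ζ|² + 2ζ²`. -/
theorem poissonKernel_le {ε : ℝ} (hε : 0 < ε) {w : ℍ} {ζ : ℝ} (h : ε ≤ ‖(w : ℂ) - ζ‖) :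
    poissonKernel w ζ ≤ ((1 + 2 * ζ ^ 2) / ε ^ 2 + 2) * Real.exp (-dist UpperHalfPlane.I w) := by
  have hw := w.im_pos
  have hnorm : ‖conj (w : ℂ) - ζ‖ = ‖(w : ℂ) - ζ‖ := by
    rw [← Complex.norm_conj]; simp
  have hc : Real.cosh (dist UpperHalfPlane.I w) = (1 + w.re ^ 2 + w.im ^ 2) / (2 * w.im) := by
    rw [UpperHalfPlane.cosh_dist, Complex.dist_eq, Complex.sq_norm, Complex.normSq_apply]
    simp
    field_simp
    ring
  have h3 : Real.exp (dist UpperHalfPlane.I w) ≤ 2 * Real.cosh (dist UpperHalfPlane.I w) := by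
    rw [Real.cosh_eq]; linarith [Real.exp_pos (-dist UpperHalfPlane.I w)]
  have hn2 : ‖(w : ℂ) - ζ‖ ^ 2 = (w.re - ζ) ^ 2 + w.im ^ 2 := by
    rw [Complex.sq_norm, Complex.normSq_apply]; simp; ring
  have hpos : 0 < ‖(w : ℂ) - ζ‖ := hε.trans_le h
  rw [Real.exp_neg, ← div_eq_mul_inv, le_div_iff₀ (Real.exp_pos _), poissonKernel, hnorm]
  calc w.im / ‖(w : ℂ) - ζ‖ ^ 2 * Real.exp (dist UpperHalfPlane.I w)
      ≤ w.im / ‖(w : ℂ) - ζ‖ ^ 2 * (2 * ((1 + w.re ^ 2 + w.im ^ 2) / (2 * w.im))) := by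
        rw [← hc]; gcongr
    _ = (1 + w.re ^ 2 + w.im ^ 2) / ‖(w : ℂ) - ζ‖ ^ 2 := by field_simp
    _ ≤ ((1 + 2 * ζ ^ 2) + 2 * ‖(w : ℂ) - ζ‖ ^ 2) / ‖(w : ℂ) - ζ‖ ^ 2 := by
        refine div_le_div_of_nonneg_right ?_ (by positivity)
        rw [hn2]
        nlinarith [sq_nonneg (w.re - 2 * ζ), sq_nonneg w.im]
    _ = (1 + 2 * ζ ^ 2) / ‖(w : ℂ) - ζ‖ ^ 2 + 2 := by field_simp
    _ ≤ _ := by gcongr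

theorem summable_poissonKernel_rpow {σ : ℝ} (h0 : 0 < σ) (hσ : criticalExponent Γ < (σ : EReal))
    (z : ℍ) {ζ : ℝ} (hζ : ζ ∈ omegaReal Γ) :
    Summable fun γ : Γ => poissonKernel ((γ : SL2R) • z) ζ ^ σ := by
  obtain ⟨ε, hε, h⟩ := orbit_away hζ z
  refine Summable.of_nonneg_of_le (fun γ => Real.rpow_nonneg (poissonKernel_pos _ _).le _)
    (fun γ => ?_) ((summable_exp_neg_dist hσ UpperHalfPlane.I z).mul_left
      (((1 + 2 * ζ ^ 2) / ε ^ 2 + 2) ^ σ))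
  refine (Real.rpow_le_rpow (poissonKernel_pos _ _).le (poissonKernel_le hε (h γ γ.2)) h0.le).trans ?_
  rw [Real.mul_rpow (by positivity) (Real.exp_pos _).le, ← Real.exp_mul]
  refine le_of_eq ?_
  congr 2; ring

theorem summable_eisensteinTerm {k : ℤ} {s : ℂ} (h0 : 0 < s.re)
    (hs : criticalExponent Γ < (s.re : EReal)) (z : ℍ) {ζ : ℝ} (hζ : ζ ∈ omegaReal Γ) :
    Summable fun γ : Γ => ‖eisensteinTerm k s z ζ γ‖ := by
  simp only [norm_eisensteinTerm]
  exact summable_poissonKernel_rpow h0 hs z hζ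

/-- If orbit points accumulated at `γζ`, continuity of `γ⁻¹` there would make orbit points
accumulate at `ζ`. -/
theorem bact_mem_omegaReal {γ : SL2R} (hγ : γ ∈ Γ) {ζ : ℝ} (h : bden γ ζ ≠ 0)
    (hζ : ζ ∈ omegaReal Γ) : bact γ ζ ∈ omegaReal Γ := by
  refine coe_mem_discontinuitySet_iff.2 ?_
  obtain ⟨ε, hε, hE⟩ := coe_mem_discontinuitySet_iff.1 hζ
  by_contra hcon
  push Not at hcon
  set η := bact γ ζ
  have hη : bden γ⁻¹ η ≠ 0 := bden_inv_ne_zero γ h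
  have hback : bact γ⁻¹ η = ζ := bact_inv_bact γ h
  set f : ℂ → ℂ := fun w => (((γ⁻¹ 0 0 : ℝ) : ℂ) * w + ((γ⁻¹ 0 1 : ℝ) : ℂ)) /
    (((γ⁻¹ 1 0 : ℝ) : ℂ) * w + ((γ⁻¹ 1 1 : ℝ) : ℂ)) with hf
  have hden : ((γ⁻¹ 1 0 : ℝ) : ℂ) * η + ((γ⁻¹ 1 1 : ℝ) : ℂ) ≠ 0 := by
    unfold bden at hη
    exact_mod_cast hη
  have hfc : ContinuousAt f η := by
    refine ContinuousAt.div (by fun_prop) (by fun_prop) hden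
  have hfη : f η = ζ := by
    rw [← hback, hf, bact, bden]; push_cast; rfl
  obtain ⟨r, hr, hball⟩ := Metric.continuousAt_iff.1 hfc ε hε
  obtain ⟨β, hβ, hlt⟩ := hcon r hr
  have h1 := hball (x := ((β • UpperHalfPlane.I : ℍ) : ℂ)) (by rwa [Complex.dist_eq])
  rw [hfη, Complex.dist_eq] at h1
  have h2 : f ((β • UpperHalfPlane.I : ℍ) : ℂ) = ((((γ⁻¹ * β) • UpperHalfPlane.I : ℍ)) : ℂ) := by
    rw [mul_smul, coe_smul_eq γ⁻¹]; rfl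
  rw [h2] at h1
  exact absurd h1 (not_lt.2 (hE _ (Γ.mul_mem (Γ.inv_mem hγ) hβ)))

/-! ### Change of variables on the boundary -/

theorem lintegral_image_bact (γ : SL2R) {A : Set ℝ} (hA : MeasurableSet A)
    (hA' : A ⊆ finiteSet γ) (g : ℝ → ENNReal) :
    ∫⁻ x in bact γ '' A, g x = ∫⁻ x in A, ENNReal.ofReal (1 / bden γ x ^ 2) * g (bact γ x) := by
  rw [lintegral_image_eq_lintegral_abs_deriv_mul hA
    (fun x hx => (hasDerivAt_bact γ (hA' hx)).hasDerivWithinAt) ((injOn_bact γ).mono hA')]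
  refine lintegral_congr fun x => ?_
  rw [abs_of_nonneg (by positivity)]

/-! ### A lower bound for the harmonic measure of the discontinuity set. -/

/-- Harmonic measure of the discontinuity set (up to the factor `π`). -/
def harmonicOmega (Γ : Subgroup SL2R) (z : ℍ) : ENNReal :=
  ∫⁻ ζ in omegaReal Γ, ENNReal.ofReal (poissonKernel z ζ)

/-- `P(γz, γx)` times the Jacobian of `γ` is `P(z, x)`, and `Ω(Γ)` is invariant. One inequality
suffices to carry a lower bound from `γz` to `z`. -/
theorem harmonicOmega_smul_le {γ : SL2R} (hγ : γ ∈ Γ) (z : ℍ) :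
    harmonicOmega Γ (γ • z) ≤ harmonicOmega Γ z := by
  set S := omegaReal Γ ∩ finiteSet γ with hS
  have hSm : MeasurableSet S := (isOpen_omegaReal Γ).measurableSet.inter (measurableSet_finiteSet γ)
  have h1 : omegaReal Γ ≤ᵐ[volume] bact γ '' S := by
    filter_upwards [ae_bden_ne_zero γ⁻¹] with x hx hxΩ
    have h2 := bden_inv_ne_zero γ⁻¹ hx
    have h3 := bact_inv_bact γ⁻¹ hx
    rw [inv_inv] at h2 h3
    exact ⟨bact γ⁻¹ x, ⟨bact_mem_omegaReal (Γ.inv_mem hγ) hx hxΩ, h2⟩, h3⟩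
  calc harmonicOmega Γ (γ • z)
      ≤ ∫⁻ ζ in bact γ '' S, ENNReal.ofReal (poissonKernel (γ • z) ζ) := lintegral_mono_set' h1
    _ = ∫⁻ x in S, ENNReal.ofReal (poissonKernel z x) := by
      rw [lintegral_image_bact γ hSm Set.inter_subset_right]
      refine setLIntegral_congr_fun hSm fun x hx => ?_
      have hx' : bden γ x ≠ 0 := hx.2
      rw [← ENNReal.ofReal_mul (by positivity), poissonKernel_smul γ z hx']
      congr 1
      field_simp
    _ ≤ _ := lintegral_mono_set Set.inter_subset_left

theorem poissonKernel_eq (z : ℍ) (x : ℝ) :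
    poissonKernel z x = z.im / ((z.re - x) ^ 2 + z.im ^ 2) := by
  rw [poissonKernel, Complex.sq_norm, Complex.normSq_apply]
  congr 1
  simp
  ring

theorem le_harmonicOmega {a b m : ℝ} {z : ℍ} (hI : Set.Ioo a b ⊆ omegaReal Γ)
    (hm : ∀ x ∈ Set.Ioo a b, m ≤ poissonKernel z x) (hm0 : 0 ≤ m) :
    ENNReal.ofReal (m * (b - a)) ≤ harmonicOmega Γ z := by
  calc ENNReal.ofReal (m * (b - a)) = ∫⁻ _ in Set.Ioo a b, ENNReal.ofReal m := by
        rw [setLIntegral_const, Real.volume_Ioo, ENNReal.ofReal_mul hm0]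
    _ ≤ ∫⁻ x in Set.Ioo a b, ENNReal.ofReal (poissonKernel z x) :=
        setLIntegral_mono' measurableSet_Ioo fun x hx => ENNReal.ofReal_le_ofReal (hm x hx)
    _ ≤ _ := lintegral_mono_set hI

theorem le_poissonKernel_of_abs_le {z : ℍ} {x M : ℝ} (h : |z.re - x| ≤ M) :
    z.im / (M ^ 2 + z.im ^ 2) ≤ poissonKernel z x := by
  have := z.im_pos
  rw [poissonKernel_eq]
  have h2 : (z.re - x) ^ 2 ≤ M ^ 2 := sq_le_sq' (by linarith [(abs_le.1 h).1]) (abs_le.1 h).2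
  gcongr

/-- On a window of width `Im z` next to `Re z` the kernel is at least `1/(2 Im z)`, giving mass
`1/2`; the weaker `1/5` is shared with the windows used near infinity. -/
theorem le_harmonicOmega_vertical {z : ℍ} (h : Set.Ioo z.re (z.re + z.im) ⊆ omegaReal Γ) :
    ENNReal.ofReal (1 / 5) ≤ harmonicOmega Γ z := by
  have hy := z.im_pos
  refine le_trans (ENNReal.ofReal_le_ofReal ?_) (le_harmonicOmega (m := z.im / (z.im ^ 2 + z.im ^ 2))
    h (fun x hx => le_poissonKernel_of_abs_le ?_) (by positivity))
  · rw [show z.im / (z.im ^ 2 + z.im ^ 2) * (z.re + z.im - z.re) = 1 / 2 by field_simp; ring]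
    norm_num
  · rw [abs_le]; constructor <;> linarith [hx.1, hx.2]

theorem exists_radius_of_infty_mem (h : OnePoint.infty ∈ discontinuitySet Γ) :
    ∃ R > 0, ∀ x : ℝ, R < |x| → x ∈ omegaReal Γ := by
  have h1 : (OnePoint.infty : OnePoint ℂ) ∉ closure
      {q : OnePoint ℂ | ∃ γ ∈ Γ, q = (((γ • UpperHalfPlane.I : ℍ) : ℂ) : OnePoint ℂ)} := h
  rw [mem_closure_iff_nhds] at h1
  push Not at h1
  obtain ⟨U, hU, hd⟩ := h1
  have h2 : ((↑) : ℂ → OnePoint ℂ) ⁻¹' U ∈ cocompact ℂ := by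
    rw [← coclosedCompact_eq_cocompact, ← OnePoint.comap_coe_nhds_infty]
    exact preimage_mem_comap hU
  obtain ⟨R, hR⟩ := Metric.closedBall_compl_subset_of_mem_cocompact h2 0
  have h3 : ∀ γ ∈ Γ, ‖((γ • UpperHalfPlane.I : ℍ) : ℂ)‖ ≤ R := fun γ hγ => by
    by_contra hlt
    have : ((γ • UpperHalfPlane.I : ℍ) : ℂ) ∈ ((↑) : ℂ → OnePoint ℂ) ⁻¹' U :=
      hR (by simpa using hlt)
    exact (Set.eq_empty_iff_forall_notMem.1 hd) _ ⟨this, γ, hγ, rfl⟩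
  refine ⟨|R| + 1, by positivity, fun x hx => coe_mem_discontinuitySet_iff.2 ⟨1, one_pos,
    fun γ hγ => ?_⟩⟩
  have h4 := norm_sub_norm_le (x : ℂ) ((γ • UpperHalfPlane.I : ℍ) : ℂ)
  rw [norm_sub_rev, Complex.norm_real, Real.norm_eq_abs] at h4
  linarith [h3 γ hγ, le_abs_self R]

theorem omegaReal_nonempty (h : (discontinuitySet Γ).Nonempty) : (omegaReal Γ).Nonempty := by
  obtain ⟨p, hp⟩ := h
  induction p using OnePoint.rec with
  | infty =>
    obtain ⟨R, hR, hx⟩ := exists_radius_of_infty_mem hp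
    exact ⟨R + 1, hx _ (by rw [abs_of_pos (by linarith)]; linarith)⟩
  | coe x => exact ⟨x, hp⟩

theorem sphereAct_coe (γ : SL2R) (z : ℍ) :
    sphereAct γ ((z : ℂ) : OnePoint ℂ) = (((γ • z : ℍ) : ℂ) : OnePoint ℂ) := by
  have h := autFactor_ne_zero γ z
  rw [autFactor] at h
  rw [coe_smul_eq, sphereAct, OnePoint.smul_some_eq_ite, if_neg (by simpa using h), autFactor]
  simp

/-- Near each point of the extended plane, the harmonic measure is bounded below. -/
theorem exists_nhds_harmonicOmega_ge (hne : (discontinuitySet Γ).Nonempty) {q : OnePoint ℂ}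
    (hq : q ∈ extendedPlane Γ) : ∃ V ∈ 𝓝 q, ∃ c : ℝ, 0 < c ∧
      ∀ z : ℍ, ((z : ℂ) : OnePoint ℂ) ∈ V → ENNReal.ofReal c ≤ harmonicOmega Γ z := by
  have coe_nhds : ∀ (w : ℂ) (r : ℝ), 0 < r →
      ((↑) : ℂ → OnePoint ℂ) '' Metric.ball w r ∈ 𝓝 (w : OnePoint ℂ) := fun w r hr =>
    OnePoint.isOpenEmbedding_coe.image_mem_nhds.2 (Metric.ball_mem_nhds w hr)
  have mem_coe : ∀ (w u : ℂ) (r : ℝ), (u : OnePoint ℂ) ∈ ((↑) : ℂ → OnePoint ℂ) '' Metric.ball w r →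
      ‖u - w‖ < r := fun w u r h => by
    obtain ⟨u', hu', e⟩ := h
    rw [← OnePoint.coe_injective e, ← Complex.dist_eq]
    exact hu'
  rcases hq with ⟨z0, rfl⟩ | ⟨p, hp, rfl⟩
  · obtain ⟨ζ0, hζ0⟩ := omegaReal_nonempty hne
    obtain ⟨r, hr, hball⟩ := Metric.isOpen_iff.1 (isOpen_omegaReal Γ) ζ0 hζ0
    rw [Real.ball_eq_Ioo] at hball
    have hy0 := z0.im_pos
    set M := |z0.re - ζ0| + z0.im + r with hM
    refine ⟨_, coe_nhds z0 (z0.im / 2) (by positivity), z0.im / 2 / (M ^ 2 + (2 * z0.im) ^ 2) *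
      (ζ0 + r - (ζ0 - r)), ?_, fun z hz => ?_⟩
    · have : 0 < ζ0 + r - (ζ0 - r) := by linarith
      positivity
    · have hz' := mem_coe _ _ _ hz
      have h1 := (Complex.abs_re_le_norm _).trans_lt hz'
      have h2 := (Complex.abs_im_le_norm _).trans_lt hz'
      simp only [Complex.sub_re, Complex.sub_im, UpperHalfPlane.coe_re, UpperHalfPlane.coe_im] at h1 h2
      have hy := z.im_pos
      rw [abs_lt] at h1 h2
      refine le_harmonicOmega hball (fun x hx => ?_) (by positivity)
      refine le_trans ?_ (le_poissonKernel_of_abs_le (M := M) ?_)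
      · gcongr <;> linarith
      · have e1 := le_abs_self (z0.re - ζ0)
        have e2 := neg_abs_le (z0.re - ζ0)
        rw [abs_le]
        constructor <;> linarith [hx.1, hx.2]
  · induction p using OnePoint.rec with
    | infty =>
      obtain ⟨R, hR, hx⟩ := exists_radius_of_infty_mem hp
      have hV : (((↑) : ℂ → OnePoint ℂ) '' Metric.closedBall 0 (2 * R))ᶜ ∈
          𝓝 (bdryToSphere OnePoint.infty) := by
        refine IsOpen.mem_nhds (OnePoint.isOpen_compl_image_coe.2
          ⟨Metric.isClosed_closedBall, isCompact_closedBall _ _⟩) ?_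
        rintro ⟨u, -, hu⟩
        exact OnePoint.coe_ne_infty u hu
      refine ⟨_, hV, 1 / 5, by norm_num, fun z hz => ?_⟩
      have hz' : 2 * R < ‖(z : ℂ)‖ := by
        by_contra hle
        exact hz ⟨z, by simpa using hle, rfl⟩
      have hy := z.im_pos
      have hsq : (2 * R) ^ 2 < z.re ^ 2 + z.im ^ 2 := by
        have := pow_lt_pow_left₀ hz' (by positivity) two_ne_zero
        rw [Complex.sq_norm, Complex.normSq_apply] at this
        simp only [UpperHalfPlane.coe_re, UpperHalfPlane.coe_im] at this
        linarith
      -- Near infinity a window of width `Im z` is chosen on the side of `Re z` away from `0`. It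
      -- starts at distance `R` from `Re z` when `Im z ≥ R`; otherwise `|Re z| > R` and it starts at
      -- `Re z`. Within distance `2 Im z` the kernel is at least `1/(5 Im z)`.
      rcases le_or_gt R z.im with hRy | hRy
      · have hP : ∀ x, |z.re - x| ≤ 2 * z.im →
            z.im / ((2 * z.im) ^ 2 + z.im ^ 2) ≤ poissonKernel z x :=
          fun x hx => le_poissonKernel_of_abs_le hx
        have hval : z.im / ((2 * z.im) ^ 2 + z.im ^ 2) * z.im = 1 / 5 := by field_simp; ring
        rcases le_or_gt 0 z.re with h0 | h0
        · have := le_harmonicOmega (Γ := Γ) (z := z) (a := z.re + R) (b := z.re + R + z.im)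
            (fun x hx' => hx x (by rw [abs_of_pos] <;> linarith [hx'.1]))
            (fun x hx' => hP x (by rw [abs_le]; constructor <;> linarith [hx'.1, hx'.2]))
            (by positivity)
          rwa [add_sub_cancel_left, hval] at this
        · have := le_harmonicOmega (Γ := Γ) (z := z) (a := z.re - R - z.im) (b := z.re - R)
            (fun x hx' => hx x (by rw [abs_of_neg] <;> linarith [hx'.2]))
            (fun x hx' => hP x (by rw [abs_le]; constructor <;> linarith [hx'.1, hx'.2]))
            (by positivity)
          rwa [sub_sub_cancel, hval] at this
      · have hre : R ^ 2 < z.re ^ 2 := by nlinarith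
        rcases le_or_gt 0 z.re with h0 | h0
        · have hR' : R < z.re := lt_of_pow_lt_pow_left₀ 2 h0 hre
          exact le_harmonicOmega_vertical fun x hx' =>
            hx x (by rw [abs_of_pos] <;> linarith [hx'.1])
        · have hR' : R < -z.re := lt_of_pow_lt_pow_left₀ 2 (by linarith) (by rwa [neg_sq])
          have := le_harmonicOmega (Γ := Γ) (z := z) (a := z.re - z.im) (b := z.re)
            (fun x hx' => hx x (by rw [abs_of_neg] <;> linarith [hx'.2]))
            (fun x hx' => le_poissonKernel_of_abs_le (M := 2 * z.im)
              (by rw [abs_le]; constructor <;> linarith [hx'.1, hx'.2])) (by positivity)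
          rw [sub_sub_cancel] at this
          have hval : z.im / ((2 * z.im) ^ 2 + z.im ^ 2) * z.im = 1 / 5 := by field_simp; ring
          rwa [hval] at this
    | coe ω =>
      obtain ⟨r, hr, hball⟩ := Metric.isOpen_iff.1 (isOpen_omegaReal Γ) ω hp
      rw [Real.ball_eq_Ioo] at hball
      refine ⟨_, coe_nhds (ω : ℂ) (r / 2) (by positivity), 1 / 5, by norm_num, fun z hz => ?_⟩
      have hz' := mem_coe _ _ _ hz
      have h1 := (Complex.abs_re_le_norm _).trans_lt hz'
      have h2 := (Complex.abs_im_le_norm _).trans_lt hz'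
      simp only [Complex.sub_re, Complex.sub_im, UpperHalfPlane.coe_re, UpperHalfPlane.coe_im,
        Complex.ofReal_re, Complex.ofReal_im, sub_zero] at h1 h2
      rw [abs_lt] at h1 h2
      refine le_harmonicOmega_vertical fun x hx => hball ?_
      constructor <;> linarith [hx.1, hx.2]

/-- A finite cover of the compact set `K` makes the local bounds uniform, and every `z` can be moved
into `K`. Since `K` may reach `Ω(Γ)`, the local bounds at boundary points are indispensable. -/
theorem exists_le_harmonicOmega (hΓ : IsConvexCocompact Γ) :
    ∃ c : ℝ, 0 < c ∧ ∀ z : ℍ, ENNReal.ofReal c ≤ harmonicOmega Γ z := by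
  obtain ⟨K, hK, hKs, hKc⟩ := hΓ.cocompact
  obtain ⟨c, hc, h⟩ := hK.induction_on (p := fun S => ∃ c : ℝ, 0 < c ∧
      ∀ z : ℍ, ((z : ℂ) : OnePoint ℂ) ∈ S → ENNReal.ofReal c ≤ harmonicOmega Γ z)
    ⟨1, one_pos, fun z hz => hz.elim⟩
    (fun S T hST ⟨c, hc, h⟩ => ⟨c, hc, fun z hz => h z (hST hz)⟩)
    (fun S T ⟨c, hc, h⟩ ⟨d, hd, h'⟩ => ⟨min c d, lt_min hc hd, fun z hz => hz.elim
      (fun hz => (ENNReal.ofReal_le_ofReal (min_le_left _ _)).trans (h z hz))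
      (fun hz => (ENNReal.ofReal_le_ofReal (min_le_right _ _)).trans (h' z hz))⟩)
    (fun q hq => by
      obtain ⟨V, hV, h⟩ := exists_nhds_harmonicOmega_ge hΓ.nonempty (hKs hq)
      exact ⟨V, mem_nhdsWithin_of_mem_nhds hV, h⟩)
  refine ⟨c, hc, fun z => ?_⟩
  obtain ⟨γ, hγ, hz⟩ := hKc _ (Or.inl ⟨z, rfl⟩)
  rw [sphereAct_coe] at hz
  exact (h _ hz).trans (harmonicOmega_smul_le hγ z)

/-! ### The limit set is a null set -/

theorem poissonKernel_angleToBdry (z : ℍ) {φ : ℝ} (hφ : φ ∈ Set.Ioo (-(Real.pi / 2)) (Real.pi / 2)) :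
    poissonKernel z (angleToBdry z φ) = Real.cos φ ^ 2 / z.im := by
  have hc := Real.cos_pos_of_mem_Ioo hφ
  have hy := z.im_pos
  rw [poissonKernel_eq, angleToBdry, Real.tan_eq_sin_div_cos]
  have h := Real.sin_sq_add_cos_sq φ
  have : (z.re - (z.re + z.im * (Real.sin φ / Real.cos φ))) ^ 2 + z.im ^ 2 =
      z.im ^ 2 * (Real.sin φ ^ 2 + Real.cos φ ^ 2) / Real.cos φ ^ 2 := by field_simp; ring
  rw [this, h]
  field_simp

/-- In the angle at `z` the measure `P dζ` is Lebesgue measure `dφ`. -/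
theorem lintegral_poissonKernel_tail (z : ℍ) {α : ℝ} (hα : 0 < α) (hα' : α < Real.pi / 2) :
    ∫⁻ x in (Metric.closedBall z.re (z.im * Real.tan α))ᶜ, ENNReal.ofReal (poissonKernel z x) ≤
      ENNReal.ofReal (2 * (Real.pi / 2 - α)) := by
  set I := Set.Ioo (-(Real.pi / 2)) (Real.pi / 2) with hI
  set A := I \ Set.Icc (-α) α with hA
  have hAm : MeasurableSet A := measurableSet_Ioo.diff measurableSet_Icc
  have hsub : (Metric.closedBall z.re (z.im * Real.tan α))ᶜ ⊆ angleToBdry z '' A := by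
    intro x hx
    obtain ⟨φ, hφ, rfl⟩ : x ∈ angleToBdry z '' I := by rw [angleToBdry_image]; trivial
    refine ⟨φ, ⟨hφ, fun hle => hx ?_⟩, rfl⟩
    have hy := z.im_pos
    have hαI : α ∈ I := ⟨by linarith, hα'⟩
    have hnαI : -α ∈ I := ⟨by linarith, by linarith⟩
    have t1 := Real.strictMonoOn_tan.monotoneOn hφ hαI hle.2
    have t2 := Real.strictMonoOn_tan.monotoneOn hnαI hφ hle.1
    rw [Real.tan_neg] at t2
    rw [Metric.mem_closedBall, Real.dist_eq, angleToBdry, add_sub_cancel_left, abs_mul,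
      abs_of_pos hy]
    gcongr
    exact abs_le.2 ⟨t2, t1⟩
  calc _ ≤ ∫⁻ x in angleToBdry z '' A, ENNReal.ofReal (poissonKernel z x) := lintegral_mono_set hsub
    _ = ∫⁻ _ in A, 1 := by
      rw [lintegral_image_eq_lintegral_abs_deriv_mul hAm
        (fun φ hφ => (hasDerivAt_angleToBdry z hφ.1).hasDerivWithinAt)
        ((angleToBdry_injOn z).mono Set.sdiff_subset)]
      refine setLIntegral_congr_fun hAm fun φ hφ => ?_
      have hc := Real.cos_pos_of_mem_Ioo hφ.1
      have hy := z.im_pos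
      rw [poissonKernel_angleToBdry z hφ.1, ← ENNReal.ofReal_mul (abs_nonneg _),
        abs_of_pos (by positivity)]
      rw [show z.im / Real.cos φ ^ 2 * (Real.cos φ ^ 2 / z.im) = 1 by field_simp]
      simp
    _ = volume A := by simp
    _ ≤ volume (Set.Ioo (-(Real.pi / 2)) (-α) ∪ Set.Ioo α (Real.pi / 2)) := by
      refine measure_mono fun φ hφ => ?_
      by_cases h : φ < -α
      · exact Or.inl ⟨hφ.1.1, h⟩
      · exact Or.inr ⟨not_le.1 fun h' => hφ.2 ⟨not_lt.1 h, h'⟩, hφ.1.2⟩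
    _ ≤ _ := measure_union_le _ _
    _ = _ := by
      rw [Real.volume_Ioo, Real.volume_Ioo, ← ENNReal.ofReal_add (by linarith) (by linarith)]
      congr 1; ring

/-- At almost every limit point `x` the set `Ω(Γ)` has density zero. Seen from height `r / tan α`
above `x`, its part in the ball of radius `r` is then negligible and everything outside subtends a
small angle, against the uniform lower bound `c`. -/
theorem volume_compl_omegaReal (hΓ : IsConvexCocompact Γ) : volume (omegaReal Γ)ᶜ = 0 := by
  obtain ⟨c, hc, hle⟩ := exists_le_harmonicOmega hΓ
  have hm := (isOpen_omegaReal Γ).measurableSet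
  have hae := Besicovitch.ae_tendsto_measure_inter_div_of_measurableSet (volume : Measure ℝ) hm
  rw [measure_eq_zero_iff_ae_notMem]
  filter_upwards [hae] with x hx hxΛ
  rw [Set.indicator_of_notMem hxΛ] at hx
  -- The exterior contributes at most `2η ≤ c/2`, and the density threshold `c/(8 tan α)` makes the
  -- ball contribute at most `c/4`, so the total is below `c`. The bound `π/4` keeps `α` positive.
  set η := min (c / 4) (Real.pi / 4) with hη
  have hη0 : 0 < η := lt_min (by positivity) (by positivity)
  have hη1 : η ≤ c / 4 := min_le_left _ _
  have hη2 : η ≤ Real.pi / 4 := min_le_right _ _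
  have hpi := Real.pi_pos
  set α := Real.pi / 2 - η with hα
  have hα0 : 0 < α := by linarith
  have hα1 : α < Real.pi / 2 := by linarith
  have htan : 0 < Real.tan α := Real.tan_pos_of_pos_of_lt_pi_div_two hα0 hα1
  have hκ : 0 < ENNReal.ofReal (c / (8 * Real.tan α)) := ENNReal.ofReal_pos.2 (by positivity)
  have hev := hx.eventually (gt_mem_nhds hκ)
  obtain ⟨r, hr, hr0⟩ := (hev.and self_mem_nhdsWithin).exists
  have hr0 : 0 < r := hr0
  set t := r / Real.tan α with ht
  have ht0 : 0 < t := by positivity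
  set z : ℍ := ⟨⟨x, t⟩, ht0⟩ with hz
  have hre : z.re = x := rfl
  have him : z.im = t := rfl
  have htr : z.im * Real.tan α = r := by rw [him, ht]; field_simp
  have hvol : volume (omegaReal Γ ∩ Metric.closedBall x r) ≤
      ENNReal.ofReal (c / (8 * Real.tan α) * (2 * r)) := by
    have hb : volume (Metric.closedBall x r) = ENNReal.ofReal (2 * r) := Real.volume_closedBall x r
    have h2 : ENNReal.ofReal (2 * r) ≠ 0 := (ENNReal.ofReal_pos.2 (by positivity)).ne'
    have := (ENNReal.div_le_iff h2 ENNReal.ofReal_ne_top).1 (hb ▸ hr.le)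
    rwa [← ENNReal.ofReal_mul (by positivity)] at this
  have hup : harmonicOmega Γ z ≤ ENNReal.ofReal (c / 4) + ENNReal.ofReal (2 * η) := by
    calc harmonicOmega Γ z
        ≤ ∫⁻ y in (omegaReal Γ ∩ Metric.closedBall x r) ∪ (Metric.closedBall x r)ᶜ,
            ENNReal.ofReal (poissonKernel z y) := by
          refine lintegral_mono_set fun y hy => ?_
          by_cases h : y ∈ Metric.closedBall x r
          · exact Or.inl ⟨hy, h⟩
          · exact Or.inr h
      _ ≤ _ := lintegral_union_le _ _ _
      _ ≤ _ := by
        gcongr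
        · calc ∫⁻ y in omegaReal Γ ∩ Metric.closedBall x r, ENNReal.ofReal (poissonKernel z y)
              ≤ ∫⁻ _ in omegaReal Γ ∩ Metric.closedBall x r, ENNReal.ofReal (1 / t) := by
                refine lintegral_mono fun y => ENNReal.ofReal_le_ofReal ?_
                rw [poissonKernel_eq, him, div_le_div_iff₀ (by positivity) ht0]
                nlinarith [sq_nonneg (z.re - y)]
            _ = ENNReal.ofReal (1 / t) * volume (omegaReal Γ ∩ Metric.closedBall x r) :=
                setLIntegral_const _ _
            _ ≤ ENNReal.ofReal (1 / t) * ENNReal.ofReal (c / (8 * Real.tan α) * (2 * r)) := by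
                gcongr
            _ = ENNReal.ofReal (c / 4) := by
                rw [← ENNReal.ofReal_mul (by positivity)]
                congr 1
                rw [ht]; field_simp; norm_num
        · have := lintegral_poissonKernel_tail z hα0 hα1
          rw [htr, hre] at this
          refine this.trans (ENNReal.ofReal_le_ofReal ?_)
          rw [hα]; linarith
  have := (hle z).trans hup
  rw [← ENNReal.ofReal_add (by positivity) (by positivity)] at this
  rw [ENNReal.ofReal_le_ofReal_iff (by positivity)] at this
  linarith

/-! ### Fundamental domains -/

theorem finite_quadratic_zeros {A B : ℝ} (C : ℝ) (h : ¬(A = 0 ∧ B = 0)) :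
    {x : ℝ | A * x ^ 2 + B * x + C = 0}.Finite := by
  set p : Polynomial ℝ := Polynomial.C A * Polynomial.X ^ 2 + Polynomial.C B * Polynomial.X
    + Polynomial.C C with hp
  have hp0 : p ≠ 0 := fun h0 => h ⟨by
    have := congrArg (fun q => Polynomial.coeff q 2) h0
    simpa [hp, Polynomial.coeff_X, Polynomial.coeff_C] using this, by
    have := congrArg (fun q => Polynomial.coeff q 1) h0
    simpa [hp, Polynomial.coeff_X, Polynomial.coeff_C] using this⟩
  refine (Polynomial.finite_setOfPred_isRoot hp0).subset fun x hx => ?_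
  simpa [Polynomial.IsRoot.def, hp] using hx

/-- Equality is a polynomial equation of degree at most two in `x`, whose coefficients in degrees
two and one both vanish only if `z = w`. -/
theorem finite_poissonKernel_eq {z w : ℍ} (h : z ≠ w) :
    {x : ℝ | poissonKernel z x = poissonKernel w x}.Finite := by
  have hz := z.im_pos
  have hw := w.im_pos
  refine (finite_quadratic_zeros (A := z.im - w.im) (B := -2 * (z.im * w.re - w.im * z.re))
    (z.im * (w.re ^ 2 + w.im ^ 2) - w.im * (z.re ^ 2 + z.im ^ 2)) ?_).subset fun x hx => ?_
  · rintro ⟨c2, c1⟩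
    have e : z.im = w.im := by linarith
    refine h (UpperHalfPlane.ext (Complex.ext ?_ e))
    rw [← e] at c1
    have : z.im * (w.re - z.re) = 0 := by linarith
    have := (mul_eq_zero.1 this).resolve_left hz.ne'
    simp only [UpperHalfPlane.coe_re]; linarith
  · have hx' : poissonKernel z x = poissonKernel w x := hx
    rw [poissonKernel_eq, poissonKernel_eq, div_eq_div_iff (by positivity) (by positivity)] at hx'
    simp only [Set.mem_ofPred_eq]
    linear_combination hx'

theorem continuous_poissonKernel (z : ℍ) : Continuous (poissonKernel z) := by
  have hz := z.im_pos
  simp only [funext (poissonKernel_eq z)]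
  exact continuous_const.div (by fun_prop) fun x => by positivity

/-- The Dirichlet fundamental domain centred at `i`. -/
def dirichletDomain (Γ : Subgroup SL2R) : Set ℝ :=
  omegaReal Γ ∩ {ζ | ∀ γ : Γ, poissonKernel ((γ : SL2R) • UpperHalfPlane.I) ζ ≤
    poissonKernel UpperHalfPlane.I ζ}

theorem ae_forall_bden_ne_zero [Countable Γ] : ∀ᵐ x : ℝ, ∀ γ : Γ, bden (γ : SL2R) x ≠ 0 :=
  ae_all_iff.2 fun γ => ae_bden_ne_zero γ

theorem dirichletDomain_isBdryFundamentalDomain (hΓ : IsConvexCocompact Γ)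
    (hδ : criticalExponent Γ < ((1 / 2 : ℝ) : EReal)) :
    IsBdryFundamentalDomain Γ (dirichletDomain Γ) where
  measurable := by
    refine (isOpen_omegaReal Γ).measurableSet.inter (IsClosed.measurableSet ?_)
    have : {ζ : ℝ | ∀ γ : Γ, poissonKernel ((γ : SL2R) • UpperHalfPlane.I) ζ ≤
        poissonKernel UpperHalfPlane.I ζ} = ⋂ γ : Γ, {ζ : ℝ |
        poissonKernel ((γ : SL2R) • UpperHalfPlane.I) ζ ≤ poissonKernel UpperHalfPlane.I ζ} := by
      ext; simp
    rw [this]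
    exact isClosed_iInter fun γ => isClosed_le (continuous_poissonKernel _) (continuous_poissonKernel _)
  subset ζ hζ := hζ.1
  covers := by
    have := countable_of_criticalExponent_lt hδ
    filter_upwards [ae_forall_bden_ne_zero (Γ := Γ)] with ζ hζ hΩ
    -- The exponent `1/2` exceeds `δ`, so the kernels `P(γi, ζ)` tend to `0` along `Γ` and a
    -- maximiser `γ0` exists; `γ0⁻¹` moves `ζ` into the domain.
    have hsum := (summable_poissonKernel_rpow (by norm_num) hδ UpperHalfPlane.I
      (ζ := ζ) hΩ).tendsto_cofinite_zero
    set f : Γ → ℝ := fun γ => poissonKernel ((γ : SL2R) • UpperHalfPlane.I) ζ with hf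
    have hfin : {γ : Γ | f 1 ≤ f γ}.Finite := by
      have hpos : 0 < f 1 ^ (1 / 2 : ℝ) := Real.rpow_pos_of_pos (poissonKernel_pos _ _) _
      have := hsum.eventually (gt_mem_nhds hpos)
      refine (eventually_cofinite.1 this).subset fun γ hγ => ?_
      have h2 : f 1 ≤ f γ := hγ
      simp only [Set.mem_ofPred_eq, not_lt]
      exact Real.rpow_le_rpow (poissonKernel_pos _ _).le h2 (by norm_num)
    obtain ⟨γ0, hγ0, hmax⟩ := Set.exists_max_image _ f hfin ⟨1, le_refl (f 1)⟩
    have hmax' : ∀ γ, f γ ≤ f γ0 := fun γ => by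
      rcases le_or_gt (f 1) (f γ) with h | h
      · exact hmax γ h
      · exact h.le.trans hγ0
    have hb : bden (γ0 : SL2R)⁻¹ ζ ≠ 0 := hζ γ0⁻¹
    refine ⟨(γ0 : SL2R)⁻¹, Γ.inv_mem γ0.2, bact (γ0 : SL2R)⁻¹ ζ,
      ⟨bact_mem_omegaReal (Γ.inv_mem γ0.2) hb hΩ, fun γ => ?_⟩, bdryAct_coe_eq_coe.2 ⟨hb, rfl⟩⟩
    have e1 := poissonKernel_smul (γ0 : SL2R)⁻¹ ((γ0 : SL2R) • (γ : SL2R) • UpperHalfPlane.I) hb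
    have e2 := poissonKernel_smul (γ0 : SL2R)⁻¹ ((γ0 : SL2R) • UpperHalfPlane.I) hb
    rw [inv_smul_smul] at e1 e2
    rw [e1, e2]
    refine mul_le_mul_of_nonneg_right ?_ (sq_nonneg _)
    have := hmax' (γ0 * γ)
    simpa only [hf, Subgroup.coe_mul, mul_smul] using this
  disjoint γ hγ hne := by
    -- If `ζ` and `γζ` both lie in the domain, the two Dirichlet inequalities force `P(i, ζ) =
    -- P(γ⁻¹i, ζ)`; by freeness this holds for finitely many `ζ` only.
    have hI : UpperHalfPlane.I ≠ γ⁻¹ • UpperHalfPlane.I := fun h => by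
      have := hΓ.free γ⁻¹ (Γ.inv_mem hγ) (inv_ne_one.2 hne) _ (Or.inl ⟨UpperHalfPlane.I, rfl⟩)
      rw [sphereAct_coe, ← h] at this
      exact this rfl
    refine measure_mono_null ?_ ((finite_poissonKernel_eq hI).measure_zero volume)
    rintro ζ ⟨hζ, η, hη, hact⟩
    obtain ⟨hb, rfl⟩ := bdryAct_coe_eq_coe.1 hact
    have h1 := hζ.2 ⟨γ⁻¹, Γ.inv_mem hγ⟩
    have h2 := hη.2 ⟨γ, hγ⟩
    have e1 := poissonKernel_smul γ UpperHalfPlane.I hb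
    have e2 := poissonKernel_smul γ (γ⁻¹ • UpperHalfPlane.I) hb
    rw [smul_inv_smul] at e2
    rw [e1, e2] at h2
    exact le_antisymm (le_of_mul_le_mul_right h2 (by positivity)) h1

/-! ### Unfolding -/

section Unfold

variable {D : Set ℝ} {E : Type*} [NormedAddCommGroup E] [NormedSpace ℝ E]

/-- A common point of two translates comes from a point of `D` that `γ'⁻¹γ` moves into `D`. Such
points form a null set, and differentiable maps preserve null sets. -/
theorem IsBdryFundamentalDomain.aedisjoint (hD : IsBdryFundamentalDomain Γ D) {γ γ' : Γ}
    (h : γ ≠ γ') : AEDisjoint volume (bact (γ : SL2R) '' (D ∩ finiteSet γ))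
      (bact (γ' : SL2R) '' (D ∩ finiteSet γ')) := by
  set N : Set ℝ := {ζ : ℝ | ζ ∈ D ∧ ∃ η ∈ D,
    bdryAct ((γ' : SL2R)⁻¹ * γ) (ζ : OnePoint ℝ) = (η : OnePoint ℝ)} with hN
  have hN0 : volume N = 0 := hD.disjoint _ (Γ.mul_mem (Γ.inv_mem γ'.2) γ.2) fun e => h (by
    rw [inv_mul_eq_one] at e
    exact Subtype.ext e.symm)
  have himg : volume (bact (γ : SL2R) '' (N ∩ finiteSet γ)) = 0 :=
    addHaar_image_eq_zero_of_differentiableOn_of_addHaar_eq_zero volume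
      (fun x hx => (hasDerivAt_bact (γ : SL2R) hx.2).differentiableAt.differentiableWithinAt)
      (measure_mono_null Set.inter_subset_left hN0)
  refine measure_mono_null ?_ himg
  rintro _ ⟨⟨ζ, ⟨hζ, hf⟩, rfl⟩, ⟨η, ⟨hη, hf'⟩, e⟩⟩
  have hf : bden (γ : SL2R) ζ ≠ 0 := hf
  have hf' : bden (γ' : SL2R) η ≠ 0 := hf'
  have h1 := bden_inv_ne_zero (γ' : SL2R) hf'
  have h2 := bact_inv_bact (γ' : SL2R) hf'
  rw [e] at h1 h2
  refine ⟨ζ, ⟨⟨hζ, η, hη, bdryAct_coe_eq_coe.2 ⟨?_, ?_⟩⟩, hf⟩, rfl⟩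
  · rw [bden_mul _ _ hf]; exact mul_ne_zero h1 hf
  · rw [bact_mul _ _ hf h1, h2]

theorem IsBdryFundamentalDomain.iUnion_ae_eq (hD : IsBdryFundamentalDomain Γ D)
    (hΓ : IsConvexCocompact Γ) :
    (⋃ γ : Γ, bact (γ : SL2R) '' (D ∩ finiteSet γ)) =ᵐ[volume] Set.univ := by
  rw [ae_eq_univ]
  refine measure_mono_null ?_ (measure_union_null (volume_compl_omegaReal hΓ)
    (ae_iff.1 hD.covers))
  intro x hx
  by_contra hcon
  simp only [Set.mem_union, Set.mem_compl_iff, not_or, not_not, Set.mem_ofPred_eq] at hcon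
  obtain ⟨γ, hγ, η, hη, hact⟩ := hcon.2 hcon.1
  obtain ⟨hb, rfl⟩ := bdryAct_coe_eq_coe.1 hact
  refine hx (Set.mem_iUnion.2 ⟨⟨γ⁻¹, Γ.inv_mem hγ⟩, bact γ x, ⟨hη, bden_inv_ne_zero γ hb⟩,
    bact_inv_bact γ hb⟩)

theorem inter_finiteSet_ae_eq (D : Set ℝ) (γ : SL2R) : (D ∩ finiteSet γ : Set ℝ) =ᵐ[volume] D := by
  filter_upwards [ae_bden_ne_zero γ] with x hx
  exact propext ⟨fun h => h.1, fun h => ⟨h, hx⟩⟩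

theorem IsBdryFundamentalDomain.integrableOn_unfold (hD : IsBdryFundamentalDomain Γ D) {g : ℝ → E}
    (hg : Integrable g) (γ : SL2R) :
    IntegrableOn (fun ζ => (1 / bden γ ζ ^ 2) • g (bact γ ζ)) D := by
  have hm : MeasurableSet (D ∩ finiteSet γ) := hD.measurable.inter (measurableSet_finiteSet γ)
  have h := (integrableOn_image_iff_integrableOn_abs_deriv_smul hm
    (fun x hx => (hasDerivAt_bact γ hx.2).hasDerivWithinAt)
    ((injOn_bact γ).mono Set.inter_subset_right) g).1 hg.integrableOn
  refine IntegrableOn.congr_set_ae ?_ (inter_finiteSet_ae_eq D γ).symm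
  refine h.congr_fun (fun x _ => ?_) hm
  simp only [abs_of_nonneg (show 0 ≤ 1 / bden γ x ^ 2 by positivity)]

theorem IsBdryFundamentalDomain.hasSum_unfold [Countable Γ] (hD : IsBdryFundamentalDomain Γ D)
    (hΓ : IsConvexCocompact Γ) {g : ℝ → E} (hg : Integrable g) :
    HasSum (fun γ : Γ => ∫ ζ in D, (1 / bden (γ : SL2R) ζ ^ 2) • g (bact (γ : SL2R) ζ))
      (∫ ζ, g ζ) := by
  have hm : ∀ γ : SL2R, MeasurableSet (D ∩ finiteSet γ) := fun γ =>
    hD.measurable.inter (measurableSet_finiteSet γ)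
  have h := hasSum_integral_iUnion_ae (μ := volume) (f := g)
    (s := fun γ : Γ => bact (γ : SL2R) '' (D ∩ finiteSet γ))
    (fun γ => ((hm γ).image_of_measurable_injOn (measurable_bact γ)
      ((injOn_bact (γ : SL2R)).mono Set.inter_subset_right)).nullMeasurableSet)
    (fun γ γ' hne => hD.aedisjoint hne) hg.integrableOn
  rw [setIntegral_congr_set (hD.iUnion_ae_eq hΓ), setIntegral_univ] at h
  refine h.congr_fun fun γ => ?_
  rw [integral_image_eq_integral_abs_deriv_smul (hm γ)
    (fun x hx => (hasDerivAt_bact (γ : SL2R) hx.2).hasDerivWithinAt)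
    ((injOn_bact (γ : SL2R)).mono Set.inter_subset_right) g,
    setIntegral_congr_set (inter_finiteSet_ae_eq D γ)]
  refine integral_congr_ae (Eventually.of_forall fun x => ?_)
  simp only [abs_of_nonneg (show 0 ≤ 1 / bden (γ : SL2R) x ^ 2 by positivity)]

end Unfold

/-! ### Domination of the Poisson integrals -/

theorem rpow_le_rpow_add_rpow {r a b c : ℝ} (hr : 0 < r) (hab : a ≤ b) (hbc : b ≤ c) :
    r ^ b ≤ r ^ a + r ^ c := by
  rcases le_total r 1 with h | h
  · have h1 := Real.rpow_le_rpow_of_exponent_ge hr h hab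
    have h2 := Real.rpow_nonneg hr.le c
    linarith
  · have h1 := Real.rpow_le_rpow_of_exponent_le h hbc
    have h2 := Real.rpow_nonneg hr.le a
    linarith

theorem norm_poissonPair (k : ℤ) (s : ℂ) (z w : ℍ) (ζ : ℝ) :
    ‖poissonPair k s z w ζ‖ =
      (poissonKernel z ζ / poissonKernel w ζ) ^ s.re * poissonKernel w ζ := by
  have hp := poissonKernel_pos z ζ
  have hq := poissonKernel_pos w ζ
  rw [poissonPair, norm_mul, norm_weightPoisson, norm_weightPoisson, Complex.sub_re, Complex.one_re,
    Real.rpow_sub hq, Real.rpow_one, Real.div_rpow hp.le hq.le]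
  ring

/-- The norm is `r^σ P(w, ζ)` with `r = P(z, ζ)/P(w, ζ)`, and `r^σ ≤ r^a + r^b` whether `r` is below
or above `1`. -/
theorem norm_poissonPair_le (k : ℤ) {s : ℂ} {a b : ℝ} (ha : a ≤ s.re) (hb : s.re ≤ b) (z w : ℍ)
    (ζ : ℝ) :
    ‖poissonPair k s z w ζ‖ ≤ ‖poissonPair 0 a z w ζ‖ + ‖poissonPair 0 b z w ζ‖ := by
  have hp := poissonKernel_pos z ζ
  have hq := poissonKernel_pos w ζ
  simp only [norm_poissonPair, Complex.ofReal_re, ← add_mul]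
  exact mul_le_mul_of_nonneg_right (rpow_le_rpow_add_rpow (div_pos hp hq) ha hb) hq.le

theorem poissonPair_zero_ofReal (σ : ℝ) (z w : ℍ) (ζ : ℝ) :
    poissonPair 0 σ z w ζ = (‖poissonPair 0 σ z w ζ‖ : ℂ) := by
  have hp := poissonKernel_pos z ζ
  have hq := poissonKernel_pos w ζ
  have e : poissonPair 0 σ z w ζ =
      ((poissonKernel z ζ ^ σ * poissonKernel w ζ ^ (1 - σ) : ℝ) : ℂ) := by
    rw [Complex.ofReal_mul, Complex.ofReal_cpow hp.le, Complex.ofReal_cpow hq.le]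
    simp [poissonPair, weightPoisson]
  have h0 : 0 ≤ poissonKernel z ζ ^ σ * poissonKernel w ζ ^ (1 - σ) := by positivity
  rw [e, Complex.norm_real, Real.norm_of_nonneg h0]

theorem integral_norm_poissonPair_zero (σ : ℝ) (z w : ℍ) :
    ∫ ζ, ‖poissonPair 0 σ z w ζ‖ = ‖∫ ζ, poissonPair 0 σ z w ζ‖ := by
  have e : ∫ ζ, poissonPair 0 σ z w ζ = ((∫ ζ, ‖poissonPair 0 σ z w ζ‖ : ℝ) : ℂ) := by
    rw [← integral_complex_ofReal]
    exact integral_congr_ae (Eventually.of_forall fun ζ => poissonPair_zero_ofReal σ z w ζ)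
  rw [e, Complex.norm_real, Real.norm_of_nonneg (integral_nonneg fun ζ => norm_nonneg _)]

theorem pos_of_criticalExponent_lt {σ : ℝ} (h : criticalExponent Γ < (σ : EReal)) : 0 < σ :=
  EReal.coe_pos.1 ((criticalExponent_nonneg Γ).trans_lt h)

theorem exists_criticalExponent_eq {σ : ℝ} (h : criticalExponent Γ < (σ : EReal)) :
    ∃ d : ℝ, criticalExponent Γ = d := by
  induction hc : criticalExponent Γ using EReal.rec with
  | bot => simpa [hc] using criticalExponent_nonneg Γ
  | top => simp [hc] at h
  | coe x => exact ⟨x, rfl⟩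

/-- In weight `0` with real exponent the integrand is positive, so the integral of its norm is the
modulus of the sum of two Green kernels, and the Green series supply the majorant. -/
theorem summable_integral_norm_poissonPair_zero {σ : ℝ} (h : criticalExponent Γ < (σ : EReal))
    (h' : criticalExponent Γ < ((1 - σ : ℝ) : EReal)) (hne : σ ≠ 1 / 2) {z z' : ℍ}
    (hz : ∀ γ ∈ Γ, z ≠ γ • z') :
    Summable fun β : Γ => ∫ ζ, ‖poissonPair 0 σ z ((β : SL2R) • z') ζ‖ := by
  have h0 := pos_of_criticalExponent_lt h
  have h1 := pos_of_criticalExponent_lt h'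
  have s1 := (summable_greenTerm (k := 0) (s := σ) (by simpa using h0) (by simpa using h) hz).norm
  have s2 := (summable_greenTerm (k := 0) (s := 1 - σ) (by simpa using h1) (by simpa using h')
    hz).norm
  refine Summable.of_nonneg_of_le (fun β => integral_nonneg fun ζ => norm_nonneg _) (fun β => ?_)
    (s1.add s2)
  rw [integral_norm_poissonPair_zero, integral_poissonPair_eq_greenKernel (Or.inl rfl)
    (by simpa using h0) (by simp; linarith)
    (fun e => hne (Complex.ofReal_injective (by rw [e]; norm_num))) (hz β β.2), norm_greenTerm,
    norm_greenTerm]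
  exact norm_add_le _ _

/-- The sum of two Poisson integrands of weight `0`, dominating all integrands whose exponents
lie between `a` and `b`. -/
def pairBound (a b : ℝ) (z w : ℍ) (ζ : ℝ) : ℝ :=
  ‖poissonPair 0 a z w ζ‖ + ‖poissonPair 0 b z w ζ‖

theorem integrable_pairBound (a b : ℝ) (z w : ℍ) : Integrable (pairBound a b z w) :=
  (integrable_poissonPair 0 a z w).norm.add (integrable_poissonPair 0 b z w).norm

/-- The exponents satisfy `δ < a < min(σ, 1/2)` and `max(σ, 1/2) < b < 1 - δ`: both avoid `1/2`,
where the kernel formula fails, even when `σ = 1/2`. -/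
theorem exists_summable_pairBound (hδ : criticalExponent Γ < ((1 / 2 : ℝ) : EReal)) {σ : ℝ}
    (h : criticalExponent Γ < (σ : EReal)) (h' : criticalExponent Γ < ((1 - σ : ℝ) : EReal))
    {z z' : ℍ} (hz : ∀ γ ∈ Γ, z ≠ γ • z') :
    ∃ a b : ℝ, a < σ ∧ σ < b ∧
      Summable fun β : Γ => ∫ ζ, pairBound a b z ((β : SL2R) • z') ζ := by
  obtain ⟨d, hd⟩ := exists_criticalExponent_eq h
  rw [hd, EReal.coe_lt_coe_iff] at hδ h h'
  obtain ⟨a, ha, ha'⟩ := exists_between (lt_min h hδ)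
  obtain ⟨b, hb, hb'⟩ := exists_between
    (max_lt (show σ < 1 - d by linarith) (show 1 / 2 < 1 - d by linarith))
  obtain ⟨ha1, ha2⟩ := lt_min_iff.1 ha'
  obtain ⟨hb1, hb2⟩ := max_lt_iff.1 hb
  refine ⟨a, b, ha1, hb1, ?_⟩
  have s1 := summable_integral_norm_poissonPair_zero (Γ := Γ) (σ := a)
    (by rw [hd, EReal.coe_lt_coe_iff]; linarith) (by rw [hd, EReal.coe_lt_coe_iff]; linarith)
    ha2.ne hz
  have s2 := summable_integral_norm_poissonPair_zero (Γ := Γ) (σ := b)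
    (by rw [hd, EReal.coe_lt_coe_iff]; linarith) (by rw [hd, EReal.coe_lt_coe_iff]; linarith)
    hb2.ne' hz
  refine (s1.add s2).congr fun β => ?_
  exact (integral_add (integrable_poissonPair 0 a z _).norm
    (integrable_poissonPair 0 b z _).norm).symm

/-! ### The integral of the product as a sum of Poisson integrals -/

theorem integrable_of_hasSum {ι α E : Type*} [Countable ι] [MeasurableSpace α] {μ : Measure α}
    [NormedAddCommGroup E] {F : ι → α → E} {f : α → E} (hF : ∀ i, Integrable (F i) μ)
    (hsum : Summable fun i => ∫ a, ‖F i a‖ ∂μ) (hf : ∀ᵐ a ∂μ, HasSum (fun i => F i a) (f a)) :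
    Integrable f μ := by
  refine ⟨aestronglyMeasurable_of_tendsto_ae (u := (atTop : Filter (Finset ι)))
    (f := fun S a => ∑ i ∈ S, F i a)
    (fun S => Finset.aestronglyMeasurable_fun_sum S fun i _ => (hF i).1) ?_, ?_⟩
  · filter_upwards [hf] with a ha using by simpa [HasSum] using ha
  · have h1 : ∫⁻ a, ‖f a‖ₑ ∂μ ≤ ∫⁻ a, ∑' i, ‖F i a‖ₑ ∂μ := lintegral_mono_ae (by
      filter_upwards [hf] with a ha
      rw [← ha.tsum_eq]
      exact enorm_tsum_le_tsum_enorm)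
    refine h1.trans_lt ?_
    rw [lintegral_tsum fun i => (hF i).1.enorm]
    simp only [← ofReal_integral_norm_eq_lintegral_enorm (hF _)]
    rw [← ENNReal.ofReal_tsum_of_nonneg (fun i => integral_nonneg fun a => norm_nonneg _) hsum]
    exact ENNReal.ofReal_lt_top

/-- The phase of the terms of the automorphic Green function. -/
def greenPhase (k : ℤ) (w : ℍ) (γ : SL2R) : ℂ := autFactor γ w ^ k * conj (autFactor γ w) ^ (-k)

theorem norm_greenPhase (k : ℤ) (w : ℍ) (γ : SL2R) : ‖greenPhase k w γ‖ = 1 := by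
  have h := norm_phase (autFactor γ w) (autFactor_ne_zero γ w) (-k)
  rwa [neg_neg] at h

/-- The product of the `γ⁻¹`-term and the `γ⁻¹β`-term of the two Eisenstein series. -/
def productTerm (k : ℤ) (s : ℂ) (z z' : ℍ) (β γ : SL2R) (ζ : ℝ) : ℂ :=
  eisensteinTerm k s z ζ γ⁻¹ * eisensteinTerm (-k) (1 - s) z' ζ (γ⁻¹ * β)

/-- Transporting both factors by `γ` leaves the identity term at `z` and the `β` term at `z'`,
evaluated at `γζ`; the factors `bden^(2s)` and `bden^(2(1-s))` combine to the inverse Jacobian. -/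
theorem productTerm_eq (k : ℤ) (s : ℂ) (z z' : ℍ) (β γ : SL2R) {ζ : ℝ} (h : bden γ ζ ≠ 0) :
    productTerm k s z z' β γ ζ = (1 / bden γ ζ ^ 2) •
      (greenPhase k z' β * poissonPair k s z (β • z') (bact γ ζ)) := by
  have e1 := eisensteinTerm_mul k s γ γ⁻¹ z h
  have e2 := eisensteinTerm_mul (-k) (1 - s) γ (γ⁻¹ * β) z' h
  rw [mul_inv_cancel, eisensteinTerm_one] at e1
  rw [mul_inv_cancel_left] at e2
  have hb : ((bden γ ζ ^ 2 : ℝ) : ℂ) ≠ 0 := by exact_mod_cast pow_ne_zero 2 h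
  have e3 : ((bden γ ζ ^ 2 : ℝ) : ℂ) ^ s * ((bden γ ζ ^ 2 : ℝ) : ℂ) ^ (1 - s) =
      ((bden γ ζ ^ 2 : ℝ) : ℂ) := by
    rw [← Complex.cpow_add _ _ hb, add_sub_cancel, Complex.cpow_one]
  have e4 : greenPhase k z' β * poissonPair k s z (β • z') (bact γ ζ) =
      ((bden γ ζ ^ 2 : ℝ) : ℂ) * productTerm k s z z' β γ ζ := by
    calc _ = weightPoisson k s z (bact γ ζ) *
          eisensteinTerm (-k) (1 - s) z' (bact γ ζ) β := by
          rw [greenPhase, poissonPair, eisensteinTerm, neg_neg]; ring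
      _ = _ := by
          rw [e1, e2, productTerm]
          linear_combination (eisensteinTerm k s z ζ γ⁻¹ *
            eisensteinTerm (-k) (1 - s) z' ζ (γ⁻¹ * β)) * e3
  rw [e4, Complex.real_smul, ← mul_assoc, ← Complex.ofReal_mul, one_div_mul_cancel (pow_ne_zero 2 h),
    Complex.ofReal_one, one_mul]

section Product

variable {D : Set ℝ} {k : ℤ} {s : ℂ} {z z' : ℍ}

theorem productTerm_ae_eq (k : ℤ) (s : ℂ) (z z' : ℍ) (β γ : SL2R) (D : Set ℝ) :
    productTerm k s z z' β γ =ᵐ[volume.restrict D] fun ζ => (1 / bden γ ζ ^ 2) •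
      (greenPhase k z' β * poissonPair k s z (β • z') (bact γ ζ)) := by
  filter_upwards [ae_restrict_of_ae (ae_bden_ne_zero γ)] with ζ hζ
  exact productTerm_eq k s z z' β γ hζ

theorem integrableOn_productTerm (hD : IsBdryFundamentalDomain Γ D) (β γ : SL2R) :
    IntegrableOn (productTerm k s z z' β γ) D :=
  (hD.integrableOn_unfold ((integrable_poissonPair k s z (β • z')).const_mul
    (greenPhase k z' β)) γ).congr (productTerm_ae_eq k s z z' β γ D).symm

theorem hasSum_integral_productTerm [Countable Γ] (hD : IsBdryFundamentalDomain Γ D)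
    (hΓ : IsConvexCocompact Γ) (β : SL2R) :
    HasSum (fun γ : Γ => ∫ ζ in D, productTerm k s z z' β γ ζ)
      (greenPhase k z' β * ∫ ζ, poissonPair k s z (β • z') ζ) := by
  have h := hD.hasSum_unfold hΓ ((integrable_poissonPair k s z (β • z')).const_mul
    (greenPhase k z' β))
  rw [integral_const_mul] at h
  exact h.congr_fun fun γ => integral_congr_ae (productTerm_ae_eq k s z z' β γ D)

theorem hasSum_integral_norm_productTerm [Countable Γ] (hD : IsBdryFundamentalDomain Γ D)
    (hΓ : IsConvexCocompact Γ) (β : SL2R) :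
    HasSum (fun γ : Γ => ∫ ζ in D, ‖productTerm k s z z' β γ ζ‖)
      (∫ ζ, ‖poissonPair k s z (β • z') ζ‖) := by
  refine (hD.hasSum_unfold hΓ (integrable_poissonPair k s z (β • z')).norm).congr_fun fun γ =>
    integral_congr_ae ?_
  filter_upwards [productTerm_ae_eq k s z z' β γ D] with ζ hζ
  rw [hζ, norm_smul, norm_mul, norm_greenPhase, one_mul, smul_eq_mul,
    Real.norm_of_nonneg (by positivity)]

theorem summable_integral_norm_productTerm [Countable Γ] (hD : IsBdryFundamentalDomain Γ D)
    (hΓ : IsConvexCocompact Γ)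
    (hs : Summable fun β : Γ => ∫ ζ, ‖poissonPair k s z ((β : SL2R) • z') ζ‖) :
    Summable fun p : Γ × Γ => ∫ ζ in D, ‖productTerm k s z z' p.1 p.2 ζ‖ := by
  rw [summable_prod_of_nonneg fun p => integral_nonneg fun ζ => norm_nonneg _]
  refine ⟨fun β => (hasSum_integral_norm_productTerm hD hΓ β).summable, ?_⟩
  simpa only [(hasSum_integral_norm_productTerm hD hΓ _).tsum_eq] using hs

theorem hasSum_productTerm (h : criticalExponent Γ < (s.re : EReal))
    (h' : criticalExponent Γ < ((1 - s.re : ℝ) : EReal)) {ζ : ℝ} (hζ : ζ ∈ omegaReal Γ) :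
    HasSum (fun p : Γ × Γ => productTerm k s z z' p.1 p.2 ζ)
      (eisenstein Γ k s z ζ * eisenstein Γ (-k) (1 - s) z' ζ) := by
  have s1 := summable_eisensteinTerm (k := k) (pos_of_criticalExponent_lt h) h z hζ
  have s2 := summable_eisensteinTerm (k := -k) (s := 1 - s)
    (by simpa using pos_of_criticalExponent_lt h') (by simpa using h') z' hζ
  have hm : HasSum (fun q : Γ × Γ =>
      eisensteinTerm k s z ζ q.1 * eisensteinTerm (-k) (1 - s) z' ζ q.2)
      (eisenstein Γ k s z ζ * eisenstein Γ (-k) (1 - s) z' ζ) := by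
    rw [eisenstein, eisenstein, tsum_mul_tsum_of_summable_norm s1 s2]
    exact (summable_mul_of_summable_norm s1 s2).hasSum
  -- The change of indices `(β, γ) ↦ (γ⁻¹, γ⁻¹β)` isolates the relative position `β`, leaving `γ`
  -- free for unfolding.
  let e : Γ × Γ ≃ Γ × Γ :=
    { toFun := fun p => (p.2⁻¹, p.2⁻¹ * p.1)
      invFun := fun q => (q.1⁻¹ * q.2, q.1⁻¹)
      left_inv := fun p => by simp
      right_inv := fun q => by simp }
  refine (e.hasSum_iff.2 hm).congr_fun fun p => ?_
  simp only [Function.comp_apply, e, Equiv.coe_fn_mk, productTerm, Subgroup.coe_inv,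
    Subgroup.coe_mul]

/-- Unfolding the norms first makes the double family absolutely summable in `L¹(D)`; sum and
integral may then be exchanged and the sum over `γ` performed for each `β`. -/
theorem integral_eisenstein_mul [Countable Γ] (hD : IsBdryFundamentalDomain Γ D)
    (hΓ : IsConvexCocompact Γ) (h : criticalExponent Γ < (s.re : EReal))
    (h' : criticalExponent Γ < ((1 - s.re : ℝ) : EReal))
    (hs : Summable fun β : Γ => ∫ ζ, ‖poissonPair k s z ((β : SL2R) • z') ζ‖) :
    IntegrableOn (fun ζ => eisenstein Γ k s z ζ * eisenstein Γ (-k) (1 - s) z' ζ) D ∧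
    ∫ ζ in D, eisenstein Γ k s z ζ * eisenstein Γ (-k) (1 - s) z' ζ =
      ∑' β : Γ, greenPhase k z' β * ∫ ζ, poissonPair k s z ((β : SL2R) • z') ζ := by
  have hsum := summable_integral_norm_productTerm (z := z) (z' := z') hD hΓ hs
  have hint : ∀ p : Γ × Γ, IntegrableOn (productTerm k s z z' p.1 p.2) D := fun p =>
    integrableOn_productTerm hD _ _
  have hpt : ∀ᵐ ζ ∂volume.restrict D, HasSum (fun p : Γ × Γ => productTerm k s z z' p.1 p.2 ζ)
      (eisenstein Γ k s z ζ * eisenstein Γ (-k) (1 - s) z' ζ) := by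
    filter_upwards [ae_restrict_mem hD.measurable] with ζ hζ
    exact hasSum_productTerm h h' (hD.subset ζ hζ)
  refine ⟨integrable_of_hasSum hint hsum hpt, ?_⟩
  have h1 := hasSum_integral_of_summable_integral_norm hint hsum
  have h2 : ∫ ζ in D, ∑' p : Γ × Γ, productTerm k s z z' p.1 p.2 ζ =
      ∫ ζ in D, eisenstein Γ k s z ζ * eisenstein Γ (-k) (1 - s) z' ζ :=
    integral_congr_ae (by filter_upwards [hpt] with ζ hζ using hζ.tsum_eq)
  rw [h2] at h1
  exact (h1.prod_fiberwise fun β => hasSum_integral_productTerm hD hΓ β).tsum_eq.symm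

end Product

/-! ### The product formula -/

theorem green_add_green {k : ℤ} (hk : k = 0 ∨ k = 1 ∨ k = -1) {s : ℂ}
    (h : criticalExponent Γ < (s.re : EReal)) (h' : criticalExponent Γ < ((1 - s.re : ℝ) : EReal))
    (hs : s ≠ 1 / 2) {z z' : ℍ} (hz : ∀ γ ∈ Γ, z ≠ γ • z') :
    green Γ k s z z' + green Γ k (1 - s) z z' =
      ∑' β : Γ, greenPhase k z' β * ∫ ζ, poissonPair k s z ((β : SL2R) • z') ζ := by
  have h0 := pos_of_criticalExponent_lt h
  have h1 := pos_of_criticalExponent_lt h'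
  rw [green, green, ← (summable_greenTerm h0 h hz).tsum_add
    (summable_greenTerm (s := 1 - s) (by simpa using h1) (by simpa using h') hz)]
  refine tsum_congr fun β => ?_
  rw [integral_poissonPair_eq_greenKernel hk h0 (by linarith) hs (hz β β.2), mul_add]
  rfl

theorem continuous_weightPoisson (k : ℤ) (z : ℍ) (ζ : ℝ) :
    Continuous fun s => weightPoisson k s z ζ := by
  unfold weightPoisson
  refine continuous_const.mul (continuous_id.const_cpow (Or.inl ?_))
  exact_mod_cast (poissonKernel_pos z ζ).ne'

theorem continuous_poissonPair (k : ℤ) (z w : ℍ) (ζ : ℝ) :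
    Continuous fun s => poissonPair k s z w ζ :=
  (continuous_weightPoisson k z ζ).mul
    ((continuous_weightPoisson (-k) w ζ).comp (continuous_const.sub continuous_id))

theorem eventually_re_mem {s : ℂ} {a b : ℝ} (ha : a < s.re) (hb : s.re < b) :
    ∀ᶠ t : ℂ in 𝓝 s, a < t.re ∧ t.re < b :=
  (Complex.continuous_re.tendsto s).eventually (Ioo_mem_nhds ha hb)

theorem tendsto_integral_poissonPair (k : ℤ) (s : ℂ) (z w : ℍ) :
    Tendsto (fun t => ∫ ζ, poissonPair k t z w ζ) (𝓝 s) (𝓝 (∫ ζ, poissonPair k s z w ζ)) := by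
  refine tendsto_integral_filter_of_dominated_convergence
    (pairBound (s.re - 1) (s.re + 1) z w)
    (Eventually.of_forall fun t => (integrable_poissonPair k t z w).1) ?_
    (integrable_pairBound _ _ z w)
    (Eventually.of_forall fun ζ => (continuous_poissonPair k z w ζ).tendsto s)
  filter_upwards [eventually_re_mem (sub_one_lt s.re) (lt_add_one s.re)] with t ht
  exact Eventually.of_forall fun ζ => norm_poissonPair_le k ht.1.le ht.2.le z w ζ

theorem integral_norm_poissonPair_le (k : ℤ) {s : ℂ} {a b : ℝ} (ha : a ≤ s.re) (hb : s.re ≤ b)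
    (z w : ℍ) : ∫ ζ, ‖poissonPair k s z w ζ‖ ≤ ∫ ζ, pairBound a b z w ζ :=
  integral_mono (integrable_poissonPair k s z w).norm (integrable_pairBound a b z w)
    fun ζ => norm_poissonPair_le k ha hb z w ζ

/-- The majorant `pairBound` serves every exponent with real part between `a` and `b`, so dominated
convergence applies to the sum over the group. -/
theorem tendsto_tsum_integral_poissonPair (k : ℤ) {s : ℂ} {a b : ℝ} (ha : a < s.re) (hb : s.re < b)
    {z z' : ℍ} (hsum : Summable fun β : Γ => ∫ ζ, pairBound a b z ((β : SL2R) • z') ζ) :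
    Tendsto (fun t => ∑' β : Γ, greenPhase k z' β * ∫ ζ, poissonPair k t z ((β : SL2R) • z') ζ)
      (𝓝 s) (𝓝 (∑' β : Γ, greenPhase k z' β * ∫ ζ, poissonPair k s z ((β : SL2R) • z') ζ)) := by
  refine tendsto_tsum_of_dominated_convergence hsum
    (fun β => (tendsto_integral_poissonPair k s z _).const_mul _) ?_
  filter_upwards [eventually_re_mem ha hb] with t ht β
  rw [norm_mul, norm_greenPhase, one_mul]
  exact (norm_integral_le_integral_norm _).trans
    (integral_norm_poissonPair_le k ht.1.le ht.2.le z _)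

end HypProduct

end

open HypProduct in
/-- Product formula for Eisenstein series of weight `k = 0, ±1` on convex cocompact subgroups of
`SL(2, ℝ)` with `δ(Γ) < 1/2`. At `s = 1/2`, where both Green functions have a pole, their sum is
understood as its limit. -/
theorem theorem1p5 (Γ : Subgroup SL2R) (hΓ : IsConvexCocompact Γ)
    (hδ : criticalExponent Γ < ((1 / 2 : ℝ) : EReal))
    (k : ℤ) (hk : k = 0 ∨ k = 1 ∨ k = -1)
    (z z' : ℍ) (hz : ∀ γ ∈ Γ, z ≠ γ • z') :
    (∃ D : Set ℝ, IsBdryFundamentalDomain Γ D) ∧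
    ∀ s : ℂ, criticalExponent Γ < (s.re : EReal) → (s.re : EReal) < 1 - criticalExponent Γ →
      (∀ ζ : ℝ, (ζ : OnePoint ℝ) ∈ discontinuitySet Γ →
        Summable (fun γ : Γ => eisensteinTerm k s z ζ γ) ∧
        Summable (fun γ : Γ => eisensteinTerm (-k) (1 - s) z' ζ γ)) ∧
      (s ≠ 1 / 2 →
        Summable (fun γ : Γ => greenTerm k s z z' γ) ∧
        Summable (fun γ : Γ => greenTerm k (1 - s) z z' γ)) ∧
      ∀ D : Set ℝ, IsBdryFundamentalDomain Γ D →
        MeasureTheory.IntegrableOn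
          (fun ζ => eisenstein Γ k s z ζ * eisenstein Γ (-k) (1 - s) z' ζ) D ∧
        (s ≠ 1 / 2 →
          ∫ ζ in D, eisenstein Γ k s z ζ * eisenstein Γ (-k) (1 - s) z' ζ
            = green Γ k s z z' + green Γ k (1 - s) z z') ∧
        (s = 1 / 2 →
          Filter.Tendsto (fun t : ℂ => green Γ k t z z' + green Γ k (1 - t) z z')
            (nhdsWithin s {s}ᶜ)
            (nhds (∫ ζ in D, eisenstein Γ k s z ζ * eisenstein Γ (-k) (1 - s) z' ζ))) := by
  have hcount := countable_of_criticalExponent_lt hδ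
  refine ⟨⟨_, dirichletDomain_isBdryFundamentalDomain hΓ hδ⟩, fun s h h1 => ?_⟩
  obtain ⟨d, hd⟩ := exists_criticalExponent_eq h
  have hds : d < s.re := by rwa [hd, EReal.coe_lt_coe_iff] at h
  have hds' : s.re < 1 - d := by
    rw [hd, ← EReal.coe_one, ← EReal.coe_sub, EReal.coe_lt_coe_iff] at h1
    exact h1
  have h' : criticalExponent Γ < ((1 - s.re : ℝ) : EReal) := by
    rw [hd, EReal.coe_lt_coe_iff]; linarith
  have h0 := pos_of_criticalExponent_lt h
  have h0' : 0 < (1 - s).re := by simpa using pos_of_criticalExponent_lt h'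
  have hre' : criticalExponent Γ < ((1 - s).re : EReal) := by simpa using h'
  refine ⟨fun ζ hζ => ⟨(summable_eisensteinTerm h0 h z hζ).of_norm,
    (summable_eisensteinTerm h0' hre' z' hζ).of_norm⟩,
    fun _ => ⟨summable_greenTerm h0 h hz, summable_greenTerm h0' hre' hz⟩, fun D hD => ?_⟩
  obtain ⟨a, b, ha, hb, hsum⟩ := exists_summable_pairBound hδ h h' hz
  obtain ⟨hint, heq⟩ := integral_eisenstein_mul (k := k) hD hΓ h h'
    (Summable.of_nonneg_of_le (fun β => MeasureTheory.integral_nonneg fun ζ => norm_nonneg _)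
      (fun β => integral_norm_poissonPair_le k ha.le hb.le z _) hsum)
  refine ⟨hint, fun hs => by rw [heq, green_add_green hk h h' hs hz], fun hs => ?_⟩
  rw [heq]
  -- For `t ≠ 1/2` near `1/2` the Green functions add up to the unfolded series, which is continuous
  -- at `1/2` although each of them has a pole there.
  refine Filter.Tendsto.congr' ?_
    ((tendsto_tsum_integral_poissonPair k ha hb hsum).mono_left nhdsWithin_le_nhds)
  filter_upwards [self_mem_nhdsWithin,
    nhdsWithin_le_nhds (eventually_re_mem hds hds')] with t ht ht'
  refine (green_add_green hk ?_ ?_ (fun e => ht (e.trans hs.symm)) hz).symm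
  · rw [hd, EReal.coe_lt_coe_iff]; exact ht'.1
  · rw [hd, EReal.coe_lt_coe_iff]; linarith [ht'.2]
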